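/- An instance of the model-checking problem for linear dynamical systems is a tuple $(v,A,\mathcal T,\mathcal L)$ with $v\in\mathbb Q^m$, $A\in\mathbb Q^{m\times m}$, a finite family $\mathcal T=(T_1,\dots,T_h)$ of semialgebraic subsets of $\mathbb R^m$ (each given by a Boolean combination of equalities and inequalities between polynomials with integer coefficients), and an $\omega$-regular language $\mathcal L$ over the alphabet of all subsets of $\mathcal T$ (given by a deterministic Muller automaton). It asks whether the characteristic word $\alpha$, where $T_i\in\alpha(n)$ if and only if $A^nv\in T_i$, belongs to $\mathcal L$. It is an instance $(\mu,M,\mathcal T,\mathcal L)$ of the model-checking problem for Markov chains if the initial vector $\mu$ is a probability distribution and the update matrix $M$ is column-stochastic. The dynamical dimension of $M$ is the number of its nonzero complex eigenvalues of modulus less than $1$, counted with algebraic multiplicity. The intrinsic dimension of a semialgebraic set is the largest $d$ such that a cell semialgebraically homeomorphic to $(0,1)^d$ occurs in a decomposition of it into finitely many semialgebraic cells ($-\infty$ for the empty set); its linear dimension is the dimension of the smallest linear subspace containing it. Theorem. There is a computable function that maps every instance $(\mu,M,\mathcal T,\mathcal L)$ of the model-checking problem for Markov chains to an instance $(v,A,\mathcal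 T',\mathcal L')$ of the model-checking problem for linear dynamical systems with the same answer, such that for all $k,d_1\ge 0$ and $d_2\ge 1$: if (a) $M$ has dynamical dimension $k$, and (b) all targets in $\mathcal T$ have intrinsic dimension at most $d_1$ and linear dimension at most $d_2$, then (A) $A$ is an invertible rational $k\times k$ matrix, and (B) all targets in $\mathcal T'$ have intrinsic dimension at most $d_1$ and linear dimension at most $d_2-1$. -/

import Mathlib

namespace DistMC

/-! ### Semialgebraic sets -/

/-- A polynomial in `k` variables with integer coefficients, written as a finite sum of monomials
`c * x₁ ^ e₁ * ⋯ * x_k ^ e_k`, each given by its coefficient and its exponent vector. -/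
abbrev IntPoly (k : ℕ) : Type := List (ℤ × (Fin k → ℕ))

/-- The value of a polynomial at a real point. -/
noncomputable def IntPoly.eval {k : ℕ} (p : IntPoly k) (x : Fin k → ℝ) : ℝ :=
  (p.map fun t => (t.1 : ℝ) * ∏ i, x i ^ t.2 i).sum

/-- Boolean combinations of polynomial equalities `p = 0` and inequalities `p > 0`. -/
inductive SAFormula (k : ℕ) : Type
  | eq (p : IntPoly k) : SAFormula k
  | pos (p : IntPoly k) : SAFormula k
  | not (φ : SAFormula k) : SAFormula k
  | and (φ ψ : SAFormula k) : SAFormula k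
  | or (φ ψ : SAFormula k) : SAFormula k

/-- The subset of `ℝ^k` defined by a formula. -/
def SAFormula.toSet {k : ℕ} : SAFormula k → Set (Fin k → ℝ)
  | .eq p => {x | p.eval x = 0}
  | .pos p => {x | 0 < p.eval x}
  | .not φ => φ.toSetᶜ
  | .and φ ψ => φ.toSet ∩ ψ.toSet
  | .or φ ψ => φ.toSet ∪ ψ.toSet

/-- A set is semialgebraic if it is defined by a Boolean combination of polynomial (in)equalities
with integer coefficients. -/
def IsSemialgebraic {k : ℕ} (S : Set (Fin k → ℝ)) : Prop :=
  ∃ φ : SAFormula k, φ.toSet = S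

/-- The open cube `(0, 1)^d`; for `d = 0` it is a single point. -/
def openCube (d : ℕ) : Set (Fin d → ℝ) := {y | ∀ i, y i ∈ Set.Ioo (0 : ℝ) 1}

/-- `C` is a semialgebraic cell of dimension `d`: a semialgebraic set which is semialgebraically
homeomorphic to `(0, 1)^d`, i.e. by a homeomorphism with semialgebraic graph. -/
def IsCell {k : ℕ} (d : ℕ) (C : Set (Fin k → ℝ)) : Prop :=
  IsSemialgebraic C ∧
    ∃ e : C ≃ₜ openCube d,
      IsSemialgebraic {z : Fin (k + d) → ℝ |
        ∃ x : C, z = Fin.append (x : Fin k → ℝ) (e x : Fin d → ℝ)}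

/-- The intrinsic dimension of a semialgebraic set `T`: the largest dimension of a cell occurring
in a decomposition of `T` into finitely many cells. It does not depend on the decomposition, and
every cell `C ⊆ T` occurs in one (decompose the semialgebraic set `T \ C` further), so it is the
largest `d` such that `T` contains a cell of dimension `d`. The empty set has dimension `⊥`. -/
noncomputable def intrinsicDim {k : ℕ} (T : Set (Fin k → ℝ)) : WithBot ℕ∞ :=
  ⨆ (d : ℕ) (_ : ∃ C : Set (Fin k → ℝ), C ⊆ T ∧ IsCell d C), (d : WithBot ℕ∞)

/-- The linear dimension of a set: the dimension of the smallest linear subspace containing it. -/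
noncomputable def linearDim {k : ℕ} (T : Set (Fin k → ℝ)) : ℕ :=
  Module.finrank ℝ (Submodule.span ℝ T)

/-! ### Deterministic Muller automata -/

/-- A deterministic Muller automaton over the alphabet `σ`, with states `0, …, numStates - 1`. -/
structure MullerAutomaton (σ : Type) where
  numStates : ℕ
  start : Fin numStates
  step : Fin numStates → σ → Fin numStates
  family : Finset (Finset (Fin numStates))

/-- The run of the automaton on an infinite word. -/
def MullerAutomaton.run {σ : Type} (A : MullerAutomaton σ) (w : ℕ → σ) : ℕ → Fin A.numStates
  | 0 => A.start
  | n + 1 => A.step (A.run w n) (w n)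

/-- The `ω`-language accepted by the automaton: the words for which the set of states visited
infinitely often belongs to the acceptance family. -/
def MullerAutomaton.language {σ : Type} (A : MullerAutomaton σ) : Set (ℕ → σ) :=
  {w | ∃ F ∈ A.family, ∀ q, q ∈ F ↔ ∃ᶠ n in Filter.atTop, A.run w n = q}

/-! ### The model-checking problem -/

/-- An instance of the model-checking problem for linear dynamical systems: a rational initial
vector, a rational update matrix, finitely many semialgebraic targets (given by formulas), and an
`ω`-regular language over the subsets of the set of targets (given by a Muller automaton). -/
structure Instance where
  dim : ℕ
  init : Fin dim → ℚ
  mat : Matrix (Fin dim) (Fin dim) ℚ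
  numTargets : ℕ
  target : Fin numTargets → SAFormula dim
  automaton : MullerAutomaton (Finset (Fin numTargets))

/-- The point `Aⁿ v` of the trajectory, as a real vector. -/
def Instance.orbit (I : Instance) (n : ℕ) : Fin I.dim → ℝ :=
  fun i => (((I.mat ^ n).mulVec I.init i : ℚ) : ℝ)

open Classical in
/-- The characteristic word: its `n`-th letter is the set of the targets that contain `Aⁿ v`. -/
noncomputable def Instance.charWord (I : Instance) (n : ℕ) : Finset (Fin I.numTargets) :=
  Finset.univ.filter fun i => I.orbit n ∈ (I.target i).toSet

/-- The question asked of an instance: does its characteristic word belong to the language? -/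
def Instance.Holds (I : Instance) : Prop := I.charWord ∈ I.automaton.language

/-- The instances of the model-checking problem for Markov chains: the initial vector is a
distribution and the update matrix is column-stochastic. -/
def Instance.IsMarkovChain (I : Instance) : Prop :=
  I.init ∈ stdSimplex ℚ (Fin I.dim) ∧ I.mat ∈ Matrix.colStochastic ℚ (Fin I.dim)

/-- The number of nonzero complex eigenvalues of modulus less than `1`, counted with algebraic
multiplicity. -/
noncomputable def dynamicalDim {m : ℕ} (M : Matrix (Fin m) (Fin m) ℚ) : ℕ :=
  ((M.map (fun q : ℚ => (q : ℂ))).charpoly.roots.countP fun z => z ≠ 0 ∧ ‖z‖ < 1)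

/-! ### Instances as finite data, for computability -/

/-- The `b`-th subset of `{0, …, n - 1}`, read off from the binary digits of `b`; as `b` runs
through `0, …, 2 ^ n - 1`, every subset occurs exactly once. -/
def subsetOfBits (n b : ℕ) : Finset (Fin n) := Finset.univ.filter fun i => b.testBit i = true

/-- A rational number as numerator and denominator. -/
def ratCode (q : ℚ) : ℤ × ℕ := (q.num, q.den)

/-- A polynomial as a list of coefficients and exponent lists. -/
def polyCode {k : ℕ} (p : IntPoly k) : List (ℤ × List ℕ) :=
  p.map fun t => (t.1, List.ofFn t.2)

/-- A formula as a natural number. -/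
def SAFormula.code {k : ℕ} : SAFormula k → ℕ
  | .eq p => Nat.pair 0 (Encodable.encode (polyCode p))
  | .pos p => Nat.pair 1 (Encodable.encode (polyCode p))
  | .not φ => Nat.pair 2 φ.code
  | .and φ ψ => Nat.pair 3 (Nat.pair φ.code ψ.code)
  | .or φ ψ => Nat.pair 4 (Nat.pair φ.code ψ.code)

/-- Number of states, initial state, transition table, and acceptance table. -/
abbrev AutomatonCode : Type := ℕ × ℕ × List (List ℕ) × List Bool

/-- An automaton over the subsets of `{0, …, h - 1}` as finite data. -/
def MullerAutomaton.code {h : ℕ} (A : MullerAutomaton (Finset (Fin h))) : AutomatonCode :=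
  (A.numStates, (A.start : ℕ),
    List.ofFn fun q : Fin A.numStates =>
      List.ofFn fun b : Fin (2 ^ h) => (A.step q (subsetOfBits h b) : ℕ),
    List.ofFn fun b : Fin (2 ^ A.numStates) => decide (subsetOfBits A.numStates b ∈ A.family))

/-- Dimension, initial vector, rows of the update matrix, formulas for the targets, automaton. -/
abbrev InstanceCode : Type :=
  ℕ × List (ℤ × ℕ) × List (List (ℤ × ℕ)) × List ℕ × AutomatonCode

/-- An instance as finite data. -/
def Instance.code (I : Instance) : InstanceCode :=
  (I.dim,
    List.ofFn fun i => ratCode (I.init i),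
    List.ofFn fun i => List.ofFn fun j => ratCode (I.mat i j),
    List.ofFn fun i => (I.target i).code,
    I.automaton.code)

/-! The finite data determine the instance. -/

theorem polyCode_injective {k : ℕ} : Function.Injective (polyCode (k := k)) := by
  intro p q h
  refine List.map_injective_iff.2 ?_ h
  rintro ⟨a, e⟩ ⟨b, e'⟩ h
  simp only [Prod.mk.injEq] at h
  rw [h.1, List.ofFn_injective h.2]

theorem SAFormula.code_injective {k : ℕ} : Function.Injective (SAFormula.code (k := k)) := by
  intro φ
  induction φ with
  | eq p =>
    intro χ h
    cases χ <;> simp [SAFormula.code, Nat.pair_eq_pair] at h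
    rw [polyCode_injective h]
  | pos p =>
    intro χ h
    cases χ <;> simp [SAFormula.code, Nat.pair_eq_pair] at h
    rw [polyCode_injective h]
  | not φ ih =>
    intro χ h
    cases χ <;> simp [SAFormula.code, Nat.pair_eq_pair] at h
    rw [ih h]
  | and φ ψ ih ih' =>
    intro χ h
    cases χ <;> simp [SAFormula.code, Nat.pair_eq_pair] at h
    rw [ih h.1, ih' h.2]
  | or φ ψ ih ih' =>
    intro χ h
    cases χ <;> simp [SAFormula.code, Nat.pair_eq_pair] at h
    rw [ih h.1, ih' h.2]

theorem exists_bits {n : ℕ} (s : Finset (Fin n)) : ∃ b : Fin (2 ^ n), subsetOfBits n b = s := by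
  classical
  let v : BitVec n := BitVec.ofFnLE (fun i => decide (i ∈ s))
  refine ⟨v.toFin, ?_⟩
  ext i
  simp only [subsetOfBits, Finset.mem_filter, Finset.mem_univ, true_and]
  have : v.toNat.testBit i = v.getLsbD i := rfl
  change v.toNat.testBit i = true ↔ _
  rw [this]
  simp [v]

theorem ratCode_injective : Function.Injective ratCode := by
  intro p q h
  simp only [ratCode, Prod.mk.injEq] at h
  exact Rat.ext h.1 h.2

theorem MullerAutomaton.code_injective {h : ℕ} : Function.Injective (MullerAutomaton.code (h := h)) := by
  rintro ⟨n, s, d, F⟩ ⟨n', s', d', F'⟩ hh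
  simp only [MullerAutomaton.code, Prod.mk.injEq] at hh
  obtain ⟨rfl, h1, h2, h3⟩ := hh
  have h2 := List.ofFn_injective h2
  have h3 := List.ofFn_injective h3
  congr 1
  · exact Fin.ext h1
  · funext q a
    obtain ⟨b, rfl⟩ := exists_bits a
    exact Fin.ext (congrFun (List.ofFn_injective (congrFun h2 q)) b)
  · ext a
    obtain ⟨b, rfl⟩ := exists_bits a
    simpa using congrFun h3 b

theorem Instance.code_injective : Function.Injective Instance.code := by
  rintro ⟨m, v, A, h, T, L⟩ ⟨m', v', A', h', T', L'⟩ hh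
  simp only [Instance.code, Prod.mk.injEq] at hh
  obtain ⟨rfl, h1, h2, h3, h4⟩ := hh
  have : h = h' := by simpa using congrArg List.length h3
  subst this
  have h1 := List.ofFn_injective h1
  have h2 := List.ofFn_injective h2
  have h3 := List.ofFn_injective h3
  congr 1
  · exact funext fun i => ratCode_injective (congrFun h1 i)
  · ext i j : 2
    exact ratCode_injective (congrFun (List.ofFn_injective (congrFun h2 i)) j)
  · exact funext fun i => SAFormula.code_injective (congrFun h3 i)
  · exact MullerAutomaton.code_injective h4

end DistMC

/-!
# Reduction of Markov chains to linear dynamical systems of the dynamical dimension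

**Decomposition.** The eigenvalues of modulus `1` of a stochastic matrix `M` are roots of unity
(`eigenvalue_of_colStochastic`), and as the powers of `M` are bounded, they are semisimple
(`pow_mulVec_eq_of_colStochastic`). With `L = m !`, the Fitting decomposition with respect to
`M * (M ^ L - 1)` splits the space into a summand on which `M` is an invertible matrix `A` whose powers
tend to zero, and one on which the powers of `M` are eventually periodic
(`exists_decomposition_of_colStochastic`). The dimension `k` of the first summand is the dynamical
dimension (`DistMC.dynamicalDim_eq`), and its vectors have coordinate sum `0`. Hence the
trajectory satisfies `M ^ (s₀ + n) μ = (ω (n % L) + P Aⁿ v) / δ` for some start time `s₀`, a vector `v`,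
integral vectors `ω r` with nonzero coordinate sum, and an integral injective matrix `P` whose columns
have sum `0`.

**Targets and automaton.** The new system has the matrix `A`, the initial vector `v`, and for each
phase `r < L` and target `T` the preimage of `T` under `x ↦ (ω r + P x) / δ`, restricted to a small cube
around the origin, which the trajectory never leaves. The prefix of length `s₀` only determines the
initial state of the automaton, and the phase is counted by the automaton
(`DistMC.MullerAutomaton.phased`). An affine embedding does not increase the intrinsic dimension
(`DistMC.intrinsicDim_mono_image`). The linear dimension decreases (`DistMC.linearDim_le_of_affinePoint`)
if the preimage is empty or has the origin in its closure: in the latter case, `ω r` is in the span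
of `T`, but not in the hyperplane of coordinate sum `0`, which contains the image of `P`.

**The size of the cube.** The cube has to be so small that a preimage that meets it has the origin in its
closure, and its size has to be computable from the formula (`DistMC.SAFormula.zero_mem_closure`). This
is an effective form of quantifier elimination: if two points give the same signs to all integer
polynomials of a certain size, then to each further coordinate in `[-1, 1]` of the first point there
corresponds one of the second point such that the signs of polynomials of smaller size still agree
(`matched_polyFam`). In one variable, the roots of a family of polynomials and the sign patterns between
them are determined by induction on the degree, by pseudo-division and Thom's lemma. Applied to a point
`x` together with a bound `t` for its coordinates, this moves `x` towards the origin along with `t`, as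
the signs of polynomials in `t` alone are constant near `0`.

**Computability.** All the data above are recorded in a finite list of rational numbers, and it is
primitive recursive to check that a list is such a certificate (`DistMC.primrec_ok`). Certificates exist
(`DistMC.exists_cert`), so they can be searched for, and every certificate gives a correct reduction
(`DistMC.exists_reduceBy`).
-/

/-! ### Signs of real polynomials -/

section Thom

open Polynomial

theorem sign_eval_eq_of_forall_ne {p : ℝ[X]} {u v : ℝ} (h : ∀ w ∈ Set.uIcc u v, p.eval w ≠ 0) :
    SignType.sign (p.eval u) = SignType.sign (p.eval v) := by
  by_contra hne
  have hc : ContinuousOn (fun w => p.eval w) (Set.uIcc u v) := p.continuous.continuousOn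
  have h0 : (0 : ℝ) ∈ Set.uIcc (p.eval u) (p.eval v) := by
    have hu := h u Set.left_mem_uIcc
    have hv := h v Set.right_mem_uIcc
    rw [Set.mem_uIcc]
    rcases lt_or_gt_of_ne hu with h1 | h1 <;> rcases lt_or_gt_of_ne hv with h2 | h2
    · simp [sign_neg h1, sign_neg h2] at hne
    · left; constructor <;> linarith
    · right; constructor <;> linarith
    · simp [sign_pos h1, sign_pos h2] at hne
  obtain ⟨w, hw, hw0⟩ := intermediate_value_uIcc hc h0
  exact h w hw hw0

theorem eval_lt_eval_of_derivative_pos {p : ℝ[X]} {u v : ℝ} (huv : u < v)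
    (h : ∀ w ∈ Set.Ioo u v, 0 < p.derivative.eval w) : p.eval u < p.eval v := by
  have : StrictMonoOn (fun w => p.eval w) (Set.Icc u v) := by
    apply strictMonoOn_of_deriv_pos (convex_Icc u v) p.continuous.continuousOn
    intro w hw
    rw [interior_Icc] at hw
    simpa using h w hw
  exact this ⟨le_rfl, huv.le⟩ ⟨huv.le, le_rfl⟩ huv

theorem eval_le_eval_of_derivative_nonneg {p : ℝ[X]} {u v : ℝ} (huv : u ≤ v)
    (h : ∀ w ∈ Set.Ioo u v, 0 ≤ p.derivative.eval w) : p.eval u ≤ p.eval v := by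
  have : MonotoneOn (fun w => p.eval w) (Set.Icc u v) := by
    apply monotoneOn_of_deriv_nonneg (convex_Icc u v) p.continuous.continuousOn
      p.differentiable.differentiableOn
    intro w hw
    rw [interior_Icc] at hw
    simpa using h w hw
  exact this ⟨le_rfl, huv⟩ ⟨huv, le_rfl⟩ huv

/-- Thom's lemma: if a polynomial and all its derivatives have the same signs at the endpoints of
an interval, then the polynomial has constant sign on the interval. -/
theorem sign_eval_eq_of_iterate_derivative {p : ℝ[X]} {u v : ℝ}
    (h : ∀ j, SignType.sign ((derivative^[j] p).eval u) = SignType.sign ((derivative^[j] p).eval v))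
    {w : ℝ} (hw : w ∈ Set.Icc u v) : SignType.sign (p.eval w) = SignType.sign (p.eval u) := by
  induction hn : p.natDegree using Nat.strong_induction_on generalizing p w with
  | _ n ih =>
  rcases Nat.eq_zero_or_pos n with rfl | hpos
  · rw [Polynomial.eq_C_of_natDegree_eq_zero hn]; simp
  have hd : ∀ x ∈ Set.Icc u v,
      SignType.sign (p.derivative.eval x) = SignType.sign (p.derivative.eval u) := by
    intro x hx
    exact ih _ (hn ▸ natDegree_derivative_lt (by omega)) (p := p.derivative)
      (fun j => h (j + 1)) hx rfl
  have hends : SignType.sign (p.eval u) = SignType.sign (p.eval v) := h 0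
  have key : p.eval w ∈ Set.uIcc (p.eval u) (p.eval v) := by
    rcases le_total 0 (p.derivative.eval u) with h0 | h0
    · have hd' : ∀ x ∈ Set.Icc u v, 0 ≤ p.derivative.eval x := fun x hx => by
        rw [← sign_nonneg_iff, hd x hx, sign_nonneg_iff]; exact h0
      rw [Set.mem_uIcc]; left
      exact ⟨eval_le_eval_of_derivative_nonneg hw.1
          fun x hx => hd' x ⟨hx.1.le, hx.2.le.trans hw.2⟩,
        eval_le_eval_of_derivative_nonneg hw.2 fun x hx => hd' x ⟨hw.1.trans hx.1.le, hx.2.le⟩⟩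
    · have hd' : ∀ x ∈ Set.Icc u v, 0 ≤ (-p).derivative.eval x := fun x hx => by
        have : p.derivative.eval x ≤ 0 := by
          rw [← sign_nonpos_iff, hd x hx, sign_nonpos_iff]; exact h0
        simpa using this
      rw [Set.mem_uIcc]; right
      have h1 := eval_le_eval_of_derivative_nonneg hw.1
          fun x hx => hd' x ⟨hx.1.le, hx.2.le.trans hw.2⟩
      have h2 := eval_le_eval_of_derivative_nonneg hw.2
          fun x hx => hd' x ⟨hw.1.trans hx.1.le, hx.2.le⟩
      simp only [eval_neg, neg_le_neg_iff] at h1 h2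
      exact ⟨h2, h1⟩
  rw [Set.mem_uIcc] at key
  rcases key with ⟨k1, k2⟩ | ⟨k1, k2⟩
  · apply le_antisymm
    · rw [hends]; exact SignType.sign.monotone k2
    · exact SignType.sign.monotone k1
  · apply le_antisymm
    · exact SignType.sign.monotone k2
    · rw [hends]; exact SignType.sign.monotone k1

/-- By Thom's lemma, if all proper derivatives of a polynomial have the same signs at `u < v`, then
the sign of the first derivative decides how the values at `u` and `v` compare. -/
theorem sign_eval_sub_eq_of_iterate_derivative {p : ℝ[X]} {u v : ℝ} (huv : u < v)
    (h : ∀ j, SignType.sign ((derivative^[j + 1] p).eval u) =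
      SignType.sign ((derivative^[j + 1] p).eval v)) :
    SignType.sign (p.eval v - p.eval u) = SignType.sign (p.derivative.eval u) := by
  have hd : ∀ x ∈ Set.Icc u v,
      SignType.sign (p.derivative.eval x) = SignType.sign (p.derivative.eval u) := fun x hx =>
    sign_eval_eq_of_iterate_derivative (p := p.derivative) h hx
  rcases lt_trichotomy (p.derivative.eval u) 0 with h0 | h0 | h0
  · rw [sign_neg h0] at hd ⊢
    have := eval_lt_eval_of_derivative_pos (p := -p) huv fun w hw => by
      simpa using sign_eq_neg_one_iff.1 (hd w ⟨hw.1.le, hw.2.le⟩)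
    apply sign_neg
    simp only [eval_neg, neg_lt_neg_iff] at this
    linarith
  · rw [h0, sign_zero] at hd ⊢
    have h1 := eval_le_eval_of_derivative_nonneg (p := p) huv.le fun w hw =>
      (sign_eq_zero_iff.1 (hd w ⟨hw.1.le, hw.2.le⟩)).ge
    have h2 := eval_le_eval_of_derivative_nonneg (p := -p) huv.le fun w hw => by
      simpa using (sign_eq_zero_iff.1 (hd w ⟨hw.1.le, hw.2.le⟩)).le
    simp only [eval_neg, neg_le_neg_iff] at h2
    rw [sign_eq_zero_iff]; linarith
  · rw [sign_pos h0] at hd ⊢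
    have := eval_lt_eval_of_derivative_pos (p := p) huv fun w hw =>
      sign_eq_one_iff.1 (hd w ⟨hw.1.le, hw.2.le⟩)
    exact sign_pos (by linarith)

/-- A point between two elements of a finite set lies between two neighbouring elements of it. -/
theorem exists_adjacent {Z : Set ℝ} (hZ : Z.Finite) {u v y : ℝ} (hu : u ∈ Z) (hv : v ∈ Z)
    (huy : u < y) (hyv : y < v) (hy : y ∉ Z) :
    ∃ a ∈ Z, ∃ b ∈ Z, a < y ∧ y < b ∧ u ≤ a ∧ b ≤ v ∧ ∀ c ∈ Z, ¬ (a < c ∧ c < b) := by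
  obtain ⟨a, ⟨haZ, hay⟩, hamax⟩ := Set.exists_max_image (Z ∩ Set.Iio y) id
    (hZ.inter_of_left _) ⟨u, hu, huy⟩
  obtain ⟨b, ⟨hbZ, hyb⟩, hbmin⟩ := Set.exists_min_image (Z ∩ Set.Ioi y) id
    (hZ.inter_of_left _) ⟨v, hv, hyv⟩
  refine ⟨a, haZ, b, hbZ, hay, hyb, hamax u ⟨hu, huy⟩, hbmin v ⟨hv, hyv⟩, ?_⟩
  rintro c hc ⟨h1, h2⟩
  rcases lt_trichotomy c y with h | h | h
  · exact absurd (hamax c ⟨hc, h⟩) (not_le.2 h1)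
  · exact hy (h ▸ hc)
  · exact absurd (hbmin c ⟨hc, h⟩) (not_le.2 h2)

end Thom

/-! ### Sign conditions on polynomials over a ring with a size function -/

section Elimination

open Polynomial

/-- A subadditive and submultiplicative measure of the size of ring elements, with finitely many
elements of each size, such as the absolute value on `ℤ`. -/
structure SizeFn (R : Type*) [CommRing R] where
  /-- The size of an element. -/
  size : R → ℕ
  size_zero : size 0 = 0
  size_one_le : size 1 ≤ 1
  size_neg : ∀ r, size (-r) = size r
  size_add_le : ∀ r s, size (r + s) ≤ size r + size s
  size_mul_le : ∀ r s, size (r * s) ≤ size r * size s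
  finite_size_le : ∀ c, {r | size r ≤ c}.Finite

theorem SizeFn.size_natCast_mul_le {R : Type*} [CommRing R] (N : SizeFn R) (n : ℕ) (r : R) :
    N.size (n * r) ≤ n * N.size r := by
  induction n with
  | zero => simp [N.size_zero]
  | succ n ih =>
    have := N.size_add_le (n * r) r
    push_cast
    rw [add_mul, one_mul, add_mul, one_mul]
    omega

variable {R : Type*} [CommRing R]

/-- The ring homomorphisms `e`, `e'` give all elements of size at most `c` the same signs. -/
def SignEq (N : SizeFn R) (e e' : R →+* ℝ) (c : ℕ) : Prop :=
  ∀ r, N.size r ≤ c → SignType.sign (e r) = SignType.sign (e' r)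

/-- The polynomials in `F` have the same signs at `y`, with coefficients evaluated by `e`, as at
`y'`, with coefficients evaluated by `e'`. -/
def SameSigns (F : Set R[X]) (e e' : R →+* ℝ) (y y' : ℝ) : Prop :=
  ∀ f ∈ F, SignType.sign ((f.map e).eval y) = SignType.sign ((f.map e').eval y')

/-- The real roots of those polynomials in `F` that do not vanish identically under `e`. -/
def rootsOf (F : Set R[X]) (e : R →+* ℝ) : Set ℝ :=
  {z | ∃ f ∈ F, f.map e ≠ 0 ∧ (f.map e).eval z = 0}

theorem SignEq.symm {N : SizeFn R} {e e' : R →+* ℝ} {c : ℕ} (h : SignEq N e e' c) :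
    SignEq N e' e c := fun r hr => (h r hr).symm

theorem SameSigns.symm {F : Set R[X]} {e e' : R →+* ℝ} {y y' : ℝ} (h : SameSigns F e e' y y') :
    SameSigns F e' e y' y := fun f hf => (h f hf).symm

theorem SameSigns.eval_eq_zero_iff {F : Set R[X]} {e e' : R →+* ℝ} {y y' : ℝ}
    (h : SameSigns F e e' y y') {f : R[X]} (hf : f ∈ F) :
    (f.map e).eval y = 0 ↔ (f.map e').eval y' = 0 := by
  rw [← sign_eq_zero_iff, h f hf, sign_eq_zero_iff]

theorem finite_rootsOf {F : Set R[X]} (hF : F.Finite) (e : R →+* ℝ) : (rootsOf F e).Finite := by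
  have : rootsOf F e ⊆ ⋃ f ∈ F, {z | z ∈ (f.map e).roots} := by
    rintro z ⟨f, hf, h0, hz⟩
    simp only [Set.mem_iUnion]
    exact ⟨f, hf, (mem_roots h0).2 hz⟩
  refine (hF.biUnion fun f _ => ?_).subset this
  exact Multiset.finite_toSet _

/-- In a family closed under derivatives, the signs of the polynomials at two points determine the
order of the points, unless no polynomial tells the points apart. -/
theorem lt_of_sameSigns {F : Set R[X]} (hF : ∀ f ∈ F, derivative f ∈ F) {e e' : R →+* ℝ}
    {z w z' w' : ℝ} (hz : SameSigns F e e' z z') (hw : SameSigns F e e' w w') (hlt : z < w)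
    {f : R[X]} (hf : f ∈ F)
    (hne : SignType.sign ((f.map e).eval z) ≠ SignType.sign ((f.map e).eval w)) : z' < w' := by
  induction hn : f.natDegree using Nat.strong_induction_on generalizing f with
  | _ n ih =>
  rcases Nat.eq_zero_or_pos n with rfl | hpos
  · rw [Polynomial.eq_C_of_natDegree_eq_zero hn] at hne; simp at hne
  have hFj : ∀ j, derivative^[j] f ∈ F := by
    intro j
    induction j with
    | zero => exact hf
    | succ j ihj => rw [Function.iterate_succ_apply']; exact hF _ ihj
  by_cases hall : ∃ j, SignType.sign (((derivative^[j + 1] f).map e).eval z) ≠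
      SignType.sign (((derivative^[j + 1] f).map e).eval w)
  · obtain ⟨j, hj⟩ := hall
    refine ih _ ?_ (hFj (j + 1)) hj rfl
    have h1 := natDegree_iterate_derivative f (j + 1)
    omega
  push Not at hall
  have h1 := sign_eval_sub_eq_of_iterate_derivative (p := f.map e) hlt fun j => by
    rw [Polynomial.iterate_derivative_map]; exact hall j
  have hall' : ∀ j, SignType.sign (((derivative^[j + 1] f).map e').eval z') =
      SignType.sign (((derivative^[j + 1] f).map e').eval w') := fun j => by
    rw [← hz _ (hFj (j + 1)), ← hw _ (hFj (j + 1))]; exact hall j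
  by_contra hge
  rcases (not_lt.1 hge).eq_or_lt with h | h
  · exact hne (by rw [hz f hf, hw f hf, h])
  have h2 := sign_eval_sub_eq_of_iterate_derivative (p := f.map e') h fun j => by
    rw [Polynomial.iterate_derivative_map]; exact (hall' j).symm
  have h3 : SignType.sign ((f.map e).derivative.eval z) =
      SignType.sign ((f.map e').derivative.eval w') := by
    rw [derivative_map, derivative_map, hz _ (hF f hf)]
    exact hall' 0
  rw [← h1, ← h2] at h3
  have e1 := hz f hf
  have e2 := hw f hf
  rcases lt_trichotomy ((f.map e).eval z) ((f.map e).eval w) with h4 | h4 | h4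
  · rw [sign_pos (by linarith), eq_comm, sign_eq_one_iff] at h3
    have m1 := SignType.sign.monotone h4.le
    have m2 := SignType.sign.monotone (show (f.map e').eval w' ≤ (f.map e').eval z' by linarith)
    exact hne (le_antisymm m1 (by rw [e1, e2]; exact m2))
  · exact hne (by rw [h4])
  · rw [sign_neg (by linarith), eq_comm, sign_eq_neg_one_iff] at h3
    have m1 := SignType.sign.monotone h4.le
    have m2 := SignType.sign.monotone (show (f.map e').eval z' ≤ (f.map e').eval w' by linarith)
    exact hne (le_antisymm (by rw [e1, e2]; exact m2) m1)

end Elimination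

/-! ### Pseudo-division, and families of polynomials of bounded size -/

section Elimination

open Polynomial
open scoped Nat

variable {R : Type*} [CommRing R]

/-- At a root of `q`, a power of the leading coefficient of `q` times `f` has the value of a polynomial
of degree less than `t`, so that the signs of polynomials of low degree determine that of `f`. Only
`t ≥ q.natDegree` is assumed, and that the coefficient at `t` does not vanish under `e`. -/
theorem sign_eval_eq_of_pseudo_division {N : SizeFn R} {e e' : R →+* ℝ} {q : R[X]} {t C B : ℕ}
    {y y' : ℝ} (ht : 1 ≤ t) (hq : q.natDegree ≤ t) (hqC : ∀ j, N.size (q.coeff j) ≤ C)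
    (hlead : SignType.sign (e (q.coeff t)) = SignType.sign (e' (q.coeff t)))
    (hne : e (q.coeff t) ≠ 0) (hy : (q.map e).eval y = 0) (hy' : (q.map e').eval y' = 0)
    (hlow : ∀ f : R[X], f.natDegree < t → (∀ j, N.size (f.coeff j) ≤ B) →
      SignType.sign ((f.map e).eval y) = SignType.sign ((f.map e').eval y'))
    (n : ℕ) (f : R[X]) (b : ℕ) (hf : f.natDegree < t + n) (hfb : ∀ j, N.size (f.coeff j) ≤ b)
    (hb : b * (2 * C) ^ n ≤ B) :
    SignType.sign ((f.map e).eval y) = SignType.sign ((f.map e').eval y') := by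
  induction n generalizing f b with
  | zero => exact hlow f hf fun j => (hfb j).trans (by simpa using hb)
  | succ n ih =>
    set a := q.coeff t with ha
    -- One step of the division lowers the degree and multiplies the value at `y` by `e a`.
    let g : R[X] := Polynomial.C a * f - Polynomial.C (f.coeff (t + n)) * (X ^ n * q)
    have hcoeff : ∀ i, g.coeff i =
        a * f.coeff i - f.coeff (t + n) * (if n ≤ i then q.coeff (i - n) else 0) := by
      intro i
      simp only [g, coeff_sub, coeff_C_mul, coeff_X_pow_mul']
    have hgdeg : g.natDegree < t + n := by
      have : g.natDegree ≤ t + n - 1 := by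
        rw [natDegree_le_iff_coeff_eq_zero]
        intro i hi
        rw [hcoeff, if_pos (by omega)]
        rcases eq_or_ne i (t + n) with rfl | hne'
        · rw [Nat.add_sub_cancel, ← ha]; ring
        · rw [coeff_eq_zero_of_natDegree_lt (by omega : f.natDegree < i),
            coeff_eq_zero_of_natDegree_lt (by omega : q.natDegree < i - n)]
          ring
      omega
    have hgb : ∀ j, N.size (g.coeff j) ≤ b * (2 * C) := by
      intro i
      rw [hcoeff, sub_eq_add_neg]
      refine (N.size_add_le _ _).trans ?_
      rw [N.size_neg]
      have h1 : N.size (a * f.coeff i) ≤ C * b :=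
        (N.size_mul_le _ _).trans (Nat.mul_le_mul (hqC _) (hfb _))
      have h2 : N.size (f.coeff (t + n) * (if n ≤ i then q.coeff (i - n) else 0)) ≤ b * C := by
        refine (N.size_mul_le _ _).trans (Nat.mul_le_mul (hfb _) ?_)
        split_ifs
        · exact hqC _
        · simp [N.size_zero]
      calc _ ≤ C * b + b * C := Nat.add_le_add h1 h2
        _ = _ := by ring
    have key := ih g (b * (2 * C)) hgdeg hgb (by rw [mul_assoc, ← pow_succ']; exact hb)
    have e1 : (g.map e).eval y = e a * (f.map e).eval y := by
      simp [g, hy]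
    have e2 : (g.map e').eval y' = e' a * (f.map e').eval y' := by
      simp [g, hy']
    rw [e1, e2, sign_mul, sign_mul, ← hlead] at key
    have : SignType.sign (e a) ≠ 0 := by rwa [Ne, sign_eq_zero_iff]
    exact mul_left_cancel₀ this key

/-- Cutting off the leading terms of `f` that vanish under `e` makes the degree of `f` that of its
image; the same terms vanish under `e'`. -/
theorem exists_truncation {N : SizeFn R} {e e' : R →+* ℝ} {C : ℕ} (h : SignEq N e e' C) {f : R[X]}
    (hf : ∀ j, N.size (f.coeff j) ≤ C) (hne : f.map e ≠ 0) :
    ∃ q : R[X], q.natDegree ≤ (f.map e).natDegree ∧ q.natDegree ≤ f.natDegree ∧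
      (∀ j, q.coeff j = f.coeff j ∨ q.coeff j = 0) ∧
      e (q.coeff (f.map e).natDegree) ≠ 0 ∧ q.map e = f.map e ∧ q.map e' = f.map e' := by
  set t := (f.map e).natDegree with ht
  let q : R[X] := ∑ j ∈ Finset.range (t + 1), monomial j (f.coeff j)
  have hq : ∀ i, q.coeff i = if i ≤ t then f.coeff i else 0 := by
    intro i
    simp only [q, finsetSum_coeff, coeff_monomial, Finset.sum_ite_eq', Finset.mem_range,
      Nat.lt_succ_iff]
  have hlarge : ∀ i, t < i → e (f.coeff i) = 0 := by
    intro i hi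
    rw [← coeff_map]; exact coeff_eq_zero_of_natDegree_lt hi
  have hlarge' : ∀ i, t < i → e' (f.coeff i) = 0 := by
    intro i hi
    rw [← sign_eq_zero_iff, ← h _ (hf i), hlarge i hi, sign_zero]
  refine ⟨q, ?_, ?_, ?_, ?_, ?_, ?_⟩
  · rw [natDegree_le_iff_coeff_eq_zero]
    intro i hi
    rw [hq, if_neg (by omega)]
  · rw [natDegree_le_iff_coeff_eq_zero]
    intro i hi
    rw [hq, coeff_eq_zero_of_natDegree_lt hi, ite_self]
  · intro j
    rw [hq]
    split_ifs
    · exact Or.inl rfl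
    · exact Or.inr rfl
  · rw [hq, if_pos le_rfl, ← coeff_map]
    exact leadingCoeff_ne_zero.2 hne
  · ext i
    rw [coeff_map, coeff_map, hq]
    split_ifs with h1
    · rfl
    · rw [hlarge i (by omega), map_zero]
  · ext i
    rw [coeff_map, coeff_map, hq]
    split_ifs with h1
    · rfl
    · rw [hlarge' i (by omega), map_zero]

/-- The polynomials of degree at most `d` whose coefficients have bounded size, together with
`X - 1` and `X + 1`. The weights `j !` make this family closed under derivatives; the two additional
elements make the endpoints of `[-1, 1]` roots, also for `d = 0`. -/
def polyFam (N : SizeFn R) (d C : ℕ) : Set R[X] :=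
  {f | f.natDegree ≤ d ∧ ∀ j, j ! * N.size (f.coeff j) ≤ C} ∪ {X - 1, X + 1}

theorem mem_polyFam_of_size_le {N : SizeFn R} {d C B : ℕ} {f : R[X]} (hd : f.natDegree ≤ d)
    (hf : ∀ j, N.size (f.coeff j) ≤ B) (hB : d ! * B ≤ C) : f ∈ polyFam N d C := by
  refine Or.inl ⟨hd, fun j => ?_⟩
  rcases le_or_gt j d with h | h
  · exact (Nat.mul_le_mul (Nat.factorial_le h) (hf j)).trans hB
  · rw [coeff_eq_zero_of_natDegree_lt (by omega), N.size_zero, mul_zero]; exact Nat.zero_le _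

theorem bounds_of_mem_pair {N : SizeFn R} {C : ℕ} (hC : 1 ≤ C) {f : R[X]}
    (hf : f ∈ ({X - 1, X + 1} : Set R[X])) :
    f.natDegree ≤ 1 ∧ ∀ j, j ! * N.size (f.coeff j) ≤ C := by
  have h1 := N.size_one_le
  rcases hf with rfl | rfl
  · refine ⟨by simpa using natDegree_X_sub_C_le (1 : R), fun j => ?_⟩
    rcases j with _ | _ | j
    · simp [N.size_neg, coeff_X, coeff_one]; omega
    · simp [coeff_X, coeff_one]; omega
    · simp [coeff_X, coeff_one, N.size_zero]
  · refine ⟨natDegree_add_le_of_degree_le natDegree_X_le (by simp), fun j => ?_⟩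
    rcases j with _ | _ | j
    · simp [coeff_X, coeff_one]; omega
    · simp [coeff_X, coeff_one]; omega
    · simp [coeff_X, coeff_one, N.size_zero]

theorem bounds_of_mem_polyFam_succ {N : SizeFn R} {d C : ℕ} (hC : 1 ≤ C) {f : R[X]}
    (hf : f ∈ polyFam N (d + 1) C) :
    f.natDegree ≤ d + 1 ∧ ∀ j, j ! * N.size (f.coeff j) ≤ C := by
  rcases hf with h | h
  · exact h
  · have := bounds_of_mem_pair (N := N) hC h
    exact ⟨by omega, this.2⟩

theorem size_coeff_le_of_mem_polyFam {N : SizeFn R} {d C : ℕ} (hC : 1 ≤ C) {f : R[X]}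
    (hf : f ∈ polyFam N d C) (j : ℕ) : N.size (f.coeff j) ≤ C := by
  have : j ! * N.size (f.coeff j) ≤ C := by
    rcases hf with h | h
    · exact h.2 j
    · exact (bounds_of_mem_pair (N := N) hC h).2 j
  exact (Nat.le_mul_of_pos_left _ (Nat.factorial_pos j)).trans this

theorem polyFam_mono {N : SizeFn R} {d C d' C' : ℕ} (hd : d ≤ d') (hC : C ≤ C') :
    polyFam N d C ⊆ polyFam N d' C' :=
  Set.union_subset_union_left _ fun _ hf => ⟨hf.1.trans hd, fun j => (hf.2 j).trans hC⟩

theorem finite_polyFam (N : SizeFn R) (d C : ℕ) : (polyFam N d C).Finite := by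
  refine Set.Finite.union ?_ (by simp)
  have hfin : (Set.pi Set.univ fun _ : Fin (d + 1) => {r : R | N.size r ≤ C}).Finite :=
    Set.Finite.pi fun _ => N.finite_size_le C
  refine Set.Finite.of_finite_image (f := fun (f : R[X]) (i : Fin (d + 1)) => f.coeff i)
    (hfin.subset ?_) ?_
  · rintro _ ⟨f, hf, rfl⟩ i -
    exact (Nat.le_mul_of_pos_left _ (Nat.factorial_pos _)).trans (hf.2 i)
  · intro f hf g hg hfg
    ext i
    rcases lt_or_ge i (d + 1) with h | h
    · exact congrFun hfg ⟨i, h⟩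
    · rw [coeff_eq_zero_of_natDegree_lt (lt_of_le_of_lt hf.1 h),
        coeff_eq_zero_of_natDegree_lt (lt_of_le_of_lt hg.1 h)]

theorem derivative_mem_of_bound {N : SizeFn R} {d C : ℕ} {f : R[X]} (hd : f.natDegree ≤ d + 1)
    (hf : ∀ j, j ! * N.size (f.coeff j) ≤ C) : derivative f ∈ polyFam N d C := by
  refine Or.inl ⟨(natDegree_derivative_le f).trans (by omega), fun j => ?_⟩
  rw [coeff_derivative]
  calc j ! * N.size (f.coeff (j + 1) * (j + 1)) ≤ j ! * ((j + 1) * N.size (f.coeff (j + 1))) := by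
        refine Nat.mul_le_mul_left _ ?_
        have := N.size_natCast_mul_le (j + 1) (f.coeff (j + 1))
        rw [mul_comm (f.coeff _)]; push_cast at this; exact this
    _ = (j + 1)! * N.size (f.coeff (j + 1)) := by rw [Nat.factorial_succ]; ring
    _ ≤ C := hf _

theorem derivative_mem_polyFam {N : SizeFn R} {d C : ℕ} (hC : 1 ≤ C) {f : R[X]}
    (hf : f ∈ polyFam N d C) : derivative f ∈ polyFam N d C := by
  rcases hf with h | h
  · exact polyFam_mono le_rfl le_rfl (derivative_mem_of_bound (h.1.trans (Nat.le_succ _)) h.2)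
  · have h' := bounds_of_mem_pair (N := N) hC h
    exact polyFam_mono (Nat.zero_le _) le_rfl (derivative_mem_of_bound h'.1 h'.2)

theorem derivative_mem_polyFam_of_succ {N : SizeFn R} {d C : ℕ} (hC : 1 ≤ C) {f : R[X]}
    (hf : f ∈ polyFam N (d + 1) C) : derivative f ∈ polyFam N d C :=
  derivative_mem_of_bound (bounds_of_mem_polyFam_succ hC hf).1 (bounds_of_mem_polyFam_succ hC hf).2

/-- A bound for the coefficients of pseudo-remainders in degree at most `D`, when the coefficients
of the dividend and the divisor are bounded by `C`. -/
def remBound (D C : ℕ) : ℕ := D ^ D * (C * (2 * C) ^ (D + 1))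

theorem le_remBound {D C : ℕ} (hC : 1 ≤ C) : C ≤ remBound D C := by
  unfold remBound
  have h1 : 0 < D ^ D := Nat.pow_self_pos
  have h2 : 0 < (2 * C) ^ (D + 1) := by positivity
  calc C = 1 * (C * 1) := by ring
    _ ≤ _ := Nat.mul_le_mul h1 (Nat.mul_le_mul_left _ h2)

theorem sameSigns_of_root {N : SizeFn R} {e e' : R →+* ℝ} {d D C : ℕ} {y y' : ℝ} (hC : 1 ≤ C)
    (hdD : d + 1 ≤ D) (hE : SignEq N e e' C) {f₁ : R[X]} (hf₁ : f₁ ∈ polyFam N (d + 1) C)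
    (hne : f₁.map e ≠ 0) (hy : (f₁.map e).eval y = 0) (hy' : (f₁.map e').eval y' = 0)
    (hG : SameSigns (polyFam N d (remBound D C)) e e' y y') :
    SameSigns (polyFam N (d + 1) C) e e' y y' := by
  intro f hf
  have hf₁C := size_coeff_le_of_mem_polyFam hC hf₁
  obtain ⟨q, hq1, hq2, hq3, hq4, hq5, hq6⟩ := exists_truncation hE hf₁C hne
  have hqC : ∀ j, N.size (q.coeff j) ≤ C := by
    intro j
    rcases hq3 j with h | h <;> rw [h]
    · exact hf₁C j
    · simp [N.size_zero]
  have ht : 1 ≤ (f₁.map e).natDegree := by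
    by_contra h0
    have h0 : (f₁.map e).natDegree = 0 := by omega
    rw [eq_C_of_natDegree_eq_zero h0, eval_C] at hy
    exact hne (by rw [eq_C_of_natDegree_eq_zero h0, hy, C_0])
  have ht' : (f₁.map e).natDegree ≤ d + 1 :=
    natDegree_map_le.trans (bounds_of_mem_polyFam_succ hC hf₁).1
  refine sign_eval_eq_of_pseudo_division (B := C * (2 * C) ^ (d + 1)) (b := C) ht hq1 hqC
    (hE _ (hqC _)) hq4 (by rw [hq5]; exact hy) (by rw [hq6]; exact hy') ?_ (d + 1) f ?_
    (size_coeff_le_of_mem_polyFam hC hf) le_rfl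
  · intro g hg hgB
    refine hG g (mem_polyFam_of_size_le (by omega) hgB ?_)
    refine Nat.mul_le_mul ?_ (Nat.mul_le_mul_left _ (Nat.pow_le_pow_right (by omega) (by omega)))
    exact (Nat.factorial_le (by omega)).trans (Nat.factorial_le_pow D)
  · have := (bounds_of_mem_polyFam_succ hC hf).1
    omega

end Elimination

/-! ### Elimination of one variable -/

section Elimination

open Polynomial

variable {R : Type*} [CommRing R]

theorem SignEq.mono {N : SizeFn R} {e e' : R →+* ℝ} {c c' : ℕ} (h : SignEq N e e' c') (hc : c ≤ c') :
    SignEq N e e' c := fun r hr => h r (hr.trans hc)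

theorem SignEq.map_eq_zero {N : SizeFn R} {e e' : R →+* ℝ} {C : ℕ} (h : SignEq N e e' C)
    {f : R[X]} (hf : ∀ j, N.size (f.coeff j) ≤ C) (h0 : f.map e = 0) : f.map e' = 0 := by
  ext j
  rw [coeff_map, coeff_zero, ← sign_eq_zero_iff, ← h _ (hf j), ← coeff_map, h0]
  simp

/-- Every point of `[-1, 1]` can be matched by a point of `[-1, 1]` at which the polynomials in `F`
have the same signs, when `e` is replaced by `e'`. -/
def Matched (F : Set R[X]) (e e' : R →+* ℝ) : Prop :=
  ∀ y ∈ Set.Icc (-1 : ℝ) 1, ∃ y' ∈ Set.Icc (-1 : ℝ) 1, SameSigns F e e' y y'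

theorem Matched.signEq {N : SizeFn R} {e e' : R →+* ℝ} {d C : ℕ}
    (h : Matched (polyFam N d C) e e') : SignEq N e e' C := by
  intro r hr
  obtain ⟨y', -, hy'⟩ := h 0 ⟨by norm_num, by norm_num⟩
  have hmem : Polynomial.C r ∈ polyFam N d C := by
    refine Or.inl ⟨by simp, fun j => ?_⟩
    rcases j with _ | j
    · simpa using hr
    · simp [N.size_zero]
  simpa using hy' _ hmem

theorem neg_one_mem_rootsOf (N : SizeFn R) (d C : ℕ) (e : R →+* ℝ) :
    (-1 : ℝ) ∈ rootsOf (polyFam N d C) e := by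
  refine ⟨X + 1, Or.inr (by simp), ?_, by simp⟩
  simpa using X_add_C_ne_zero (1 : ℝ)

theorem one_mem_rootsOf (N : SizeFn R) (d C : ℕ) (e : R →+* ℝ) :
    (1 : ℝ) ∈ rootsOf (polyFam N d C) e := by
  refine ⟨X - 1, Or.inr (by simp), ?_, by simp⟩
  simpa using X_sub_C_ne_zero (1 : ℝ)

theorem exists_adjacent_roots (N : SizeFn R) (d C : ℕ) (e : R →+* ℝ) {y : ℝ}
    (hy : y ∈ Set.Icc (-1 : ℝ) 1) (hroot : y ∉ rootsOf (polyFam N d C) e) :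
    ∃ a ∈ rootsOf (polyFam N d C) e, ∃ b ∈ rootsOf (polyFam N d C) e, a < y ∧ y < b ∧
      -1 ≤ a ∧ b ≤ 1 ∧ ∀ c ∈ rootsOf (polyFam N d C) e, ¬ (a < c ∧ c < b) :=
  exists_adjacent (finite_rootsOf (finite_polyFam N d C) e) (neg_one_mem_rootsOf N d C e)
    (one_mem_rootsOf N d C e)
    (lt_of_le_of_ne hy.1 fun h => hroot (h ▸ neg_one_mem_rootsOf N d C e))
    (lt_of_le_of_ne hy.2 fun h => hroot (h ▸ one_mem_rootsOf N d C e)) hroot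

/-- If a member of the family has one of two points as a root, then some member of the family tells
the two points apart: otherwise it would vanish in between, by Thom's lemma. -/
theorem exists_sign_ne {F : Set R[X]} (hF : ∀ f ∈ F, derivative f ∈ F) {e : R →+* ℝ} {z w : ℝ}
    (hzw : z < w) {f : R[X]} (hf : f ∈ F) (hf0 : f.map e ≠ 0)
    (hzero : (f.map e).eval z = 0 ∨ (f.map e).eval w = 0) :
    ∃ k ∈ F, SignType.sign ((k.map e).eval z) ≠ SignType.sign ((k.map e).eval w) := by
  by_contra! hall
  have hFj : ∀ j, derivative^[j] f ∈ F := by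
    intro j
    induction j with
    | zero => exact hf
    | succ j ihj => rw [Function.iterate_succ_apply']; exact hF _ ihj
  have hz : (f.map e).eval z = 0 := by
    rcases hzero with h | h
    · exact h
    · rw [← sign_eq_zero_iff, hall f hf, h, sign_zero]
  refine hf0 (eq_zero_of_infinite_isRoot _ ((Set.Icc_infinite hzw).mono fun x hx => ?_))
  have := sign_eval_eq_of_iterate_derivative (p := f.map e) (fun j => by
    rw [iterate_derivative_map]; exact hall _ (hFj j)) hx
  rwa [hz, sign_zero, sign_eq_zero_iff] at this

/-- The order of two points one of which is a root is preserved by matching. -/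
theorem lt_of_mem_rootsOf {F : Set R[X]} (hF : ∀ f ∈ F, derivative f ∈ F) {G : Set R[X]}
    (hGF : G ⊆ F) {e e' : R →+* ℝ} {z w z' w' : ℝ} (hz : SameSigns F e e' z z')
    (hw : SameSigns F e e' w w') (hr : z ∈ rootsOf G e ∨ w ∈ rootsOf G e) (h : z < w) :
    z' < w' := by
  have : ∃ f ∈ F, f.map e ≠ 0 ∧ ((f.map e).eval z = 0 ∨ (f.map e).eval w = 0) := by
    rcases hr with ⟨f, hf, hf0, hfz⟩ | ⟨f, hf, hf0, hfz⟩
    · exact ⟨f, hGF hf, hf0, Or.inl hfz⟩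
    · exact ⟨f, hGF hf, hf0, Or.inr hfz⟩
  obtain ⟨f, hf, hf0, hfz⟩ := this
  obtain ⟨k, hk, hne⟩ := exists_sign_ne hF h hf hf0 hfz
  exact lt_of_sameSigns hF hz hw h hk hne

variable {N : SizeFn R} {e e' : R →+* ℝ} {d D C : ℕ}

theorem mem_rootsOf_of_sameSigns (hC : 1 ≤ C) {F : Set R[X]} (hE : SignEq N e e' C)
    (hF : polyFam N d C ⊆ F) {z z' : ℝ} (hz : SameSigns F e e' z z')
    (hr : z ∈ rootsOf (polyFam N d C) e) : z' ∈ rootsOf (polyFam N d C) e' := by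
  obtain ⟨f, hf, hf0, hfz⟩ := hr
  refine ⟨f, hf, fun h => hf0 ?_, (hz.eval_eq_zero_iff (hF hf)).1 hfz⟩
  exact hE.symm.map_eq_zero (size_coeff_le_of_mem_polyFam hC hf) h

/-- The roots of the polynomials of lower degree are matched, because the signs of the polynomials
of higher degree at such roots are those of pseudo-remainders. -/
theorem sameSigns_of_low_root (hC : 1 ≤ C) (hdD : d + 1 ≤ D)
    (hE : SignEq N e e' (remBound D C)) {y y' : ℝ}
    (hG : SameSigns (polyFam N d (remBound D (remBound D C))) e e' y y')
    (hy : y ∈ rootsOf (polyFam N d (remBound D C)) e) :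
    SameSigns (polyFam N (d + 1) C) e e' y y' := by
  have hC' : 1 ≤ remBound D C := hC.trans (le_remBound hC)
  obtain ⟨g, hg, hg0, hgy⟩ := hy
  have := sameSigns_of_root hC' hdD hE (polyFam_mono (Nat.le_succ d) le_rfl hg) hg0 hgy
    ((hG.eval_eq_zero_iff (polyFam_mono le_rfl (le_remBound hC') hg)).1 hgy) hG
  exact fun f hf => this f (polyFam_mono le_rfl (le_remBound hC) hf)

/-- The roots of the polynomials of degree `d + 1` are matched: between adjacent roots of the
polynomials of lower degree such a polynomial is monotone, so that the signs at these roots decide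
whether it has a root there. -/
theorem exists_match_of_root (hC : 1 ≤ C) (hdD : d + 1 ≤ D)
    (h : Matched (polyFam N d (remBound D (remBound D C))) e e')
    (h' : Matched (polyFam N d (remBound D (remBound D C))) e' e)
    {y : ℝ} (hy : y ∈ Set.Icc (-1 : ℝ) 1) (hroot : y ∈ rootsOf (polyFam N (d + 1) C) e) :
    ∃ y' ∈ Set.Icc (-1 : ℝ) 1, SameSigns (polyFam N (d + 1) C) e e' y y' := by
  set C' := remBound D C with hC'def
  set C'' := remBound D C' with hC''def
  have hCC' : C ≤ C' := le_remBound hC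
  have hC' : 1 ≤ C' := hC.trans hCC'
  have hCC'' : C' ≤ C'' := le_remBound hC'
  have hC'' : 1 ≤ C'' := hC'.trans hCC''
  have hE'' : SignEq N e e' C'' := h.signEq
  have hE' : SignEq N e e' C' := hE''.mono hCC''
  have hE : SignEq N e e' C := hE'.mono hCC'
  have hder : ∀ f ∈ polyFam N d C'', derivative f ∈ polyFam N d C'' :=
    fun f hf => derivative_mem_polyFam hC'' hf
  have hsub : polyFam N d C' ⊆ polyFam N d C'' := polyFam_mono le_rfl hCC''
  obtain ⟨y₀, hy₀, hyy₀⟩ := h y hy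
  by_cases hlow : y ∈ rootsOf (polyFam N d C') e
  · exact ⟨y₀, hy₀, sameSigns_of_low_root hC hdD hE' hyy₀ hlow⟩
  obtain ⟨f, hf, hf0, hfy⟩ := hroot
  have hfC := size_coeff_le_of_mem_polyFam hC hf
  obtain ⟨a, ha, b, hb, hay, hyb, ha1, hb1, hadj⟩ := exists_adjacent_roots N d C' e hy hlow
  obtain ⟨a', ha'I, haa'⟩ := h a ⟨ha1, by linarith [hy.2]⟩
  obtain ⟨b', hb'I, hbb'⟩ := h b ⟨by linarith [hy.1], hb1⟩
  have ha'y := lt_of_mem_rootsOf hder hsub haa' hyy₀ (Or.inl ha) hay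
  have hyb' := lt_of_mem_rootsOf hder hsub hyy₀ hbb' (Or.inr hb) hyb
  have hfa := sameSigns_of_low_root hC hdD hE' haa' ha f hf
  have hfb := sameSigns_of_low_root hC hdD hE' hbb' hb f hf
  -- The signs of `f` at `a` and `b` are opposite, since its derivative has no root in between.
  have hder0 : ∀ w ∈ Set.Ioo a b, (f.map e).derivative.eval w ≠ 0 := by
    intro w hw hw0
    refine hadj w ⟨derivative f,
      polyFam_mono le_rfl hCC' (derivative_mem_polyFam_of_succ hC hf), fun h0 => ?_, ?_⟩ hw
    · rw [← derivative_map] at h0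
      have := derivative_eq_zero.1 h0
      rw [eq_C_of_natDegree_eq_zero this, eval_C] at hfy
      exact hf0 (by rw [eq_C_of_natDegree_eq_zero this, hfy, C_0])
    · rw [← derivative_map]; exact hw0
  have hsgn : ∀ w ∈ Set.Ioo a b, SignType.sign ((f.map e).derivative.eval w) =
      SignType.sign ((f.map e).derivative.eval y) := fun w hw =>
    sign_eval_eq_of_forall_ne fun x hx => hder0 x
      ((Set.OrdConnected.uIcc_subset Set.ordConnected_Ioo hw ⟨hay, hyb⟩) hx)
  have hzero : ∃ w ∈ Set.Ioo a' b', (f.map e').eval w = 0 := by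
    have hc : ContinuousOn (fun w => (f.map e').eval w) (Set.Icc a' b') :=
      (f.map e').continuous.continuousOn
    have hab' : a' ≤ b' := by linarith
    rcases lt_or_gt_of_ne (hder0 y ⟨hay, hyb⟩) with hs | hs
    · have hneg : ∀ w ∈ Set.Ioo a b, 0 < (-(f.map e)).derivative.eval w := fun w hw => by
        have := hsgn w hw
        rw [sign_neg hs, sign_eq_neg_one_iff] at this
        simpa using this
      have h1 := eval_lt_eval_of_derivative_pos hay fun w hw => hneg w ⟨hw.1, hw.2.trans hyb⟩
      have h2 := eval_lt_eval_of_derivative_pos hyb fun w hw => hneg w ⟨hay.trans hw.1, hw.2⟩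
      simp only [eval_neg, hfy] at h1 h2
      rw [sign_pos (by linarith), eq_comm, sign_eq_one_iff] at hfa
      rw [sign_neg (by linarith), eq_comm, sign_eq_neg_one_iff] at hfb
      exact intermediate_value_Ioo' hab' hc ⟨hfb, hfa⟩
    · have hpos : ∀ w ∈ Set.Ioo a b, 0 < (f.map e).derivative.eval w := fun w hw => by
        have := hsgn w hw
        rwa [sign_pos hs, sign_eq_one_iff] at this
      have h1 := eval_lt_eval_of_derivative_pos hay fun w hw => hpos w ⟨hw.1, hw.2.trans hyb⟩
      have h2 := eval_lt_eval_of_derivative_pos hyb fun w hw => hpos w ⟨hay.trans hw.1, hw.2⟩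
      rw [hfy] at h1 h2
      rw [sign_neg h1, eq_comm, sign_eq_neg_one_iff] at hfa
      rw [sign_pos h2, eq_comm, sign_eq_one_iff] at hfb
      exact intermediate_value_Ioo hab' hc ⟨hfa, hfb⟩
  obtain ⟨w, hw, hw0⟩ := hzero
  -- The root `w` and the point `y₀` lie in the same interval between roots of lower degree.
  refine ⟨w, ⟨ha'I.1.trans hw.1.le, hw.2.le.trans hb'I.2⟩,
    sameSigns_of_root hC hdD hE hf hf0 hfy hw0 ?_⟩
  -- There is no root of lower degree between `a'` and `b'`, as it would be matched.
  have hadj' : ∀ c ∈ rootsOf (polyFam N d C') e', ¬ (a' < c ∧ c < b') := by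
    rintro c hc ⟨hac, hcb⟩
    obtain ⟨c₀, hc₀I, hcc₀⟩ := h' c ⟨by linarith [ha'I.1], by linarith [hb'I.2]⟩
    have hc₀ := mem_rootsOf_of_sameSigns hC' hE'.symm hsub hcc₀ hc
    exact hadj c₀ hc₀ ⟨lt_of_mem_rootsOf hder hsub haa'.symm hcc₀ (Or.inr hc) hac,
      lt_of_mem_rootsOf hder hsub hcc₀ hbb'.symm (Or.inl hc) hcb⟩
  intro g hg
  rw [hyy₀ g (hsub hg)]
  by_cases hg0 : g.map e' = 0
  · simp [hg0]
  · refine sign_eval_eq_of_forall_ne fun x hx hx0 => hadj' x ⟨g, hg, hg0, hx0⟩ ?_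
    exact (Set.OrdConnected.uIcc_subset Set.ordConnected_Ioo ⟨ha'y, hyb'⟩ hw) hx

/-- The points between adjacent roots of the family are matched by the midpoint between the matched
roots. -/
theorem Matched.succ (hC : 1 ≤ C) (hdD : d + 1 ≤ D)
    (h : Matched (polyFam N d (remBound D (remBound D C))) e e')
    (h' : Matched (polyFam N d (remBound D (remBound D C))) e' e) :
    Matched (polyFam N (d + 1) C) e e' := by
  intro y hy
  by_cases hroot : y ∈ rootsOf (polyFam N (d + 1) C) e
  · exact exists_match_of_root hC hdD h h' hy hroot
  have hE : SignEq N e e' C :=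
    h.signEq.mono ((le_remBound hC).trans (le_remBound (hC.trans (le_remBound hC))))
  have hder : ∀ f ∈ polyFam N (d + 1) C, derivative f ∈ polyFam N (d + 1) C :=
    fun f hf => derivative_mem_polyFam hC hf
  obtain ⟨a, ha, b, hb, hay, hyb, ha1, hb1, hadj⟩ := exists_adjacent_roots N (d + 1) C e hy hroot
  obtain ⟨a', ha'I, haa'⟩ := exists_match_of_root hC hdD h h' ⟨ha1, by linarith [hy.2]⟩ ha
  obtain ⟨b', hb'I, hbb'⟩ := exists_match_of_root hC hdD h h' ⟨by linarith [hy.1], hb1⟩ hb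
  have hab' := lt_of_mem_rootsOf hder subset_rfl haa' hbb' (Or.inl ha) (hay.trans hyb)
  have hadj' : ∀ c ∈ rootsOf (polyFam N (d + 1) C) e', ¬ (a' < c ∧ c < b') := by
    rintro c hc ⟨hac, hcb⟩
    obtain ⟨c₀, hc₀I, hcc₀⟩ :=
      exists_match_of_root hC hdD h' h ⟨by linarith [ha'I.1], by linarith [hb'I.2]⟩ hc
    exact hadj c₀ (mem_rootsOf_of_sameSigns hC hE.symm subset_rfl hcc₀ hc)
      ⟨lt_of_mem_rootsOf hder subset_rfl haa'.symm hcc₀ (Or.inr hc) hac,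
      lt_of_mem_rootsOf hder subset_rfl hcc₀ hbb'.symm (Or.inl hc) hcb⟩
  refine ⟨(a' + b') / 2, ⟨by linarith [ha'I.1], by linarith [hb'I.2]⟩, fun f hf => ?_⟩
  have hfC := size_coeff_le_of_mem_polyFam hC hf
  by_cases hf0 : f.map e = 0
  · rw [hf0, hE.map_eq_zero hfC hf0]; simp
  have hf0' : f.map e' ≠ 0 := fun h0 => hf0 (hE.symm.map_eq_zero hfC h0)
  have hfree : ∀ x, a < x → x < b → (f.map e).eval x ≠ 0 :=
    fun x h1 h2 h0 => hadj x ⟨f, hf, hf0, h0⟩ ⟨h1, h2⟩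
  have hfree' : ∀ x, a' < x → x < b' → (f.map e').eval x ≠ 0 :=
    fun x h1 h2 h0 => hadj' x ⟨f, hf, hf0', h0⟩ ⟨h1, h2⟩
  have hmid : a' < (a' + b') / 2 ∧ (a' + b') / 2 < b' := ⟨by linarith, by linarith⟩
  by_cases hfa : (f.map e).eval a = 0
  · by_cases hfb : (f.map e).eval b = 0
    · -- By Rolle's theorem the derivative of `f` would have a root between `a` and `b`.
      exfalso
      obtain ⟨w, hw, hw0⟩ := exists_deriv_eq_zero (hay.trans hyb)
        (f.map e).continuous.continuousOn (hfa.trans hfb.symm)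
      rw [Polynomial.deriv] at hw0
      refine hadj w ⟨derivative f, hder f hf, fun h0 => ?_, ?_⟩ hw
      · rw [← derivative_map] at h0
        have := derivative_eq_zero.1 h0
        rw [eq_C_of_natDegree_eq_zero this, eval_C] at hfa
        exact hf0 (by rw [eq_C_of_natDegree_eq_zero this, hfa, C_0])
      · rw [← derivative_map]; exact hw0
    · have hfb' : (f.map e').eval b' ≠ 0 := fun h0 => hfb ((hbb'.eval_eq_zero_iff hf).2 h0)
      have h1 : SignType.sign ((f.map e).eval y) = SignType.sign ((f.map e).eval b) :=
        sign_eval_eq_of_forall_ne fun x hx => by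
          rw [Set.uIcc_of_le hyb.le] at hx
          rcases hx.2.lt_or_eq with h2 | rfl
          · exact hfree x (hay.trans_le hx.1) h2
          · exact hfb
      have h2 : SignType.sign ((f.map e').eval ((a' + b') / 2)) =
          SignType.sign ((f.map e').eval b') :=
        sign_eval_eq_of_forall_ne fun x hx => by
          rw [Set.uIcc_of_le hmid.2.le] at hx
          rcases hx.2.lt_or_eq with h2 | rfl
          · exact hfree' x (hmid.1.trans_le hx.1) h2
          · exact hfb'
      rw [h1, h2, hbb' f hf]
  · have hfa' : (f.map e').eval a' ≠ 0 := fun h0 => hfa ((haa'.eval_eq_zero_iff hf).2 h0)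
    have h1 : SignType.sign ((f.map e).eval a) = SignType.sign ((f.map e).eval y) :=
      sign_eval_eq_of_forall_ne fun x hx => by
        rw [Set.uIcc_of_le hay.le] at hx
        rcases hx.1.lt_or_eq with h2 | rfl
        · exact hfree x h2 (hx.2.trans_lt hyb)
        · exact hfa
    have h2 : SignType.sign ((f.map e').eval a') =
        SignType.sign ((f.map e').eval ((a' + b') / 2)) :=
      sign_eval_eq_of_forall_ne fun x hx => by
        rw [Set.uIcc_of_le hmid.1.le] at hx
        rcases hx.1.lt_or_eq with h2 | rfl
        · exact hfree' x h2 (hx.2.trans_lt hmid.2)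
        · exact hfa'
    rw [← h1, ← h2, haa' f hf]

/-- Elimination of one variable: the signs of the elements of bounded size of the coefficient ring
determine which sign patterns the polynomials in `polyFam N d C` realise on `[-1, 1]`. -/
theorem matched_polyFam (hC : 1 ≤ C) (hdD : d ≤ D)
    (hE : SignEq N e e' ((remBound D)^[2 * d] C)) : Matched (polyFam N d C) e e' := by
  induction d generalizing C e e' with
  | zero =>
    intro y hy
    refine ⟨y, hy, fun f hf => ?_⟩
    rcases hf with ⟨h1, h2⟩ | h
    · rw [eq_C_of_natDegree_eq_zero (Nat.le_zero.1 h1)]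
      have := h2 0
      rw [Nat.factorial_zero, one_mul] at this
      simpa using hE _ this
    · rcases h with rfl | rfl <;> simp
  | succ d ih =>
    have hC' : 1 ≤ remBound D C := hC.trans (le_remBound hC)
    have hC'' : 1 ≤ remBound D (remBound D C) := hC'.trans (le_remBound hC')
    have hE' : SignEq N e e' ((remBound D)^[2 * d] (remBound D (remBound D C))) := by
      rwa [← Function.iterate_succ_apply, ← Function.iterate_succ_apply]
    exact Matched.succ hC hdD (ih hC'' (by omega) hE') (ih hC'' (by omega) hE'.symm)

end Elimination

/-! ### Integer polynomials in several variables -/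

section Size

/-- The weighted `ℓ¹`-norm of an integer polynomial in which every variable has norm `2`. It bounds
both the coefficients and (logarithmically) the degree. -/
noncomputable def mvSize {n : ℕ} (p : MvPolynomial (Fin n) ℤ) : ℕ :=
  ∑ s ∈ p.support, (p.coeff s).natAbs * 2 ^ s.degree

variable {n : ℕ}

theorem mvSize_eq_sum {p : MvPolynomial (Fin n) ℤ} {S : Finset (Fin n →₀ ℕ)} (h : p.support ⊆ S) :
    mvSize p = ∑ s ∈ S, (p.coeff s).natAbs * 2 ^ s.degree :=
  Finset.sum_subset h fun s _ hs => by
    rw [MvPolynomial.notMem_support_iff.1 hs]; simp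

theorem mvSize_zero : mvSize (0 : MvPolynomial (Fin n) ℤ) = 0 := by simp [mvSize]

theorem mvSize_monomial_le (s : Fin n →₀ ℕ) (a : ℤ) :
    mvSize (MvPolynomial.monomial s a) ≤ a.natAbs * 2 ^ s.degree := by
  rw [mvSize_eq_sum (S := {s}) MvPolynomial.support_monomial_subset]
  simp

theorem mvSize_add_le (p q : MvPolynomial (Fin n) ℤ) : mvSize (p + q) ≤ mvSize p + mvSize q := by
  classical
  rw [mvSize_eq_sum (p := p + q) MvPolynomial.support_add,
    mvSize_eq_sum (p := p) (S := p.support ∪ q.support) Finset.subset_union_left,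
    mvSize_eq_sum (p := q) (S := p.support ∪ q.support) Finset.subset_union_right,
    ← Finset.sum_add_distrib]
  refine Finset.sum_le_sum fun s _ => ?_
  rw [← add_mul, MvPolynomial.coeff_add]
  exact Nat.mul_le_mul_right _ (Int.natAbs_add_le _ _)

theorem mvSize_sum_le {ι : Type*} (S : Finset ι) (f : ι → MvPolynomial (Fin n) ℤ) :
    mvSize (∑ i ∈ S, f i) ≤ ∑ i ∈ S, mvSize (f i) :=
  Finset.le_sum_of_subadditive _ mvSize_zero.le mvSize_add_le _ _

theorem mvSize_mul_le (p q : MvPolynomial (Fin n) ℤ) : mvSize (p * q) ≤ mvSize p * mvSize q := by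
  conv_lhs => rw [p.as_sum, q.as_sum, Finset.sum_mul_sum]
  refine (mvSize_sum_le _ _).trans ?_
  rw [mvSize, mvSize, Finset.sum_mul_sum]
  refine Finset.sum_le_sum fun s _ => (mvSize_sum_le _ _).trans (Finset.sum_le_sum fun t _ => ?_)
  rw [MvPolynomial.monomial_mul]
  refine (mvSize_monomial_le _ _).trans (le_of_eq ?_)
  rw [Int.natAbs_mul, map_add, pow_add]
  ring

theorem natAbs_coeff_le_mvSize (p : MvPolynomial (Fin n) ℤ) (s : Fin n →₀ ℕ) :
    (p.coeff s).natAbs ≤ mvSize p := by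
  by_cases hs : s ∈ p.support
  · exact (Nat.le_mul_of_pos_right _ (by positivity)).trans
      (Finset.single_le_sum (f := fun s => (p.coeff s).natAbs * 2 ^ s.degree)
        (fun _ _ => Nat.zero_le _) hs)
  · rw [MvPolynomial.notMem_support_iff.1 hs]; simp

theorem degree_lt_mvSize {p : MvPolynomial (Fin n) ℤ} {s : Fin n →₀ ℕ} (hs : s ∈ p.support) :
    s.degree < mvSize p := by
  have h1 : 1 ≤ (p.coeff s).natAbs := Int.natAbs_pos.2 (MvPolynomial.mem_support_iff.1 hs)
  calc s.degree < 2 ^ s.degree := Nat.lt_two_pow_self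
    _ ≤ (p.coeff s).natAbs * 2 ^ s.degree := Nat.le_mul_of_pos_left _ h1
    _ ≤ mvSize p := Finset.single_le_sum (f := fun s => (p.coeff s).natAbs * 2 ^ s.degree)
        (fun _ _ => Nat.zero_le _) hs

theorem finite_mvSize_le (c : ℕ) : {p : MvPolynomial (Fin n) ℤ | mvSize p ≤ c}.Finite := by
  have hS : {s : Fin n →₀ ℕ | s.degree ≤ c}.Finite := Finsupp.finite_of_degree_le c
  have := hS.fintype
  have hfin : (Set.pi Set.univ fun _ : {s : Fin n →₀ ℕ | s.degree ≤ c} =>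
    Set.Icc (-c : ℤ) c).Finite := Set.Finite.pi fun _ => Set.finite_Icc _ _
  refine Set.Finite.of_finite_image
    (f := fun (p : MvPolynomial (Fin n) ℤ) (s : {s : Fin n →₀ ℕ | s.degree ≤ c}) => p.coeff s)
    (hfin.subset ?_) ?_
  · rintro _ ⟨p, hp, rfl⟩ s -
    have := (natAbs_coeff_le_mvSize p s).trans hp
    constructor <;> dsimp only <;> omega
  · intro p hp q hq hpq
    ext s
    by_cases hs : s.degree ≤ c
    · exact congrFun hpq ⟨s, hs⟩
    · have h1 : s ∉ p.support := fun h => hs ((degree_lt_mvSize h).le.trans hp)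
      have h2 : s ∉ q.support := fun h => hs ((degree_lt_mvSize h).le.trans hq)
      rw [MvPolynomial.notMem_support_iff.1 h1, MvPolynomial.notMem_support_iff.1 h2]

/-- `mvSize` as a size function on the ring of integer polynomials. -/
noncomputable def mvSizeFn (n : ℕ) : SizeFn (MvPolynomial (Fin n) ℤ) where
  size := mvSize
  size_zero := mvSize_zero
  size_one_le := by simpa using mvSize_monomial_le (0 : Fin n →₀ ℕ) 1
  size_neg p := by simp [mvSize]
  size_add_le := mvSize_add_le
  size_mul_le := mvSize_mul_le
  finite_size_le := finite_mvSize_le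

theorem mvSize_coeff_finSuccEquiv_le (p : MvPolynomial (Fin (n + 1)) ℤ) (j : ℕ) :
    mvSize ((MvPolynomial.finSuccEquiv ℤ n p).coeff j) ≤ mvSize p := by
  unfold mvSize
  simp only [MvPolynomial.finSuccEquiv_coeff_coeff]
  have hinj : Function.Injective fun m : Fin n →₀ ℕ => m.cons j := fun a b h => by
    simpa using congrArg Finsupp.tail h
  calc _ ≤ ∑ m ∈ ((MvPolynomial.finSuccEquiv ℤ n p).coeff j).support,
        (p.coeff (m.cons j)).natAbs * 2 ^ (m.cons j).degree := by
        refine Finset.sum_le_sum fun m _ => Nat.mul_le_mul_left _ (Nat.pow_le_pow_right (by simp) ?_)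
        rw [Finsupp.degree_eq_sum, Finsupp.degree_eq_sum, Fin.sum_univ_succ]
        simp
    _ = ∑ s ∈ ((MvPolynomial.finSuccEquiv ℤ n p).coeff j).support.image fun m => m.cons j,
        (p.coeff s).natAbs * 2 ^ s.degree := (Finset.sum_image (g := fun m : Fin n →₀ ℕ => m.cons j)
        (f := fun s => (p.coeff s).natAbs * 2 ^ s.degree) hinj.injOn).symm
    _ ≤ _ := by
        refine Finset.sum_le_sum_of_subset fun s hs => ?_
        obtain ⟨m, hm, rfl⟩ := Finset.mem_image.1 hs
        rw [MvPolynomial.mem_support_iff] at hm ⊢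
        rwa [MvPolynomial.finSuccEquiv_coeff_coeff] at hm

theorem natDegree_finSuccEquiv_le_mvSize (p : MvPolynomial (Fin (n + 1)) ℤ) :
    (MvPolynomial.finSuccEquiv ℤ n p).natDegree ≤ mvSize p := by
  rw [MvPolynomial.natDegree_finSuccEquiv, MvPolynomial.degreeOf_le_iff]
  intro s hs
  refine le_trans ?_ (degree_lt_mvSize hs).le
  rw [Finsupp.degree_eq_sum]
  exact Finset.single_le_sum (f := fun i => s i) (fun _ _ => Nat.zero_le _) (Finset.mem_univ 0)

/-- Evaluation of integer polynomials at a real point. -/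
noncomputable def evalReal (x : Fin n → ℝ) : MvPolynomial (Fin n) ℤ →+* ℝ :=
  MvPolynomial.eval₂Hom (Int.castRingHom ℝ) x

theorem evalReal_cons (x : Fin n → ℝ) (y : ℝ) (p : MvPolynomial (Fin (n + 1)) ℤ) :
    evalReal (Fin.cons y x : Fin (n + 1) → ℝ) p =
      ((MvPolynomial.finSuccEquiv ℤ n p).map (evalReal x)).eval y := by
  rw [Polynomial.eval_map]
  have : evalReal (Fin.cons y x : Fin (n + 1) → ℝ) =
      (Polynomial.eval₂RingHom (evalReal x) y).comp
        (MvPolynomial.finSuccEquiv ℤ n : MvPolynomial (Fin (n + 1)) ℤ →+* _) := by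
    refine MvPolynomial.ringHom_ext (fun a => by simp) fun i => ?_
    refine Fin.cases ?_ (fun i => ?_) i
    · simp [evalReal, MvPolynomial.finSuccEquiv_X_zero]
    · simp [evalReal, MvPolynomial.finSuccEquiv_X_succ]
  exact congrFun (congrArg DFunLike.coe this) p

/-- A size bound that is sufficient to eliminate one variable from the integer polynomials of size
at most `c`. -/
def elimStep (c : ℕ) : ℕ := (remBound c)^[2 * c] (c ^ c * c)

/-- Sign patterns of the polynomials of size at most `c` extend by one coordinate, if those of the
polynomials of size at most `elimStep c` agree. -/
theorem exists_signEq_cons {c : ℕ} (hc : 1 ≤ c) {x x' : Fin n → ℝ}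
    (h : SignEq (mvSizeFn n) (evalReal x) (evalReal x') (elimStep c)) {y : ℝ}
    (hy : y ∈ Set.Icc (-1 : ℝ) 1) :
    ∃ y' ∈ Set.Icc (-1 : ℝ) 1, SignEq (mvSizeFn (n + 1))
      (evalReal (Fin.cons y x : Fin (n + 1) → ℝ)) (evalReal (Fin.cons y' x' : Fin (n + 1) → ℝ))
      c := by
  have hC : 1 ≤ c ^ c * c := Nat.mul_pos (Nat.pow_self_pos) hc
  obtain ⟨y', hy', hyy'⟩ := matched_polyFam hC le_rfl h y hy
  refine ⟨y', hy', fun p hp => ?_⟩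
  rw [evalReal_cons, evalReal_cons]
  refine hyy' _ (mem_polyFam_of_size_le (B := c) ((natDegree_finSuccEquiv_le_mvSize p).trans hp)
    (fun j => (mvSize_coeff_finSuccEquiv_le p j).trans hp) ?_)
  exact Nat.mul_le_mul_right _ (Nat.factorial_le_pow c)

/-- A nonzero integer polynomial of size at most `c` has no root in `(0, 1 / (c + 1))`: its lowest
term dominates. -/
theorem sign_evalReal_one {c : ℕ} {p : MvPolynomial (Fin 1) ℤ} (hp : mvSize p ≤ c) {s : Fin 1 →₀ ℕ}
    (hs : s ∈ p.support) (hmin : ∀ s' ∈ p.support, s 0 ≤ s' 0) {x : Fin 1 → ℝ} (h0 : 0 < x 0)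
    (h1 : x 0 * (c + 1) < 1) :
    SignType.sign (evalReal x p) = SignType.sign ((p.coeff s : ℤ) : ℝ) := by
  have hx1 : x 0 ≤ 1 := by nlinarith [show (0 : ℝ) ≤ c from Nat.cast_nonneg c]
  have hexp : evalReal x p = ∑ s' ∈ p.support, ((p.coeff s' : ℤ) : ℝ) * x 0 ^ s' 0 := by
    simp [evalReal, MvPolynomial.eval₂_eq']
  rw [hexp, ← Finset.add_sum_erase _ _ hs]
  set r := ∑ s' ∈ p.support.erase s, ((p.coeff s' : ℤ) : ℝ) * x 0 ^ s' 0 with hr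
  have hrle : |r| ≤ x 0 ^ s 0 * (x 0 * c) := by
    calc |r| ≤ ∑ s' ∈ p.support.erase s, |((p.coeff s' : ℤ) : ℝ) * x 0 ^ s' 0| :=
          Finset.abs_sum_le_sum_abs _ _
      _ ≤ ∑ s' ∈ p.support.erase s, ((p.coeff s').natAbs : ℝ) * x 0 ^ (s 0 + 1) := by
          refine Finset.sum_le_sum fun s' hs' => ?_
          rw [abs_mul, abs_of_nonneg (pow_nonneg h0.le (s' 0)), Nat.cast_natAbs, Int.cast_abs]
          refine mul_le_mul_of_nonneg_left (pow_le_pow_of_le_one h0.le hx1 ?_) (abs_nonneg _)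
          have h2 := hmin s' (Finset.mem_of_mem_erase hs')
          have h3 : s 0 ≠ s' 0 := fun h => Finset.ne_of_mem_erase hs' (by
            ext; exact h.symm)
          omega
      _ = x 0 ^ (s 0 + 1) * ∑ s' ∈ p.support.erase s, ((p.coeff s').natAbs : ℝ) := by
          rw [← Finset.sum_mul, mul_comm]
      _ ≤ x 0 ^ (s 0 + 1) * c := by
          refine mul_le_mul_of_nonneg_left ?_ (by positivity)
          have : ∑ s' ∈ p.support.erase s, (p.coeff s').natAbs ≤ mvSize p := by
            refine (Finset.sum_le_sum_of_subset (Finset.erase_subset _ _)).trans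
              (Finset.sum_le_sum fun s' _ => Nat.le_mul_of_pos_right _ (by positivity))
          exact_mod_cast this.trans hp
      _ = _ := by ring
  have hpow : 0 < x 0 ^ s 0 := pow_pos h0 _
  have hlt : |r| < x 0 ^ s 0 := by
    refine hrle.trans_lt ?_
    have : x 0 * c < 1 := by nlinarith
    nlinarith
  have habs := abs_lt.1 hlt
  have hne : p.coeff s ≠ 0 := MvPolynomial.mem_support_iff.1 hs
  rcases lt_or_gt_of_ne hne with h | h
  · have h' : ((p.coeff s : ℤ) : ℝ) ≤ -1 := by exact_mod_cast Int.le_sub_one_of_lt h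
    rw [sign_neg (by linarith : ((p.coeff s : ℤ) : ℝ) < 0), sign_neg]
    nlinarith
  · have h' : (1 : ℝ) ≤ (p.coeff s : ℤ) := by exact_mod_cast h
    rw [sign_pos (by linarith : (0 : ℝ) < (p.coeff s : ℤ)), sign_pos]
    nlinarith

theorem signEq_one {c : ℕ} {x x' : Fin 1 → ℝ} (h0 : 0 < x 0) (h1 : x 0 * (c + 1) < 1)
    (h0' : 0 < x' 0) (h1' : x' 0 * (c + 1) < 1) :
    SignEq (mvSizeFn 1) (evalReal x) (evalReal x') c := by
  intro p hp
  rcases p.support.eq_empty_or_nonempty with h | h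
  · rw [MvPolynomial.support_eq_empty.1 h]; simp
  · obtain ⟨s, hs, hmin⟩ := Finset.exists_min_image _ (fun s => s 0) h
    rw [sign_evalReal_one hp hs hmin h0 h1, sign_evalReal_one hp hs hmin h0' h1']

theorem one_le_elimStep {c : ℕ} (hc : 1 ≤ c) : 1 ≤ elimStep c := by
  unfold elimStep
  generalize 2 * c = n
  induction n with
  | zero => exact Nat.mul_pos Nat.pow_self_pos hc
  | succ n ih => rw [Function.iterate_succ_apply']; exact ih.trans (le_remBound ih)

/-- A point of the unit cube can be followed when a small parameter `t` is replaced by another one,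
without changing the signs of the polynomials of bounded size in the coordinates and in `t`. -/
theorem exists_signEq_snoc {k c : ℕ} (hc : 1 ≤ c) {t t' : ℝ} (h0 : 0 < t)
    (h1 : t * (elimStep^[k] c + 1) < 1) (h0' : 0 < t') (h1' : t' * (elimStep^[k] c + 1) < 1)
    (y : Fin k → ℝ) (hy : ∀ i, y i ∈ Set.Icc (-1 : ℝ) 1) :
    ∃ y' : Fin k → ℝ, SignEq (mvSizeFn (k + 1)) (evalReal (Fin.snoc y t : Fin (k + 1) → ℝ))
      (evalReal (Fin.snoc y' t' : Fin (k + 1) → ℝ)) c := by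
  induction k generalizing c with
  | zero =>
    refine ⟨y, signEq_one ?_ ?_ ?_ ?_⟩ <;> simpa [Fin.snoc]
  | succ k ih =>
    obtain ⟨z', hz'⟩ := ih (one_le_elimStep hc) (by rwa [← Function.iterate_succ_apply])
      (by rwa [← Function.iterate_succ_apply]) (Fin.tail y) fun i => hy _
    obtain ⟨w, -, hw⟩ := exists_signEq_cons hc hz' (hy 0)
    refine ⟨Fin.cons w z', ?_⟩
    rwa [Fin.cons_snoc_eq_snoc_cons, Fin.cons_snoc_eq_snoc_cons, Fin.cons_self_tail] at hw

end Size

namespace DistMC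

/-! ### Small cubes around the origin -/

/-- All polynomials in a formula satisfy `P`. -/
def SAFormula.ForallPoly {k : ℕ} (P : IntPoly k → Prop) : SAFormula k → Prop
  | .eq p => P p
  | .pos p => P p
  | .not φ => φ.ForallPoly P
  | .and φ ψ => φ.ForallPoly P ∧ ψ.ForallPoly P
  | .or φ ψ => φ.ForallPoly P ∧ ψ.ForallPoly P

theorem SAFormula.ForallPoly.mono {k : ℕ} {P Q : IntPoly k → Prop} (h : ∀ p, P p → Q p)
    {φ : SAFormula k} (hφ : φ.ForallPoly P) : φ.ForallPoly Q := by
  induction φ with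
  | eq p => exact h _ hφ
  | pos p => exact h _ hφ
  | not φ ih => exact ih hφ
  | and φ ψ ih ih' => exact ⟨ih hφ.1, ih' hφ.2⟩
  | or φ ψ ih ih' => exact ⟨ih hφ.1, ih' hφ.2⟩

/-- Membership in the set of a formula depends only on the signs of its polynomials. -/
theorem SAFormula.mem_toSet_iff_of_sign {k : ℕ} {x x' : Fin k → ℝ}
    {φ : SAFormula k}
    (h : φ.ForallPoly fun p => SignType.sign (p.eval x) = SignType.sign (p.eval x')) :
    x ∈ φ.toSet ↔ x' ∈ φ.toSet := by
  induction φ with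
  | eq p =>
    change p.eval x = 0 ↔ p.eval x' = 0
    rw [← sign_eq_zero_iff, show SignType.sign (p.eval x) = _ from h, sign_eq_zero_iff]
  | pos p =>
    change 0 < p.eval x ↔ 0 < p.eval x'
    rw [← sign_eq_one_iff, show SignType.sign (p.eval x) = _ from h, sign_eq_one_iff]
  | not φ ih => exact not_congr (ih h)
  | and φ ψ ih ih' => exact and_congr (ih h.1) (ih' h.2)
  | or φ ψ ih ih' => exact or_congr (ih h.1) (ih' h.2)

/-- The weighted `ℓ¹`-norm of a polynomial that is given as a list of monomials. -/
def IntPoly.norm {k : ℕ} (p : IntPoly k) : ℕ :=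
  (p.map fun t => t.1.natAbs * 2 ^ ∑ i, t.2 i).sum

/-- A polynomial in `k` variables as a polynomial in one more variable. -/
noncomputable def IntPoly.toMv {k : ℕ} (p : IntPoly k) : MvPolynomial (Fin (k + 1)) ℤ :=
  (p.map fun t => MvPolynomial.monomial
    (Finsupp.equivFunOnFinite.symm (Fin.snoc t.2 0 : Fin (k + 1) → ℕ)) t.1).sum

theorem IntPoly.mvSize_toMv_le {k : ℕ} (p : IntPoly k) : mvSize p.toMv ≤ p.norm := by
  induction p with
  | nil => simp [IntPoly.toMv, mvSize_zero]
  | cons t p ih =>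
    have h1 : IntPoly.toMv (t :: p) = MvPolynomial.monomial
        (Finsupp.equivFunOnFinite.symm (Fin.snoc t.2 0 : Fin (k + 1) → ℕ)) t.1 + IntPoly.toMv p := by
      simp [IntPoly.toMv]
    have h2 : IntPoly.norm (t :: p) = t.1.natAbs * 2 ^ (∑ i, t.2 i) + IntPoly.norm p := by
      simp [IntPoly.norm]
    rw [h1, h2]
    refine (mvSize_add_le _ _).trans (Nat.add_le_add ((mvSize_monomial_le _ _).trans ?_) ih)
    rw [Finsupp.degree_eq_sum]
    simp [Fin.sum_univ_castSucc]

theorem IntPoly.evalReal_toMv {k : ℕ} (p : IntPoly k) (x : Fin k → ℝ) (t : ℝ) :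
    evalReal (Fin.snoc x t : Fin (k + 1) → ℝ) p.toMv = p.eval x := by
  rw [IntPoly.toMv, IntPoly.eval, map_list_sum, List.map_map]
  congr 1
  refine List.map_congr_left fun s _ => ?_
  simp [evalReal, MvPolynomial.eval₂_monomial, Finsupp.prod_fintype, Fin.prod_univ_castSucc]

/-- A constant `q` such that a set in `ℝ^k` defined by polynomials of norm at most `c` is disjoint
from the cube of radius `1 / q` unless the origin lies in its closure. -/
def boxConst (k c : ℕ) : ℕ := elimStep^[k] c + 2

/-- A set that meets the cube of radius `1 / boxConst k c` has the origin in its closure. The sup norm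
of a point of the set is below the radius `t`; when `t` is replaced by a smaller radius, the point can
be followed, as only polynomials of bounded size are involved. -/
theorem SAFormula.zero_mem_closure {k c : ℕ} (hc : 4 ≤ c) {φ : SAFormula k}
    (hφ : φ.ForallPoly fun p => p.norm ≤ c) {x : Fin k → ℝ} (hx : x ∈ φ.toSet)
    (hbox : ∀ j, |x j| * boxConst k c < 1) : (0 : Fin k → ℝ) ∈ closure φ.toSet := by
  set G : ℕ := elimStep^[k] c with hG
  have hq : ((boxConst k c : ℕ) : ℝ) = G + 2 := by simp [boxConst, hG]
  rw [hq] at hbox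
  have hG0 : (0 : ℝ) ≤ G := Nat.cast_nonneg _
  set t : ℝ := 1 / (G + 2) with ht
  have ht0 : 0 < t := by positivity
  have htmul : t * (G + 2) = 1 := by rw [ht]; field_simp
  have ht1 : t * (G + 1) < 1 := by nlinarith
  have ht2 : t ≤ 1 / 2 := by nlinarith
  have hxt : ∀ j, |x j| < t := fun j => by
    rw [ht, lt_div_iff₀ (by positivity)]; exact hbox j
  rw [Metric.mem_closure_iff]
  intro ε hε
  set t' := min t ε with ht'
  have ht'0 : 0 < t' := lt_min ht0 hε
  have ht'1 : t' * (G + 1) < 1 :=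
    lt_of_le_of_lt (mul_le_mul_of_nonneg_right (min_le_left _ _) (by positivity)) ht1
  obtain ⟨y, hy⟩ := exists_signEq_snoc (c := c) (by omega) ht0 ht1 ht'0 ht'1 x fun j =>
    abs_le.1 ((hxt j).le.trans (by linarith))
  -- The bounds `|x j| < t` are sign conditions, too.
  have hXsize : ∀ i : Fin (k + 1), mvSize (MvPolynomial.X i : MvPolynomial (Fin (k + 1)) ℤ) ≤ 2 := by
    intro i
    refine (mvSize_monomial_le _ _).trans ?_
    simp [Finsupp.degree_single]
  have hyt : ∀ j, |y j| < t' := by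
    intro j
    have h1 := hy (MvPolynomial.X (Fin.last k) + MvPolynomial.X j.castSucc)
      ((mvSize_add_le _ _).trans (by linarith [hXsize (Fin.last k), hXsize j.castSucc]))
    have h2 := hy (MvPolynomial.X (Fin.last k) + - MvPolynomial.X j.castSucc)
      ((mvSize_add_le _ _).trans (by
        have h3 := (mvSizeFn (k + 1)).size_neg (MvPolynomial.X j.castSucc)
        change mvSize _ = mvSize _ at h3
        rw [h3]; linarith [hXsize (Fin.last k), hXsize j.castSucc]))
    have hj := abs_lt.1 (hxt j)
    simp only [map_add, map_neg, evalReal, MvPolynomial.eval₂Hom_X', Fin.snoc_last,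
      Fin.snoc_castSucc] at h1 h2
    rw [sign_pos (by linarith), eq_comm, sign_eq_one_iff] at h1 h2
    exact abs_lt.2 ⟨by linarith, by linarith⟩
  refine ⟨y, ?_, ?_⟩
  · refine (SAFormula.mem_toSet_iff_of_sign (hφ.mono fun p hp => ?_)).1 hx
    have := hy p.toMv (p.mvSize_toMv_le.trans hp)
    rwa [p.evalReal_toMv, p.evalReal_toMv] at this
  · rw [dist_comm, dist_pi_lt_iff hε]
    intro j
    rw [Pi.zero_apply, Real.dist_eq, sub_zero]
    exact (hyt j).trans_le (min_le_right _ _)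

end DistMC

namespace DistMC

/-! ### Substitution of affine maps into formulas -/

/-- A polynomial as it occurs in the code of a formula: a list of coefficients and exponent lists.
Missing exponents count as `0`. -/
abbrev RawPoly : Type := List (ℤ × List ℕ)

/-- The polynomial in `k` variables that is given by a list of coefficients and exponent lists. -/
def toPoly (k : ℕ) (p : RawPoly) : IntPoly k := p.map fun t => (t.1, fun i => t.2.getD i 0)

/-- The value of a polynomial that is given by a list of coefficients and exponent lists. -/
noncomputable def rawEval (k : ℕ) (p : RawPoly) (x : Fin k → ℝ) : ℝ :=
  (p.map fun t => (t.1 : ℝ) * ∏ i : Fin k, x i ^ t.2.getD i 0).sum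

theorem eval_toPoly (k : ℕ) (p : RawPoly) (x : Fin k → ℝ) : (toPoly k p).eval x = rawEval k p x := by
  simp [toPoly, IntPoly.eval, rawEval, Function.comp_def]

theorem toPoly_polyCode {k : ℕ} (p : IntPoly k) : toPoly k (polyCode p) = p := by
  simp [toPoly, polyCode, Function.comp_def]

theorem polyCode_toPoly {k : ℕ} {p : RawPoly} (h : ∀ t ∈ p, t.2.length = k) :
    polyCode (toPoly k p) = p := by
  rw [polyCode, toPoly, List.map_map]
  conv_rhs => rw [← List.map_id p]
  refine List.map_congr_left fun t ht => ?_
  obtain ⟨a, e⟩ := t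
  have := h _ ht
  simp only [Function.comp_apply, id_eq, Prod.mk.injEq, true_and]
  refine List.ext_getElem (by simpa using this.symm) fun i h1 h2 => ?_
  simp [h2]

/-- The exponent list of the constant monomial. -/
def zeroExp (k : ℕ) : List ℕ := (List.range k).map fun _ => 0

/-- The product of polynomials. -/
def rawMul (k : ℕ) (p q : RawPoly) : RawPoly :=
  p.flatMap fun t => q.map fun s =>
    (t.1 * s.1, (List.range k).map fun j => t.2.getD j 0 + s.2.getD j 0)

/-- The power of a polynomial. -/
def rawPow (k : ℕ) (p : RawPoly) (n : ℕ) : RawPoly :=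
  Nat.rec [(1, zeroExp k)] (fun _ acc => rawMul k p acc) n

/-- The affine polynomial `w + ∑ j, P j * x j`. -/
def rawLin (k : ℕ) (w : ℤ) (P : ℕ → ℤ) : RawPoly :=
  (w, zeroExp k) ::
    (List.range k).map fun j => (P j, (List.range k).map fun i => (i == j).toNat)

/-- The degree of a monomial in `m` variables. -/
def rawDeg (m : ℕ) (e : List ℕ) : ℕ := ((List.range m).map fun i => e.getD i 0).sum

/-- The polynomial that arises from a monomial by the substitution of `w i + ∑ j, P i j * x j` for
the variables, multiplied by a power of `δ`. -/
def rawSubstMonomial (m k : ℕ) (w : ℕ → ℤ) (P : ℕ → ℕ → ℤ) (δ E : ℕ) (t : ℤ × List ℕ) : RawPoly :=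
  (List.range m).foldl (fun acc i => rawMul k (rawPow k (rawLin k (w i) (P i)) (t.2.getD i 0)) acc)
    [(t.1 * (δ : ℤ) ^ (E - rawDeg m t.2), zeroExp k)]

/-- The polynomial that arises by the substitution of `(w i + ∑ j, P i j * x j) / δ` for the
variables, with denominators cleared. -/
def rawSubst (m k : ℕ) (w : ℕ → ℤ) (P : ℕ → ℕ → ℤ) (δ : ℕ) (p : RawPoly) : RawPoly :=
  p.flatMap (rawSubstMonomial m k w P δ (p.map fun t => rawDeg m t.2).sum)

theorem rawEval_append (k : ℕ) (p q : RawPoly) (x : Fin k → ℝ) :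
    rawEval k (p ++ q) x = rawEval k p x + rawEval k q x := by
  simp [rawEval]

theorem rawEval_cons (k : ℕ) (t : ℤ × List ℕ) (q : RawPoly) (x : Fin k → ℝ) :
    rawEval k (t :: q) x = (t.1 : ℝ) * ∏ i : Fin k, x i ^ t.2.getD i 0 + rawEval k q x := by
  simp [rawEval]

theorem rawEval_nil (k : ℕ) (x : Fin k → ℝ) : rawEval k [] x = 0 := by simp [rawEval]

theorem getD_range_map {β : Type*} (f : ℕ → β) (k i : ℕ) (d : β) (h : i < k) :
    ((List.range k).map f).getD i d = f i := by
  simp [h]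

theorem rawEval_const (k : ℕ) (a : ℤ) (x : Fin k → ℝ) : rawEval k [(a, zeroExp k)] x = a := by
  have : ∀ i : Fin k, (zeroExp k).getD i 0 = 0 := fun i => getD_range_map _ _ _ _ i.2
  simp only [rawEval_cons, this, pow_zero, Finset.prod_const_one, mul_one, rawEval_nil, add_zero]

theorem rawEval_mul (k : ℕ) (p q : RawPoly) (x : Fin k → ℝ) :
    rawEval k (rawMul k p q) x = rawEval k p x * rawEval k q x := by
  induction p with
  | nil => simp [rawMul, rawEval_nil]
  | cons t p ih =>
    have hcons : rawMul k (t :: p) q = (q.map fun s =>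
        (t.1 * s.1, (List.range k).map fun j => t.2.getD j 0 + s.2.getD j 0)) ++ rawMul k p q := by
      simp [rawMul]
    rw [hcons, rawEval_append, ih, rawEval_cons, add_mul]
    congr 1
    rw [rawEval, rawEval, List.map_map, ← List.sum_map_mul_left]
    congr 1
    refine List.map_congr_left fun s _ => ?_
    simp only [Function.comp_apply, Int.cast_mul]
    rw [mul_mul_mul_comm, ← Finset.prod_mul_distrib]
    congr 1
    refine Finset.prod_congr rfl fun i _ => ?_
    rw [getD_range_map _ _ _ _ i.2, pow_add]

theorem rawEval_pow (k : ℕ) (p : RawPoly) (n : ℕ) (x : Fin k → ℝ) :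
    rawEval k (rawPow k p n) x = rawEval k p x ^ n := by
  induction n with
  | zero => rw [pow_zero]; exact (rawEval_const k 1 x).trans Int.cast_one
  | succ n ih =>
    rw [pow_succ', ← ih, ← rawEval_mul]
    rfl

theorem sum_range_map {M : Type*} [AddCommMonoid M] (f : ℕ → M) (n : ℕ) :
    ((List.range n).map f).sum = ∑ i : Fin n, f i := by
  induction n with
  | zero => simp
  | succ n ih => simp [List.range_succ, Fin.sum_univ_castSucc, ih]

theorem rawEval_lin (k : ℕ) (w : ℤ) (P : ℕ → ℤ) (x : Fin k → ℝ) :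
    rawEval k (rawLin k w P) x = w + ∑ j : Fin k, (P j : ℝ) * x j := by
  have h0 : rawEval k (rawLin k w P) x = rawEval k [(w, zeroExp k)] x +
      rawEval k ((List.range k).map fun j =>
        (P j, (List.range k).map fun i => (i == j).toNat)) x := by
    rw [← rawEval_append]; rfl
  rw [h0, rawEval_const, rawEval, List.map_map, sum_range_map]
  congr 1
  refine Finset.sum_congr rfl fun j _ => ?_
  simp only [Function.comp_apply]
  congr 1
  rw [Finset.prod_eq_single j]
  · rw [getD_range_map _ _ _ _ j.2]; simp
  · intro i _ hij
    rw [getD_range_map _ _ _ _ i.2]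
    have : ((i : ℕ) == (j : ℕ)) = false := by simpa using fun h => hij (Fin.ext h)
    simp [this]
  · simp

theorem rawEval_foldl_mul (k m : ℕ) (f : ℕ → RawPoly) (p : RawPoly) (x : Fin k → ℝ) :
    rawEval k ((List.range m).foldl (fun acc i => rawMul k (f i) acc) p) x =
      rawEval k p x * ∏ i : Fin m, rawEval k (f i) x := by
  induction m with
  | zero => simp
  | succ m ih =>
    rw [List.range_succ, List.foldl_append, List.foldl_cons, List.foldl_nil, rawEval_mul, ih,
      Fin.prod_univ_castSucc]
    simp only [Fin.val_castSucc, Fin.val_last]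
    ring

/-- The image of a point under the affine map `x ↦ (w + P x) / δ`. -/
noncomputable def affinePoint (m : ℕ) {k : ℕ} (w : ℕ → ℤ) (P : ℕ → ℕ → ℤ) (δ : ℕ) (x : Fin k → ℝ) :
    Fin m → ℝ :=
  fun i => ((w i : ℝ) + ∑ j : Fin k, (P i j : ℝ) * x j) / δ

theorem rawEval_substMonomial {m k : ℕ} {w : ℕ → ℤ} {P : ℕ → ℕ → ℤ} {δ E : ℕ} (hδ : 0 < δ)
    {t : ℤ × List ℕ} (hE : rawDeg m t.2 ≤ E) (x : Fin k → ℝ) :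
    rawEval k (rawSubstMonomial m k w P δ E t) x = (δ : ℝ) ^ E *
      ((t.1 : ℝ) * ∏ i : Fin m, affinePoint m w P δ x i ^ t.2.getD i 0) := by
  have hδ' : (δ : ℝ) ≠ 0 := by positivity
  rw [rawSubstMonomial, rawEval_foldl_mul, rawEval_const]
  have h1 : ∀ i : Fin m, rawEval k (rawPow k (rawLin k (w i) (P i)) (t.2.getD i 0)) x =
      (δ : ℝ) ^ t.2.getD i 0 * affinePoint m w P δ x i ^ t.2.getD i 0 := by
    intro i
    rw [rawEval_pow, rawEval_lin, ← mul_pow, affinePoint, mul_div_cancel₀ _ hδ']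
  rw [Finset.prod_congr rfl fun i _ => h1 i, Finset.prod_mul_distrib, Finset.prod_pow_eq_pow_sum]
  have h2 : ∑ i : Fin m, t.2.getD i 0 = rawDeg m t.2 := by
    rw [rawDeg, sum_range_map]
  rw [h2, ← Nat.sub_add_cancel hE, pow_add, Nat.sub_add_cancel hE]
  push_cast
  ring

theorem rawEval_subst {m k : ℕ} {w : ℕ → ℤ} {P : ℕ → ℕ → ℤ} {δ : ℕ} (hδ : 0 < δ) (p : RawPoly)
    (x : Fin k → ℝ) : rawEval k (rawSubst m k w P δ p) x =
      (δ : ℝ) ^ (p.map fun t => rawDeg m t.2).sum * rawEval m p (affinePoint m w P δ x) := by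
  have key : ∀ (E : ℕ) (q : RawPoly), (∀ t ∈ q, rawDeg m t.2 ≤ E) →
      rawEval k (q.flatMap (rawSubstMonomial m k w P δ E)) x =
        (δ : ℝ) ^ E * rawEval m q (affinePoint m w P δ x) := by
    intro E q hq
    induction q with
    | nil => simp [rawEval_nil]
    | cons t q ih =>
      rw [List.flatMap_cons, rawEval_append, ih fun s hs => hq s (List.mem_cons_of_mem _ hs),
        rawEval_substMonomial hδ (hq t List.mem_cons_self), rawEval_cons]
      ring
  refine key _ p fun t ht => ?_
  exact List.single_le_sum (fun _ _ => Nat.zero_le _) _ (List.mem_map_of_mem ht)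

theorem length_of_mem_rawMul {k : ℕ} {p q : RawPoly} {t : ℤ × List ℕ} (h : t ∈ rawMul k p q) :
    t.2.length = k := by
  simp only [rawMul, List.mem_flatMap, List.mem_map] at h
  obtain ⟨a, -, b, -, rfl⟩ := h
  simp

theorem length_of_mem_rawSubst {m k : ℕ} {w : ℕ → ℤ} {P : ℕ → ℕ → ℤ} {δ : ℕ} {p : RawPoly}
    {t : ℤ × List ℕ} (h : t ∈ rawSubst m k w P δ p) : t.2.length = k := by
  simp only [rawSubst, List.mem_flatMap] at h
  obtain ⟨s, -, hs⟩ := h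
  rw [rawSubstMonomial] at hs
  cases m with
  | zero =>
    simp only [List.range_zero, List.foldl_nil, List.mem_singleton] at hs
    rw [hs]; simp [zeroExp]
  | succ m =>
    rw [List.range_succ, List.foldl_append, List.foldl_cons, List.foldl_nil] at hs
    exact length_of_mem_rawMul hs

theorem length_of_mem_rawLin {k : ℕ} {w : ℤ} {P : ℕ → ℤ} {t : ℤ × List ℕ}
    (h : t ∈ rawLin k w P) : t.2.length = k := by
  simp only [rawLin, List.mem_cons, List.mem_map] at h
  rcases h with rfl | ⟨j, -, rfl⟩ <;> simp [zeroExp]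

/-- Substitution of an affine map into a formula. -/
def SAFormula.subst {m : ℕ} (k : ℕ) (w : ℕ → ℤ) (P : ℕ → ℕ → ℤ) (δ : ℕ) :
    SAFormula m → SAFormula k
  | .eq p => .eq (toPoly k (rawSubst m k w P δ (polyCode p)))
  | .pos p => .pos (toPoly k (rawSubst m k w P δ (polyCode p)))
  | .not φ => .not (φ.subst k w P δ)
  | .and φ ψ => .and (φ.subst k w P δ) (ψ.subst k w P δ)
  | .or φ ψ => .or (φ.subst k w P δ) (ψ.subst k w P δ)

theorem eval_toPoly_rawSubst {m k : ℕ} {w : ℕ → ℤ} {P : ℕ → ℕ → ℤ} {δ : ℕ} (hδ : 0 < δ)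
    (p : IntPoly m) (x : Fin k → ℝ) : (toPoly k (rawSubst m k w P δ (polyCode p))).eval x =
      (δ : ℝ) ^ ((polyCode p).map fun t => rawDeg m t.2).sum *
        p.eval (affinePoint m w P δ x) := by
  rw [eval_toPoly, rawEval_subst hδ, ← eval_toPoly, toPoly_polyCode]

theorem SAFormula.mem_subst {m k : ℕ} {w : ℕ → ℤ} {P : ℕ → ℕ → ℤ} {δ : ℕ} (hδ : 0 < δ)
    (φ : SAFormula m) (x : Fin k → ℝ) :
    x ∈ (φ.subst k w P δ).toSet ↔ affinePoint m w P δ x ∈ φ.toSet := by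
  have hδ' : (0 : ℝ) < δ := by exact_mod_cast hδ
  induction φ with
  | eq p =>
    change IntPoly.eval _ x = 0 ↔ p.eval _ = 0
    rw [eval_toPoly_rawSubst hδ, mul_eq_zero, or_iff_right (pow_pos hδ' _).ne']
  | pos p =>
    change 0 < IntPoly.eval _ x ↔ 0 < p.eval _
    rw [eval_toPoly_rawSubst hδ, mul_pos_iff_of_pos_left (pow_pos hδ' _)]
  | not φ ih => exact not_congr ih
  | and φ ψ ih ih' => exact and_congr ih ih'
  | or φ ψ ih ih' => exact or_congr ih ih'

/-! ### Recursion on the codes of formulas -/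

/-- Recursion on the codes of formulas. Numbers that are no codes get the value of `atomEq 0`. -/
def foldCode {σ : Type*} (atomEq atomPos : ℕ → σ) (neg : σ → σ) (conj disj : σ → σ → σ) (n : ℕ) : σ :=
  if n.unpair.1 = 0 then atomEq n.unpair.2
  else if n.unpair.1 = 1 then atomPos n.unpair.2
  else if _h2 : n.unpair.1 = 2 then neg (foldCode atomEq atomPos neg conj disj n.unpair.2)
  else if _h3 : n.unpair.1 = 3 then
    conj (foldCode atomEq atomPos neg conj disj n.unpair.2.unpair.1)
      (foldCode atomEq atomPos neg conj disj n.unpair.2.unpair.2)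
  else if _h4 : n.unpair.1 = 4 then
    disj (foldCode atomEq atomPos neg conj disj n.unpair.2.unpair.1)
      (foldCode atomEq atomPos neg conj disj n.unpair.2.unpair.2)
  else atomEq 0
termination_by n
decreasing_by
  all_goals
    have h1 := Nat.add_le_pair n.unpair.1 n.unpair.2
    rw [Nat.pair_unpair] at h1
    have h5 := Nat.unpair_left_le n.unpair.2
    have h6 := Nat.unpair_right_le n.unpair.2
    omega

section
variable {σ : Type*} (atomEq atomPos : ℕ → σ) (neg : σ → σ) (conj disj : σ → σ → σ)

theorem foldCode_zero (r : ℕ) :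
    foldCode atomEq atomPos neg conj disj (Nat.pair 0 r) = atomEq r := by
  rw [foldCode]; simp

theorem foldCode_one (r : ℕ) :
    foldCode atomEq atomPos neg conj disj (Nat.pair 1 r) = atomPos r := by
  rw [foldCode]; simp

theorem foldCode_two (r : ℕ) : foldCode atomEq atomPos neg conj disj (Nat.pair 2 r) =
    neg (foldCode atomEq atomPos neg conj disj r) := by
  rw [foldCode]; simp

theorem foldCode_three (r s : ℕ) :
    foldCode atomEq atomPos neg conj disj (Nat.pair 3 (Nat.pair r s)) =
    conj (foldCode atomEq atomPos neg conj disj r) (foldCode atomEq atomPos neg conj disj s) := by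
  rw [foldCode]; simp

theorem foldCode_four (r s : ℕ) :
    foldCode atomEq atomPos neg conj disj (Nat.pair 4 (Nat.pair r s)) =
    disj (foldCode atomEq atomPos neg conj disj r) (foldCode atomEq atomPos neg conj disj s) := by
  rw [foldCode]; simp

end

/-- The polynomial with a given code. -/
def decodePoly (n : ℕ) : RawPoly := (Encodable.decode n : Option RawPoly).getD []

theorem decodePoly_encode (p : RawPoly) : decodePoly (Encodable.encode p) = p := by
  simp [decodePoly]

/-- Substitution of an affine map into the code of a formula. -/
def substCode (m k : ℕ) (w : ℕ → ℤ) (P : ℕ → ℕ → ℤ) (δ : ℕ) : ℕ → ℕ :=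
  foldCode (fun r => Nat.pair 0 (Encodable.encode (rawSubst m k w P δ (decodePoly r))))
    (fun r => Nat.pair 1 (Encodable.encode (rawSubst m k w P δ (decodePoly r))))
    (fun a => Nat.pair 2 a) (fun a b => Nat.pair 3 (Nat.pair a b))
    (fun a b => Nat.pair 4 (Nat.pair a b))

theorem code_subst {m : ℕ} (k : ℕ) (w : ℕ → ℤ) (P : ℕ → ℕ → ℤ) (δ : ℕ) (φ : SAFormula m) :
    (φ.subst k w P δ).code = substCode m k w P δ φ.code := by
  induction φ with
  | eq p =>
    rw [SAFormula.code, substCode, foldCode_zero, decodePoly_encode, SAFormula.subst,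
      SAFormula.code, polyCode_toPoly fun t => length_of_mem_rawSubst]
  | pos p =>
    rw [SAFormula.code, substCode, foldCode_one, decodePoly_encode, SAFormula.subst,
      SAFormula.code, polyCode_toPoly fun t => length_of_mem_rawSubst]
  | not φ ih =>
    rw [SAFormula.code, substCode, foldCode_two, SAFormula.subst, SAFormula.code, ih]; rfl
  | and φ ψ ih ih' =>
    rw [SAFormula.code, substCode, foldCode_three, SAFormula.subst, SAFormula.code, ih, ih']; rfl
  | or φ ψ ih ih' =>
    rw [SAFormula.code, substCode, foldCode_four, SAFormula.subst, SAFormula.code, ih, ih']; rfl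

/-- The constant term of a polynomial in no variables. -/
def constTerm (p : RawPoly) : ℤ := (p.map fun t => t.1).sum

theorem rawEval_zero (p : RawPoly) (x : Fin 0 → ℝ) : rawEval 0 p x = constTerm p := by
  simp only [rawEval, constTerm, Finset.univ_eq_empty, Finset.prod_empty, mul_one]
  induction p with
  | nil => simp
  | cons t p ih => simp [ih]

/-- The truth value of a formula at the rational point `w / δ`, computed from the code. -/
def evalCode (m : ℕ) (w : ℕ → ℤ) (δ : ℕ) : ℕ → Bool :=
  foldCode (fun r => constTerm (rawSubst m 0 w (fun _ _ => 0) δ (decodePoly r)) == 0)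
    -- An integer is positive if and only if `Int.toNat` does not send it to `0`.
    (fun r => (constTerm (rawSubst m 0 w (fun _ _ => 0) δ (decodePoly r))).toNat != 0)
    (fun a => !a) (fun a b => a && b) (fun a b => a || b)

theorem evalCode_iff {m : ℕ} {w : ℕ → ℤ} {δ : ℕ} (hδ : 0 < δ) (φ : SAFormula m) :
    evalCode m w δ φ.code = true ↔ (fun i : Fin m => (w i : ℝ) / δ) ∈ φ.toSet := by
  have hδ' : (0 : ℝ) < δ := by exact_mod_cast hδ
  have hpt : affinePoint m w (fun _ _ => 0) δ (0 : Fin 0 → ℝ) = fun i : Fin m => (w i : ℝ) / δ := by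
    funext i; simp [affinePoint]
  have hval : ∀ p : IntPoly m, ((constTerm (rawSubst m 0 w (fun _ _ => 0) δ (polyCode p)) : ℤ) : ℝ) =
      (δ : ℝ) ^ ((polyCode p).map fun t => rawDeg m t.2).sum *
        p.eval (fun i : Fin m => (w i : ℝ) / δ) := by
    intro p
    rw [← rawEval_zero _ 0, rawEval_subst hδ, hpt, ← eval_toPoly, toPoly_polyCode]
  induction φ with
  | eq p =>
    rw [SAFormula.code, evalCode, foldCode_zero, decodePoly_encode, beq_iff_eq]
    change _ ↔ p.eval _ = 0
    rw [← Int.cast_eq_zero (α := ℝ), hval, mul_eq_zero, or_iff_right (pow_pos hδ' _).ne']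
  | pos p =>
    rw [SAFormula.code, evalCode, foldCode_one, decodePoly_encode, bne_iff_ne]
    change _ ↔ 0 < p.eval _
    rw [← mul_pos_iff_of_pos_left (pow_pos hδ' _), ← hval, Int.cast_pos]
    omega
  | not φ ih =>
    have h : evalCode m w δ φ.not.code = !evalCode m w δ φ.code := by
      rw [SAFormula.code, evalCode, foldCode_two]
    rw [h, Bool.not_eq_true', ← Bool.not_eq_true]
    exact not_congr ih
  | and φ ψ ih ih' =>
    have h : evalCode m w δ (φ.and ψ).code = (evalCode m w δ φ.code && evalCode m w δ ψ.code) := by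
      rw [SAFormula.code, evalCode, foldCode_three]
    rw [h, Bool.and_eq_true]
    exact and_congr ih ih'
  | or φ ψ ih ih' =>
    have h : evalCode m w δ (φ.or ψ).code = (evalCode m w δ φ.code || evalCode m w δ ψ.code) := by
      rw [SAFormula.code, evalCode, foldCode_four]
    rw [h, Bool.or_eq_true]
    exact or_congr ih ih'

/-! ### Restriction of a formula to a cube -/

/-- The polynomial `1 + a * x j`. -/
def coordPoly (k : ℕ) (a : ℤ) (j : ℕ) : RawPoly :=
  rawLin k 1 fun i => if i = j then a else 0

/-- The code of the conjunction of a formula with `|x j| * q < 1`, for all `j`, see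
`SAFormula.box`. -/
def boxCode (k q c : ℕ) : ℕ :=
  (List.range k).foldl (fun acc j => Nat.pair 3 (Nat.pair acc (Nat.pair 3 (Nat.pair
    (Nat.pair 1 (Encodable.encode (coordPoly k q j)))
    (Nat.pair 1 (Encodable.encode (coordPoly k (-q) j))))))) c

/-- The conjunction of a formula with `|x j| * q < 1`, for all `j`. -/
def SAFormula.box {k : ℕ} (q : ℕ) (φ : SAFormula k) : SAFormula k :=
  (List.range k).foldl (fun acc j => .and acc (.and (.pos (toPoly k (coordPoly k q j)))
    (.pos (toPoly k (coordPoly k (-q) j))))) φ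

theorem code_box {k : ℕ} (q : ℕ) (φ : SAFormula k) : (φ.box q).code = boxCode k q φ.code := by
  rw [SAFormula.box, boxCode]
  generalize List.range k = l
  induction l generalizing φ with
  | nil => rfl
  | cons j l ih =>
    rw [List.foldl_cons, List.foldl_cons, ih]
    simp only [SAFormula.code]
    rw [polyCode_toPoly (p := coordPoly k q j) fun t => length_of_mem_rawLin,
      polyCode_toPoly (p := coordPoly k (-q) j) fun t => length_of_mem_rawLin]

theorem rawEval_coordPoly {k : ℕ} (a : ℤ) (j : Fin k) (x : Fin k → ℝ) :
    rawEval k (coordPoly k a j) x = 1 + a * x j := by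
  rw [coordPoly, rawEval_lin]
  simp [Fin.val_inj]

theorem SAFormula.mem_box {k : ℕ} (q : ℕ) (φ : SAFormula k) (x : Fin k → ℝ) :
    x ∈ (φ.box q).toSet ↔ x ∈ φ.toSet ∧ ∀ j, |x j| * q < 1 := by
  have key : ∀ (l : List ℕ) (φ : SAFormula k), (∀ j ∈ l, j < k) →
      (x ∈ (l.foldl (fun acc j => SAFormula.and acc (.and (.pos (toPoly k (coordPoly k q j)))
        (.pos (toPoly k (coordPoly k (-q) j))))) φ).toSet ↔
        x ∈ φ.toSet ∧ ∀ j : Fin k, (j : ℕ) ∈ l → |x j| * q < 1) := by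
    intro l
    induction l with
    | nil => intro φ _; simp
    | cons i l ih =>
      intro φ hl
      rw [List.foldl_cons, ih _ fun j hj => hl j (List.mem_cons_of_mem _ hj)]
      have hi : i < k := hl i List.mem_cons_self
      have h1 : x ∈ (SAFormula.and φ (.and (.pos (toPoly k (coordPoly k q i)))
          (.pos (toPoly k (coordPoly k (-q) i))))).toSet ↔ x ∈ φ.toSet ∧ |x ⟨i, hi⟩| * q < 1 := by
        change x ∈ φ.toSet ∧ (0 < IntPoly.eval _ x ∧ 0 < IntPoly.eval _ x) ↔ _
        rw [eval_toPoly, eval_toPoly, rawEval_coordPoly _ ⟨i, hi⟩, rawEval_coordPoly _ ⟨i, hi⟩]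
        have hq : |x ⟨i, hi⟩| * q = |x ⟨i, hi⟩ * q| := by rw [abs_mul, Nat.abs_cast]
        rw [hq, abs_lt]
        push_cast
        refine and_congr_right fun _ => ?_
        constructor <;> rintro ⟨h1, h2⟩ <;> constructor <;> linarith
      rw [h1, and_assoc]
      refine and_congr_right fun _ => ⟨?_, ?_⟩
      · rintro ⟨h2, h3⟩ j hj
        rcases List.mem_cons.1 hj with h | h
        · have : j = ⟨i, hi⟩ := Fin.ext h
          rwa [this]
        · exact h3 j h
      · intro h
        exact ⟨h ⟨i, hi⟩ List.mem_cons_self, fun j hj => h j (List.mem_cons_of_mem _ hj)⟩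
  rw [SAFormula.box, key _ _ fun j hj => List.mem_range.1 hj]
  simp

/-! ### Bounds for the polynomials in a formula in terms of its code -/

theorem natAbs_le_encode (z : ℤ) : z.natAbs ≤ Encodable.encode z := by
  cases z with
  | ofNat n =>
    change n ≤ Equiv.natSumNatEquivNat (Sum.inl n)
    rw [Equiv.natSumNatEquivNat_apply, Sum.elim_inl]; omega
  | negSucc n =>
    change n + 1 ≤ Equiv.natSumNatEquivNat (Sum.inr n)
    rw [Equiv.natSumNatEquivNat_apply, Sum.elim_inr]; omega

theorem le_encode_list {l : List ℕ} {a : ℕ} (h : a ∈ l) : a ≤ Encodable.encode l := by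
  induction l with
  | nil => simp at h
  | cons b l ih =>
    rw [Encodable.encode_list_cons]
    have h1 := Nat.add_le_pair (Encodable.encode b) (Encodable.encode l)
    rcases List.mem_cons.1 h with rfl | h
    · simp only [Encodable.encode_nat] at h1 ⊢; omega
    · have := ih h; omega

theorem norm_le_encode {k : ℕ} (p : IntPoly k) : p.norm ≤
    Encodable.encode (polyCode p) * 2 ^ (k * Encodable.encode (polyCode p)) := by
  induction p with
  | nil => simp [IntPoly.norm]
  | cons t p ih =>
    have hnorm : IntPoly.norm (t :: p) = t.1.natAbs * 2 ^ (∑ i, t.2 i) + IntPoly.norm p := by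
      simp [IntPoly.norm]
    have hcode : polyCode (t :: p) = (t.1, List.ofFn t.2) :: polyCode p := rfl
    rw [hnorm, hcode, Encodable.encode_list_cons, Encodable.encode_prod_val]
    have h1 := Nat.add_le_pair (Encodable.encode t.1) (Encodable.encode (List.ofFn t.2))
    set a := Nat.pair (Encodable.encode t.1) (Encodable.encode (List.ofFn t.2))
    set b := Encodable.encode (polyCode p)
    have h2 := Nat.add_le_pair a b
    have h3 : t.1.natAbs ≤ a := (natAbs_le_encode t.1).trans (by omega)
    have h4 : ∑ i, t.2 i ≤ k * a := by
      have : ∀ i ∈ Finset.univ, t.2 i ≤ a := fun i _ =>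
        (le_encode_list (List.mem_ofFn.2 ⟨i, rfl⟩)).trans (by omega)
      simpa using Finset.sum_le_card_nsmul _ _ _ this
    set n := (Nat.pair a b).succ with hn
    have h5 : a + b ≤ n := by omega
    have h6 : 2 ^ (∑ i, t.2 i) ≤ 2 ^ (k * n) :=
      Nat.pow_le_pow_right (by omega) (h4.trans (Nat.mul_le_mul_left _ (by omega)))
    have h7 : 2 ^ (k * b) ≤ 2 ^ (k * n) :=
      Nat.pow_le_pow_right (by omega) (Nat.mul_le_mul_left _ (by omega))
    calc _ ≤ a * 2 ^ (k * n) + b * 2 ^ (k * n) :=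
          Nat.add_le_add (Nat.mul_le_mul h3 h6) (ih.trans (Nat.mul_le_mul_left _ h7))
      _ = (a + b) * 2 ^ (k * n) := by ring
      _ ≤ _ := Nat.mul_le_mul_right _ h5

/-- A bound for the norms of the polynomials in a formula, in terms of its code. -/
def normBound (k n : ℕ) : ℕ := n * 2 ^ (k * n) + 4

theorem normBound_mono {k n n' : ℕ} (h : n ≤ n') : normBound k n ≤ normBound k n' := by
  unfold normBound
  gcongr
  norm_num

theorem SAFormula.forallPoly_norm_le {k : ℕ} (φ : SAFormula k) :
    φ.ForallPoly fun p => p.norm ≤ normBound k φ.code := by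
  have hpair : ∀ a b, b ≤ Nat.pair a b := fun a b =>
    (Nat.le_add_left b a).trans (Nat.add_le_pair a b)
  have hpair' : ∀ a b, a ≤ Nat.pair a b := fun a b =>
    (Nat.le_add_right a b).trans (Nat.add_le_pair a b)
  induction φ with
  | eq p =>
    exact (norm_le_encode p).trans ((Nat.le_add_right _ 4).trans (normBound_mono (hpair _ _)))
  | pos p =>
    exact (norm_le_encode p).trans ((Nat.le_add_right _ 4).trans (normBound_mono (hpair _ _)))
  | not φ ih => exact ih.mono fun p hp => hp.trans (normBound_mono (hpair _ _))
  | and φ ψ ih ih' =>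
    exact ⟨ih.mono fun p hp => hp.trans (normBound_mono ((hpair' _ _).trans (hpair _ _))),
      ih'.mono fun p hp => hp.trans (normBound_mono ((hpair _ _).trans (hpair _ _)))⟩
  | or φ ψ ih ih' =>
    exact ⟨ih.mono fun p hp => hp.trans (normBound_mono ((hpair' _ _).trans (hpair _ _))),
      ih'.mono fun p hp => hp.trans (normBound_mono ((hpair _ _).trans (hpair _ _)))⟩

end DistMC

namespace DistMC

/-! ### Dimensions under affine embeddings -/

theorem IsSemialgebraic.inter {k : ℕ} {S T : Set (Fin k → ℝ)} (hS : IsSemialgebraic S)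
    (hT : IsSemialgebraic T) : IsSemialgebraic (S ∩ T) := by
  obtain ⟨φ, rfl⟩ := hS
  obtain ⟨ψ, rfl⟩ := hT
  exact ⟨φ.and ψ, rfl⟩

theorem isSemialgebraic_zero (k : ℕ) : IsSemialgebraic ({0} : Set (Fin k → ℝ)) := by
  refine ⟨.eq (List.ofFn fun i => (1, fun j => if j = i then 2 else 0)), ?_⟩
  ext x
  change IntPoly.eval _ x = 0 ↔ x = 0
  have : IntPoly.eval (List.ofFn fun i => (1, fun j => if j = i then 2 else 0)) x =
      ∑ i, x i ^ 2 := by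
    rw [IntPoly.eval, List.map_ofFn, List.sum_ofFn]
    refine Finset.sum_congr rfl fun i _ => ?_
    simp
  rw [this, Finset.sum_eq_zero_iff_of_nonneg fun i _ => sq_nonneg (x i)]
  simp [funext_iff]

theorem exists_common_denominator {ι : Type*} [Fintype ι] (f : ι → ℚ) :
    ∃ δ : ℕ, 0 < δ ∧ ∃ g : ι → ℤ, ∀ i, f i = (g i : ℚ) / δ := by
  classical
  refine ⟨∏ i, (f i).den, Finset.prod_pos fun i _ => (f i).den_pos,
    fun i => (f i).num * ∏ j ∈ Finset.univ.erase i, ((f j).den : ℤ), fun i => ?_⟩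
  rw [← Finset.mul_prod_erase _ _ (Finset.mem_univ i)]
  push_cast
  have h : (∏ j ∈ Finset.univ.erase i, ((f j).den : ℚ)) ≠ 0 :=
    Finset.prod_ne_zero_iff.2 fun j _ => by exact_mod_cast (f j).den_nz
  rw [mul_div_mul_right _ _ h, Rat.num_div_den]

/-- Affine functions with rational coefficients. They are allowed to be rational, as denominators can
be cleared in formulas. -/
def RatAffine {k : ℕ} (f : (Fin k → ℝ) → ℝ) : Prop :=
  ∃ (b : ℚ) (n : Fin k → ℚ), ∀ x, f x = b + ∑ j, (n j : ℝ) * x j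

namespace RatAffine

variable {k : ℕ}

theorem const (b : ℚ) : RatAffine fun _ : Fin k → ℝ => (b : ℝ) := ⟨b, 0, fun x => by simp⟩

theorem coord (j : Fin k) : RatAffine fun x : Fin k → ℝ => x j :=
  ⟨0, fun i => if i = j then 1 else 0, fun x => by simp [apply_ite (Rat.cast : ℚ → ℝ)]⟩

theorem add {f g : (Fin k → ℝ) → ℝ} (hf : RatAffine f) (hg : RatAffine g) :
    RatAffine fun x => f x + g x := by
  obtain ⟨b, n, h⟩ := hf
  obtain ⟨b', n', h'⟩ := hg
  refine ⟨b + b', n + n', fun x => ?_⟩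
  simp only [h, h', Pi.add_apply, Rat.cast_add, add_mul, Finset.sum_add_distrib]
  ring

theorem const_mul (a : ℚ) {f : (Fin k → ℝ) → ℝ} (hf : RatAffine f) :
    RatAffine fun x => (a : ℝ) * f x := by
  obtain ⟨b, n, h⟩ := hf
  refine ⟨a * b, fun j => a * n j, fun x => ?_⟩
  simp only [h, Rat.cast_mul, mul_add, Finset.mul_sum, mul_assoc]

theorem sub {f g : (Fin k → ℝ) → ℝ} (hf : RatAffine f) (hg : RatAffine g) :
    RatAffine fun x => f x - g x := by
  have h := hf.add (hg.const_mul (-1))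
  have he : (fun x => f x - g x) = fun x => f x + ((-1 : ℚ) : ℝ) * g x := by
    funext x; push_cast; ring
  rwa [he]

theorem sum {ι : Type*} (s : Finset ι) {f : ι → (Fin k → ℝ) → ℝ} (hf : ∀ i, RatAffine (f i)) :
    RatAffine fun x => ∑ i ∈ s, f i x := by
  classical
  induction s using Finset.induction_on with
  | empty => simpa using const (k := k) 0
  | insert i s hi ih =>
    simp only [Finset.sum_insert hi]
    exact (hf i).add ih

theorem comp {l : ℕ} {f : (Fin l → ℝ) → ℝ} (hf : RatAffine f) {G : (Fin k → ℝ) → Fin l → ℝ}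
    (hG : ∀ i, RatAffine fun x => G x i) : RatAffine fun x => f (G x) := by
  obtain ⟨b, n, h⟩ := hf
  have he : (fun x => f (G x)) = fun x => (b : ℝ) + ∑ j, (n j : ℝ) * G x j := by
    funext x; exact h _
  rw [he]
  exact (const b).add (sum _ fun j => (hG j).const_mul (n j))

theorem continuous {f : (Fin k → ℝ) → ℝ} (hf : RatAffine f) : Continuous f := by
  obtain ⟨b, n, h⟩ := hf
  rw [show f = fun x => (b : ℝ) + ∑ j, (n j : ℝ) * x j from funext h]
  fun_prop

end RatAffine

theorem IsSemialgebraic.preimage {k m : ℕ} {G : (Fin k → ℝ) → Fin m → ℝ}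
    (hG : ∀ i, RatAffine fun x => G x i) {S : Set (Fin m → ℝ)} (hS : IsSemialgebraic S) :
    IsSemialgebraic (G ⁻¹' S) := by
  obtain ⟨φ, rfl⟩ := hS
  choose b n h using hG
  obtain ⟨δ, hδ, g, hg⟩ :=
    exists_common_denominator (Sum.elim b fun ij : Fin m × Fin k => n ij.1 ij.2)
  refine ⟨φ.subst k (fun i => if hi : i < m then g (.inl ⟨i, hi⟩) else 0)
    (fun i j => if hij : i < m ∧ j < k then g (.inr (⟨i, hij.1⟩, ⟨j, hij.2⟩)) else 0) δ, ?_⟩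
  ext x
  rw [SAFormula.mem_subst hδ, Set.mem_preimage]
  refine iff_of_eq (congrArg (· ∈ φ.toSet) (funext fun i => ?_))
  have hb : (b i : ℝ) = (g (.inl i) : ℝ) / δ := by
    have := hg (.inl i); simp only [Sum.elim_inl] at this; rw [this]; push_cast; rfl
  have hn : ∀ j, (n i j : ℝ) = (g (.inr (i, j)) : ℝ) / δ := fun j => by
    have := hg (.inr (i, j)); simp only [Sum.elim_inr] at this; rw [this]; push_cast; rfl
  simp only [affinePoint, i.2, Fin.is_lt, and_self, dite_true, Fin.eta]
  have hi := h i x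
  dsimp only at hi
  rw [hi, hb, add_div, Finset.sum_div]
  congr 1
  refine Finset.sum_congr rfl fun j _ => ?_
  rw [hn]; ring

/-- Cells are transported by affine embeddings with rational coefficients. -/
theorem IsCell.image {k m d : ℕ} {C : Set (Fin k → ℝ)} (hC : IsCell d C)
    {G : (Fin k → ℝ) → Fin m → ℝ} {H : (Fin m → ℝ) → Fin k → ℝ}
    (hG : ∀ i, RatAffine fun x => G x i) (hH : ∀ j, RatAffine fun y => H y j)
    (hHG : ∀ x, H (G x) = x) : IsCell d (G '' C) := by
  obtain ⟨hS, e, he⟩ := hC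
  have hGc : Continuous G := continuous_pi fun i => (hG i).continuous
  have hHc : Continuous H := continuous_pi fun i => (hH i).continuous
  have hGH : ∀ i, RatAffine fun y => (G (H y) - y) i := fun i =>
    ((hG i).comp hH).sub (RatAffine.coord i)
  have himage : ∀ y, y ∈ G '' C ↔ H y ∈ C ∧ G (H y) - y = 0 := by
    intro y
    constructor
    · rintro ⟨x, hx, rfl⟩
      rw [hHG, sub_self]; exact ⟨hx, rfl⟩
    · rintro ⟨h1, h2⟩
      exact ⟨H y, h1, sub_eq_zero.1 h2⟩
  refine ⟨?_, ?_⟩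
  · have := (hS.preimage hH).inter ((isSemialgebraic_zero m).preimage hGH)
    convert this using 1
    ext y
    exact himage y
  let e₀ : G '' C ≃ₜ C :=
    { toFun := fun y => ⟨H y, ((himage y).1 y.2).1⟩
      invFun := fun x => ⟨G x, Set.mem_image_of_mem G x.2⟩
      left_inv := fun y => Subtype.ext (sub_eq_zero.1 ((himage y).1 y.2).2)
      right_inv := fun x => Subtype.ext (hHG x)
      continuous_toFun := by fun_prop
      continuous_invFun := by fun_prop }
  refine ⟨e₀.trans e, ?_⟩
  let K : (Fin (m + d) → ℝ) → Fin (k + d) → ℝ := fun z =>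
    Fin.append (H fun i => z (Fin.castAdd d i)) fun j => z (Fin.natAdd m j)
  have hK : ∀ i, RatAffine fun z => K z i := by
    intro i
    refine Fin.addCases (fun i => ?_) (fun i => ?_) i
    · simp only [K, Fin.append_left]
      exact (hH i).comp fun j => RatAffine.coord _
    · simp only [K, Fin.append_right]
      exact RatAffine.coord _
  have := (he.preimage hK).inter ((isSemialgebraic_zero m).preimage
    (G := fun z : Fin (m + d) → ℝ => G (H fun i => z (Fin.castAdd d i)) - fun i =>
      z (Fin.castAdd d i)) fun i => (hGH i).comp fun j => RatAffine.coord _)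
  convert this using 1
  ext z
  obtain ⟨z₁, z₂, rfl⟩ : ∃ z₁ z₂, z = Fin.append z₁ z₂ :=
    ⟨fun i => z (Fin.castAdd d i), fun j => z (Fin.natAdd m j), (Fin.append_castAdd_natAdd).symm⟩
  simp only [Set.mem_inter_iff, Set.mem_preimage, Set.mem_ofPred_eq, Set.mem_singleton_iff, K,
    Fin.append_left, Fin.append_right]
  constructor
  · rintro ⟨y, hy⟩
    have h1 : z₁ = (y : Fin m → ℝ) := by
      funext i; simpa using congrFun hy (Fin.castAdd d i)
    have h2 : z₂ = (e (e₀ y) : Fin d → ℝ) := by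
      funext j; simpa using congrFun hy (Fin.natAdd m j)
    exact ⟨⟨e₀ y, by rw [h1, h2]; rfl⟩, by rw [h1]; exact ((himage y).1 y.2).2⟩
  · rintro ⟨⟨x, hx⟩, h0⟩
    have h1 : H z₁ = (x : Fin k → ℝ) := by
      funext i; simpa using congrFun hx (Fin.castAdd d i)
    have h2 : z₂ = (e x : Fin d → ℝ) := by
      funext j; simpa using congrFun hx (Fin.natAdd k j)
    refine ⟨⟨z₁, (himage z₁).2 ⟨by rw [h1]; exact x.2, h0⟩⟩, ?_⟩
    have h3 : e₀ ⟨z₁, (himage z₁).2 ⟨by rw [h1]; exact x.2, h0⟩⟩ = x := Subtype.ext h1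
    rw [Homeomorph.trans_apply, h3, h2]

/-- An affine embedding with rational coefficients and an affine left inverse maps cells to cells. -/
theorem intrinsicDim_mono_image {k m : ℕ} {S : Set (Fin k → ℝ)} {T : Set (Fin m → ℝ)}
    {G : (Fin k → ℝ) → Fin m → ℝ} {H : (Fin m → ℝ) → Fin k → ℝ}
    (hG : ∀ i, RatAffine fun x => G x i) (hH : ∀ j, RatAffine fun y => H y j)
    (hHG : ∀ x, H (G x) = x) (hST : ∀ x ∈ S, G x ∈ T) : intrinsicDim S ≤ intrinsicDim T := by
  refine iSup₂_le fun d hd => ?_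
  obtain ⟨C, hCS, hC⟩ := hd
  exact le_iSup₂_of_le d ⟨G '' C, by rintro _ ⟨x, hx, rfl⟩; exact hST x (hCS hx),
    hC.image hG hH hHG⟩ le_rfl

theorem ratAffine_affinePoint {m k : ℕ} (w : ℕ → ℤ) (P : ℕ → ℕ → ℤ) (δ : ℕ) (i : Fin m) :
    RatAffine fun x : Fin k → ℝ => affinePoint m w P δ x i := by
  have he : (fun x : Fin k → ℝ => affinePoint m w P δ x i) = fun x =>
      ((1 / δ : ℚ) : ℝ) * (((w i : ℚ) : ℝ) + ∑ j : Fin k, ((P i j : ℚ) : ℝ) * x j) := by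
    funext x
    rw [affinePoint]; push_cast; ring
  rw [he]
  exact ((RatAffine.const _).add (RatAffine.sum _ fun j => (RatAffine.coord j).const_mul _)).const_mul
    _

theorem sum_leftInverse {m k : ℕ} {P : ℕ → ℕ → ℤ} {Q : Fin k → Fin m → ℚ}
    (hQ : ∀ j l : Fin k, ∑ i, Q j i * P i l = if j = l then 1 else 0) (x : Fin k → ℝ) (j : Fin k) :
    ∑ i, (Q j i : ℝ) * ∑ l : Fin k, (P i l : ℝ) * x l = x j := by
  simp only [Finset.mul_sum]
  rw [Finset.sum_comm]
  have h2 : ∀ l : Fin k, ∑ i, (Q j i : ℝ) * ((P i l : ℝ) * x l) = if j = l then x l else 0 := by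
    intro l
    have h3 : ((∑ i, Q j i * P i l : ℚ) : ℝ) = ((if j = l then 1 else 0 : ℚ) : ℝ) :=
      congrArg _ (hQ j l)
    simp only [← mul_assoc, ← Finset.sum_mul]
    push_cast at h3
    rw [h3]
    split_ifs <;> simp
  simp [h2]

theorem intrinsicDim_le_of_affinePoint {m k : ℕ} {w : ℕ → ℤ} {P : ℕ → ℕ → ℤ} {δ : ℕ} (hδ : 0 < δ)
    {Q : Fin k → Fin m → ℚ} (hQ : ∀ j l : Fin k, ∑ i, Q j i * P i l = if j = l then 1 else 0)
    {S : Set (Fin k → ℝ)} {T : Set (Fin m → ℝ)} (hST : ∀ x ∈ S, affinePoint m w P δ x ∈ T) :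
    intrinsicDim S ≤ intrinsicDim T := by
  have hδ' : (δ : ℝ) ≠ 0 := by positivity
  refine intrinsicDim_mono_image (H := fun y j => ∑ i, (Q j i : ℝ) *
    (((δ : ℚ) : ℝ) * y i - ((w i : ℚ) : ℝ))) (ratAffine_affinePoint w P δ) (fun j => ?_) (fun x => ?_)
    hST
  · exact RatAffine.sum _ fun i => (((RatAffine.coord i).const_mul _).sub
      (RatAffine.const _)).const_mul _
  · funext j
    have h1 : ∀ i : Fin m, (δ : ℝ) * affinePoint m w P δ x i - (w i : ℝ) =
        ∑ l : Fin k, (P i l : ℝ) * x l := fun i => by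
      rw [affinePoint, mul_div_cancel₀ _ hδ']; ring
    push_cast
    simp only [h1]
    exact sum_leftInverse hQ x j

/-- If `w / δ` lies in the span of the target, then the span of the new target loses a dimension,
as the coordinates of `w` have nonzero sum but those of the columns of `P` have sum `0`. -/
theorem linearDim_le_of_affinePoint {m k : ℕ} {w : ℕ → ℤ} {P : ℕ → ℕ → ℤ} {δ : ℕ} (hδ : 0 < δ)
    {Q : Fin k → Fin m → ℚ} (hQ : ∀ j l : Fin k, ∑ i, Q j i * P i l = if j = l then 1 else 0)
    (hP : ∀ j : Fin k, ∑ i : Fin m, P i j = 0) (hw : ∑ i : Fin m, w i ≠ 0)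
    {S : Set (Fin k → ℝ)} {T : Set (Fin m → ℝ)} (hST : ∀ x ∈ S, affinePoint m w P δ x ∈ T)
    (hcl : S.Nonempty → (fun i : Fin m => (w i : ℝ) / δ) ∈ closure T) :
    linearDim S ≤ linearDim T - 1 := by
  have hδ' : (δ : ℝ) ≠ 0 := by positivity
  rcases S.eq_empty_or_nonempty with rfl | hS
  · rw [linearDim, Submodule.span_empty, finrank_bot]
    exact Nat.zero_le _
  set W := Submodule.span ℝ T with hW
  have hw0 : (fun i : Fin m => (w i : ℝ) / δ) ∈ W := by
    have hclosed : IsClosed (W : Set (Fin m → ℝ)) := W.closed_of_finiteDimensional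
    exact closure_minimal Submodule.subset_span hclosed (hcl hS)
  let N : Matrix (Fin m) (Fin k) ℝ := Matrix.of fun i j => (P i j : ℝ) / δ
  let L : (Fin k → ℝ) →ₗ[ℝ] (Fin m → ℝ) := N.mulVecLin
  have hLi : ∀ x i, L x i = (∑ j : Fin k, (P i j : ℝ) * x j) / δ := by
    intro x i
    simp only [L, N, Matrix.mulVecLin_apply, Matrix.mulVec, dotProduct, Matrix.of_apply,
      Finset.sum_div]
    exact Finset.sum_congr rfl fun j _ => by ring
  have hLinj : Function.Injective L := by
    intro x y hxy
    funext l
    have h0 : ∀ x : Fin k → ℝ, ∑ i, (Q l i : ℝ) * (δ * L x i) = x l := by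
      intro x
      simp only [hLi, mul_div_cancel₀ _ hδ']
      exact sum_leftInverse hQ x l
    rw [← h0 x, ← h0 y, hxy]
  let s : (Fin m → ℝ) →ₗ[ℝ] ℝ := ∑ i, LinearMap.proj i
  have hs : ∀ y, s y = ∑ i, y i := fun y => by simp [s]
  have hle : Submodule.map L (Submodule.span ℝ S) ≤ W ⊓ LinearMap.ker s := by
    rw [Submodule.map_span_le]
    intro x hx
    refine ⟨?_, ?_⟩
    · have h1 : L x = affinePoint m w P δ x - fun i : Fin m => (w i : ℝ) / δ := by
        funext i
        rw [hLi, Pi.sub_apply, affinePoint]; ring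
      rw [h1]
      exact W.sub_mem (Submodule.subset_span (hST x hx)) hw0
    · rw [SetLike.mem_coe, LinearMap.mem_ker, hs]
      simp only [hLi, ← Finset.sum_div]
      rw [Finset.sum_comm]
      have : ∀ j : Fin k, ∑ i : Fin m, (P i j : ℝ) * x j = 0 := by
        intro j
        rw [← Finset.sum_mul]
        have := hP j
        have h' : (∑ i : Fin m, (P i j : ℝ)) = 0 := by exact_mod_cast this
        rw [h', zero_mul]
      simp [this]
  have hlt : W ⊓ LinearMap.ker s < W := by
    refine lt_of_le_of_ne inf_le_left fun h => ?_
    have h1 : (fun i : Fin m => (w i : ℝ) / δ) ∈ W ⊓ LinearMap.ker s := by rw [h]; exact hw0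
    have h2 := LinearMap.mem_ker.1 h1.2
    rw [hs, ← Finset.sum_div, div_eq_zero_iff, or_iff_left hδ'] at h2
    exact hw (by exact_mod_cast h2)
  have h1 := Submodule.finrank_lt_finrank_of_lt hlt
  have h2 := Submodule.finrank_mono hle
  have h3 : Module.finrank ℝ (Submodule.map L (Submodule.span ℝ S)) =
      Module.finrank ℝ (Submodule.span ℝ S) :=
    (Submodule.equivMapOfInjective L hLinj _).finrank_eq.symm
  unfold linearDim
  rw [← hW]
  omega

end DistMC

/-! ### Eigenvalues and the dynamical dimension -/

section Spectrum

open Matrix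

variable {m : ℕ}

theorem exists_eigenvector_of_isRoot_charpoly {n : Type*} [Fintype n] [DecidableEq n]
    {A : Matrix n n ℂ} {z : ℂ} (h : A.charpoly.IsRoot z) : ∃ v ≠ 0, A *ᵥ v = z • v := by
  rw [Polynomial.IsRoot, Matrix.eval_charpoly, ← Matrix.exists_mulVec_eq_zero_iff] at h
  obtain ⟨v, hv, h0⟩ := h
  refine ⟨v, hv, ?_⟩
  rw [Matrix.sub_mulVec, sub_eq_zero, Matrix.scalar_apply, ← Matrix.smul_one_eq_diagonal,
    Matrix.smul_mulVec, Matrix.one_mulVec] at h0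
  exact h0.symm

theorem pow_mulVec_eq_smul {n : Type*} [Fintype n] [DecidableEq n]
    {A : Matrix n n ℂ} {z : ℂ} {v : n → ℂ} (h : A *ᵥ v = z • v) (p : ℕ) :
    (A ^ p) *ᵥ v = z ^ p • v := by
  induction p with
  | zero => simp
  | succ p ih =>
    rw [pow_succ, ← Matrix.mulVec_mulVec, h, Matrix.mulVec_smul, ih, smul_smul, pow_succ']

theorem exists_max_norm {n : Type*} [Fintype n] {v : n → ℂ} (hv : v ≠ 0) :
    ∃ i, 0 < ‖v i‖ ∧ ∀ j, ‖v j‖ ≤ ‖v i‖ := by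
  obtain ⟨i₀, hi₀⟩ := Function.ne_iff.1 hv
  obtain ⟨i, -, hi⟩ := Finset.exists_max_image Finset.univ (fun i => ‖v i‖) ⟨i₀, Finset.mem_univ _⟩
  exact ⟨i, (norm_pos_iff.2 hi₀).trans_le (hi i₀ (Finset.mem_univ _)), fun j => hi j (Finset.mem_univ _)⟩

/-- A matrix with a power of row sum norm less than `1` has only eigenvalues of modulus less
than `1`. -/
theorem norm_lt_one_of_isRoot_charpoly {k p : ℕ} {A : Matrix (Fin k) (Fin k) ℚ}
    (hA : ∀ i, ∑ j, |(A ^ p) i j| < 1) {z : ℂ}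
    (hz : (A.map (Rat.castHom ℂ)).charpoly.IsRoot z) : ‖z‖ < 1 := by
  obtain ⟨v, hv, h⟩ := exists_eigenvector_of_isRoot_charpoly hz
  obtain ⟨i, hi, hmax⟩ := exists_max_norm hv
  have hp := congrFun (pow_mulVec_eq_smul h p) i
  rw [Pi.smul_apply, smul_eq_mul, ← Matrix.map_pow] at hp
  have h1 : ‖z‖ ^ p * ‖v i‖ < ‖v i‖ := by
    rw [← norm_pow, ← norm_mul, ← hp]
    calc ‖∑ j, ((A ^ p).map (Rat.castHom ℂ)) i j * v j‖
        ≤ ∑ j, ‖((A ^ p).map (Rat.castHom ℂ)) i j * v j‖ := norm_sum_le _ _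
      _ ≤ ∑ j, ((|(A ^ p) i j| : ℚ) : ℝ) * ‖v i‖ := by
          refine Finset.sum_le_sum fun j _ => ?_
          rw [norm_mul, Matrix.map_apply, Rat.coe_castHom]
          have : ‖(((A ^ p) i j : ℚ) : ℂ)‖ = ((|(A ^ p) i j| : ℚ) : ℝ) := by
            rw [Complex.norm_ratCast]; push_cast; rfl
          rw [this]
          exact mul_le_mul_of_nonneg_left (hmax j) (by positivity)
      _ = ((∑ j, |(A ^ p) i j| : ℚ) : ℝ) * ‖v i‖ := by rw [← Finset.sum_mul]; push_cast; rfl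
      _ < 1 * ‖v i‖ := by
          refine mul_lt_mul_of_pos_right ?_ hi
          exact_mod_cast hA i
      _ = ‖v i‖ := one_mul _
  by_contra hge
  have := one_le_pow₀ (not_lt.1 hge) (n := p)
  nlinarith

theorem charpoly_eq_mul_of_decomposition {k l : ℕ} (hkl : k + l = m)
    {M : Matrix (Fin m) (Fin m) ℚ} {S : Matrix (Fin m) (Fin k ⊕ Fin l) ℚ}
    {T : Matrix (Fin k ⊕ Fin l) (Fin m) ℚ} {A : Matrix (Fin k) (Fin k) ℚ}
    {B : Matrix (Fin l) (Fin l) ℚ} (hTS : T * S = 1) (hM : M * S = S * fromBlocks A 0 0 B) :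
    M.charpoly = A.charpoly * B.charpoly := by
  have hcard : Fintype.card (Fin k ⊕ Fin l) = Fintype.card (Fin m) := by simp [hkl]
  have hST : S * T = 1 := (Matrix.mul_eq_one_comm_of_card_eq _ _ _ hcard).1 hTS
  have h1 : M = S * (fromBlocks A 0 0 B * T) := by
    rw [← Matrix.mul_assoc, ← hM, Matrix.mul_assoc, hST, Matrix.mul_one]
  have h2 := Matrix.charpoly_mul_comm' S (fromBlocks A 0 0 B * T)
  rw [← h1, Matrix.mul_assoc, hTS, Matrix.mul_one, hcard,
    (Polynomial.isRegular_X_pow _).left.eq_iff, Matrix.charpoly_fromBlocks_zero₁₂] at h2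
  exact h2

/-- If a matrix is the direct sum of an invertible matrix `A` with a contracting power and of a matrix
`B` with eventually periodic powers, then its dynamical dimension is the size of `A`: the eigenvalues
of `B` are zero or roots of unity. -/
theorem DistMC.dynamicalDim_eq {k l p s L : ℕ} (hkl : k + l = m)
    {M : Matrix (Fin m) (Fin m) ℚ} {S : Matrix (Fin m) (Fin k ⊕ Fin l) ℚ}
    {T : Matrix (Fin k ⊕ Fin l) (Fin m) ℚ} {A A' : Matrix (Fin k) (Fin k) ℚ}
    {B : Matrix (Fin l) (Fin l) ℚ} (hTS : T * S = 1) (hM : M * S = S * fromBlocks A 0 0 B)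
    (hA : A' * A = 1) (hAp : ∀ i, ∑ j, |(A ^ p) i j| < 1) (hL : 1 ≤ L) (hB : B ^ (s + L) = B ^ s) :
    DistMC.dynamicalDim M = k := by
  have hmap : (M.map (fun q : ℚ => (q : ℂ))).charpoly =
      (A.map (Rat.castHom ℂ)).charpoly * (B.map (Rat.castHom ℂ)).charpoly := by
    have : M.map (fun q : ℚ => (q : ℂ)) = M.map (Rat.castHom ℂ) := rfl
    rw [this, Matrix.charpoly_map, Matrix.charpoly_map, Matrix.charpoly_map,
      charpoly_eq_mul_of_decomposition hkl hTS hM, Polynomial.map_mul]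
  have hA0 : (A.map (Rat.castHom ℂ)).charpoly ≠ 0 := (Matrix.charpoly_monic _).ne_zero
  have hB0 : (B.map (Rat.castHom ℂ)).charpoly ≠ 0 := (Matrix.charpoly_monic _).ne_zero
  unfold DistMC.dynamicalDim
  rw [hmap, Polynomial.roots_mul (mul_ne_zero hA0 hB0), Multiset.countP_add]
  have h1 : ∀ z ∈ (A.map (Rat.castHom ℂ)).charpoly.roots, z ≠ 0 ∧ ‖z‖ < 1 := by
    intro z hz
    rw [Polynomial.mem_roots hA0] at hz
    refine ⟨?_, norm_lt_one_of_isRoot_charpoly hAp hz⟩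
    rintro rfl
    obtain ⟨v, hv, h⟩ := exists_eigenvector_of_isRoot_charpoly hz
    have h2 : (A'.map (Rat.castHom ℂ)) * (A.map (Rat.castHom ℂ)) = 1 := by
      rw [← Matrix.map_mul, hA, Matrix.map_one _ (map_zero _) (map_one _)]
    apply hv
    rw [← Matrix.one_mulVec v, ← h2, ← Matrix.mulVec_mulVec, h, zero_smul, Matrix.mulVec_zero]
  have h2 : ∀ z ∈ (B.map (Rat.castHom ℂ)).charpoly.roots, ¬ (z ≠ 0 ∧ ‖z‖ < 1) := by
    rintro z hz ⟨hz0, hz1⟩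
    rw [Polynomial.mem_roots hB0] at hz
    obtain ⟨v, hv, h⟩ := exists_eigenvector_of_isRoot_charpoly hz
    have h3 := pow_mulVec_eq_smul h (s + L)
    rw [← Matrix.map_pow, hB, Matrix.map_pow, pow_mulVec_eq_smul h s] at h3
    have h4 : z ^ s = z ^ (s + L) := smul_left_injective ℂ hv h3
    rw [pow_add, left_eq_mul₀ (pow_ne_zero _ hz0)] at h4
    have h5 : ‖z‖ ^ L = 1 := by rw [← norm_pow, h4, norm_one]
    have h6 := pow_lt_one₀ (norm_nonneg z) hz1 (n := L) (by omega)
    linarith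
  rw [Multiset.countP_eq_card.2 h1, Multiset.countP_eq_zero.2 h2, add_zero,
    IsAlgClosed.card_roots_eq_natDegree, Matrix.charpoly_natDegree_eq_dim, Fintype.card_fin]

end Spectrum

/-! ### Stochastic matrices -/

section Stochastic

open Matrix

variable {m : ℕ} {M : Matrix (Fin m) (Fin m) ℚ}

theorem colStochastic_sum (hM : M ∈ colStochastic ℚ (Fin m)) (j : Fin m) : ∑ i, M i j = 1 := by
  have := congrFun hM.2 j
  simpa [vecMul, dotProduct] using this

theorem sum_mulVec_of_colStochastic (hM : M ∈ colStochastic ℚ (Fin m)) (x : Fin m → ℚ) :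
    ∑ i, (M *ᵥ x) i = ∑ i, x i := by
  simp only [mulVec, dotProduct]
  rw [Finset.sum_comm]
  refine Finset.sum_congr rfl fun j _ => ?_
  rw [← Finset.sum_mul, colStochastic_sum hM, one_mul]

theorem abs_mulVec_le_of_colStochastic (hM : M ∈ colStochastic ℚ (Fin m)) (x : Fin m → ℚ)
    (i : Fin m) : |(M *ᵥ x) i| ≤ ∑ j, |x j| := by
  refine (Finset.abs_sum_le_sum_abs _ _).trans (Finset.sum_le_sum fun j _ => ?_)
  rw [abs_mul, abs_of_nonneg (hM.1 i j)]
  refine mul_le_of_le_one_left (abs_nonneg _) ?_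
  rw [← colStochastic_sum hM j]
  exact Finset.single_le_sum (f := fun i => M i j) (fun i _ => hM.1 i j) (Finset.mem_univ i)

/-- The eigenvalues of modulus `1` of a stochastic matrix are roots of unity: for a left
eigenvector `x`, every coordinate of `z • x` is a weighted mean of coordinates of `x`, so that the set
of coordinates of maximal modulus is stable under multiplication with `z`. -/
theorem eigenvalue_of_colStochastic (hM : M ∈ colStochastic ℚ (Fin m)) {z : ℂ} {v : Fin m → ℂ}
    (hv : v ≠ 0) (h : (M.map (Rat.castHom ℂ)) *ᵥ v = z • v) :
    ‖z‖ ≤ 1 ∧ (‖z‖ = 1 → z ^ m.factorial = 1) := by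
  have hdet : (Matrix.scalar (Fin m) z - M.map (Rat.castHom ℂ)).det = 0 := by
    rw [← Matrix.exists_mulVec_eq_zero_iff]
    refine ⟨v, hv, ?_⟩
    rw [Matrix.sub_mulVec, h, Matrix.scalar_apply, ← Matrix.smul_one_eq_diagonal,
      Matrix.smul_mulVec, Matrix.one_mulVec, sub_self]
  rw [← Matrix.exists_vecMul_eq_zero_iff] at hdet
  obtain ⟨x, hx, hx0⟩ := hdet
  have hxj : ∀ j, z * x j = ∑ i, ((M i j : ℚ) : ℂ) * x i := by
    intro j
    rw [Matrix.vecMul_sub, sub_eq_zero, Matrix.scalar_apply, ← Matrix.smul_one_eq_diagonal,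
      Matrix.vecMul_smul, Matrix.vecMul_one] at hx0
    have := congrFun hx0 j
    rw [Pi.smul_apply, smul_eq_mul] at this
    rw [this, vecMul, dotProduct]
    exact Finset.sum_congr rfl fun i _ => mul_comm (x i) _
  obtain ⟨j₀, hj₀, hmax⟩ := exists_max_norm hx
  have hsum : ∀ j, ∑ i, ((M i j : ℚ) : ℝ) = 1 := fun j => by exact_mod_cast colStochastic_sum hM j
  have hnn : ∀ i j, (0 : ℝ) ≤ ((M i j : ℚ) : ℝ) := fun i j => by exact_mod_cast hM.1 i j
  have hle : ‖z‖ ≤ 1 := by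
    have h1 : ‖z‖ * ‖x j₀‖ ≤ ‖x j₀‖ := by
      rw [← norm_mul, hxj]
      calc _ ≤ ∑ i, ‖((M i j₀ : ℚ) : ℂ) * x i‖ := norm_sum_le _ _
        _ ≤ ∑ i, ((M i j₀ : ℚ) : ℝ) * ‖x j₀‖ := by
            refine Finset.sum_le_sum fun i _ => ?_
            rw [norm_mul, Complex.norm_ratCast, abs_of_nonneg (hnn i j₀)]
            exact mul_le_mul_of_nonneg_left (hmax i) (hnn i j₀)
        _ = ‖x j₀‖ := by rw [← Finset.sum_mul, hsum, one_mul]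
    nlinarith
  refine ⟨hle, fun hz => ?_⟩
  have hz0 : z ≠ 0 := norm_pos_iff.1 (by rw [hz]; exact one_pos)
  have hstep : ∀ j, ‖x j‖ = ‖x j₀‖ → ∃ i, x i = z * x j := by
    intro j hj
    have hxj0 : x j ≠ 0 := norm_pos_iff.1 (hj ▸ hj₀)
    have hzx : z * x j ≠ 0 := mul_ne_zero hz0 hxj0
    set c : Fin m → ℂ := fun i => x i / (z * x j) with hc
    have hcn : ∀ i, ‖c i‖ ≤ 1 := fun i => by
      rw [hc]; dsimp only
      rw [norm_div, norm_mul, hz, one_mul, hj]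
      exact div_le_one_of_le₀ (hmax i) hj₀.le
    have hcsum : ∑ i, ((M i j : ℚ) : ℂ) * c i = 1 := by
      simp only [hc, ← mul_div_assoc]
      rw [← Finset.sum_div, ← hxj, div_self hzx]
    -- A mean of numbers of the unit disc is `1` only if all numbers with positive weight are `1`.
    have hre : ∑ i, ((M i j : ℚ) : ℝ) * (1 - (c i).re) = 0 := by
      have := congrArg Complex.re hcsum
      rw [Complex.re_sum] at this
      have h2 : ∀ i, (((M i j : ℚ) : ℂ) * c i).re = ((M i j : ℚ) : ℝ) * (c i).re := by
        intro i
        have : ((M i j : ℚ) : ℂ) = (((M i j : ℚ) : ℝ) : ℂ) := by push_cast; rfl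
        rw [this, Complex.re_ofReal_mul]
      simp only [h2, Complex.one_re] at this
      simp only [mul_sub, mul_one, Finset.sum_sub_distrib, hsum, this, sub_self]
    have hre1 : ∀ i, (c i).re ≤ 1 := fun i => (Complex.re_le_norm _).trans (hcn i)
    rw [Finset.sum_eq_zero_iff_of_nonneg fun i _ => mul_nonneg (hnn i j) (by linarith [hre1 i])] at hre
    obtain ⟨i, hi⟩ : ∃ i, ((M i j : ℚ) : ℝ) ≠ 0 := by
      by_contra! hall
      have := hsum j
      simp [hall] at this
    refine ⟨i, ?_⟩
    have h3 : (c i).re = 1 := by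
      have := (mul_eq_zero.1 (hre i (Finset.mem_univ i))).resolve_left hi
      linarith
    have h4 : c i = 1 := by
      have h5 := Complex.sq_norm (c i)
      rw [Complex.normSq_apply, h3] at h5
      have h6 : ‖c i‖ ^ 2 ≤ 1 := pow_le_one₀ (norm_nonneg _) (hcn i)
      have h7 : (c i).im = 0 := by nlinarith [mul_self_nonneg (c i).im]
      exact Complex.ext h3 h7
    rwa [hc, div_eq_one_iff_eq hzx] at h4
  have hiter : ∀ t : ℕ, ∃ i, x i = z ^ t * x j₀ := by
    intro t
    induction t with
    | zero => exact ⟨j₀, by simp⟩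
    | succ t ih =>
      obtain ⟨i, hi⟩ := ih
      obtain ⟨i', hi'⟩ := hstep i (by rw [hi, norm_mul, norm_pow, hz, one_pow, one_mul])
      exact ⟨i', by rw [hi', hi]; ring⟩
  choose f hf using hiter
  obtain ⟨s, t, hst, hfst⟩ := Fintype.exists_ne_map_eq_of_card_lt
    (fun t : Fin (m + 1) => f t) (by simp)
  have hxj₀ : x j₀ ≠ 0 := norm_pos_iff.1 hj₀
  have key : ∀ s t : Fin (m + 1), s < t → f s = f t → z ^ m.factorial = 1 := by
    intro s t hlt he
    have h1 : z ^ (s : ℕ) = z ^ (t : ℕ) := by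
      have := (hf s).symm.trans ((congrArg x he).trans (hf t))
      exact mul_right_cancel₀ hxj₀ this
    have hlt' : (s : ℕ) < t := hlt
    obtain ⟨d, hd⟩ := Nat.exists_eq_add_of_lt hlt'
    have h2 : z ^ (d + 1) = 1 := by
      rw [hd, add_assoc, pow_add] at h1
      exact ((left_eq_mul₀ (pow_ne_zero _ hz0)).1 h1)
    have h3 : d + 1 ∣ m.factorial := Nat.dvd_factorial (by omega) (by have := t.2; omega)
    obtain ⟨e, he⟩ := h3
    rw [he, pow_mul, h2, one_pow]
  rcases lt_or_gt_of_ne hst with hlt | hlt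
  · exact key s t hlt hfst
  · exact key t s hlt hfst.symm

end Stochastic

/-! ### Decomposition of stochastic matrices -/

section PowersTendTo

open Matrix

/-- A rational matrix all of whose complex eigenvalues have modulus less than `1` has powers
tending to zero. -/
theorem eventually_pow_lt {k : ℕ} {A : Matrix (Fin k) (Fin k) ℚ}
    (hA : ∀ z : ℂ, ∀ v : Fin k → ℂ, v ≠ 0 → (A.map (Rat.castHom ℂ)) *ᵥ v = z • v → ‖z‖ < 1)
    {ε : ℚ} (hε : 0 < ε) : ∃ N, ∀ n ≥ N, ∀ i j, |(A ^ n) i j| < ε := by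
  rcases Nat.eq_zero_or_pos k with rfl | hk
  · exact ⟨0, fun n _ i => i.elim0⟩
  have : Nonempty (Fin k) := ⟨⟨0, hk⟩⟩
  let _ := Matrix.linftyOpNormedRing (n := Fin k) (α := ℂ)
  let _ := Matrix.linftyOpNormedAlgebra (n := Fin k) (R := ℂ) (α := ℂ)
  set a : Matrix (Fin k) (Fin k) ℂ := A.map (Rat.castHom ℂ) with ha
  have hlt : spectralRadius ℂ a < 1 := by
    have := spectrum.spectralRadius_lt_of_forall_lt_of_nonempty (𝕜 := ℂ) (a := a) (r := 1)
      (spectrum.nonempty a) ?_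
    · simpa using this
    intro z hz
    obtain ⟨v, hv, h⟩ : ∃ v ≠ 0, a *ᵥ v = z • v := by
      apply exists_eigenvector_of_isRoot_charpoly
      rw [Polynomial.IsRoot, Matrix.eval_charpoly]
      rw [spectrum.mem_iff, Matrix.isUnit_iff_isUnit_det, isUnit_iff_ne_zero, not_not] at hz
      exact hz
    have := hA z v hv h
    exact_mod_cast this
  obtain ⟨r, hr, hr1⟩ := ENNReal.lt_iff_exists_nnreal_btwn.1 hlt
  have hr1' : r < 1 := by exact_mod_cast hr1
  have hev := (spectrum.pow_nnnorm_pow_one_div_tendsto_nhds_spectralRadius a).eventually_lt_const hr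
  have h0 : Filter.Tendsto (fun n : ℕ => (r : ℝ) ^ n) Filter.atTop (nhds 0) :=
    tendsto_pow_atTop_nhds_zero_of_lt_one r.2 hr1'
  have hev2 := h0.eventually_lt_const (u := (ε : ℝ)) (by exact_mod_cast hε)
  obtain ⟨N, hN⟩ := Filter.eventually_atTop.1 (hev.and (hev2.and (Filter.eventually_ge_atTop 1)))
  refine ⟨N, fun n hn i j => ?_⟩
  obtain ⟨h1, h2, h3⟩ := hN n hn
  have hn0 : (n : ℝ) ≠ 0 := by positivity
  have h4 : (‖a ^ n‖₊ : ENNReal) ≤ (r : ENNReal) ^ n := by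
    have := ENNReal.rpow_le_rpow h1.le (Nat.cast_nonneg n : (0 : ℝ) ≤ n)
    rwa [← ENNReal.rpow_mul, one_div_mul_cancel hn0, ENNReal.rpow_one, ENNReal.rpow_natCast] at this
  have h5 : ‖a ^ n‖ ≤ (r : ℝ) ^ n := by
    have : ‖a ^ n‖₊ ≤ r ^ n := by exact_mod_cast h4
    exact_mod_cast this
  have h6 : ‖(a ^ n) i j‖ ≤ ‖a ^ n‖ := by
    rw [Matrix.linfty_opNorm_def]
    have h7 : ∑ j, ‖(a ^ n) i j‖₊ ≤ Finset.univ.sup fun i => ∑ j, ‖(a ^ n) i j‖₊ :=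
      Finset.le_sup (f := fun i => ∑ j, ‖(a ^ n) i j‖₊) (Finset.mem_univ i)
    have h8 : ‖(a ^ n) i j‖₊ ≤ ∑ j, ‖(a ^ n) i j‖₊ :=
      Finset.single_le_sum (f := fun j => ‖(a ^ n) i j‖₊) (fun _ _ => zero_le) (Finset.mem_univ j)
    exact_mod_cast h8.trans h7
  have h9 : ‖(a ^ n) i j‖ = ((|(A ^ n) i j| : ℚ) : ℝ) := by
    rw [ha, ← Matrix.map_pow, Matrix.map_apply, Rat.coe_castHom, Complex.norm_ratCast]
    push_cast; rfl
  rw [h9] at h6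
  have := (h6.trans h5).trans_lt h2
  exact_mod_cast this

end PowersTendTo

section Decomposition

open Matrix

variable {m : ℕ} {M : Matrix (Fin m) (Fin m) ℚ}

/-- Since the powers of a stochastic matrix are bounded, its powers have no nontrivial Jordan
block at the eigenvalue `1`. -/
theorem pow_mulVec_eq_of_colStochastic {U : Matrix (Fin m) (Fin m) ℚ}
    (hU : U ∈ colStochastic ℚ (Fin m)) {x : Fin m → ℚ} {n : ℕ} (h : ((U - 1) ^ n) *ᵥ x = 0) :
    U *ᵥ x = x := by
  have key : ∀ y : Fin m → ℚ, (U - 1) *ᵥ ((U - 1) *ᵥ y) = 0 → (U - 1) *ᵥ y = 0 := by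
    intro y hy
    set d := (U - 1) *ᵥ y with hd
    have hUd : U *ᵥ d = d := by rwa [Matrix.sub_mulVec, Matrix.one_mulVec, sub_eq_zero] at hy
    have hUy : U *ᵥ y = y + d := by rw [hd, Matrix.sub_mulVec, Matrix.one_mulVec]; abel
    have hpow : ∀ t : ℕ, (U ^ t) *ᵥ y = y + (t : ℚ) • d := by
      intro t
      induction t with
      | zero => simp
      | succ t ih =>
        rw [pow_succ', ← Matrix.mulVec_mulVec, ih, Matrix.mulVec_add, Matrix.mulVec_smul, hUd, hUy]
        push_cast
        rw [add_smul, one_smul]; abel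
    -- A nonzero `d` would make `U ^ t *ᵥ y = y + t • d` unbounded.
    funext i
    by_contra hi
    have hb : ∀ t : ℕ, (t : ℚ) * |d i| ≤ ∑ j, |y j| + |y i| := by
      intro t
      have h1 := abs_mulVec_le_of_colStochastic (pow_mem hU t) y i
      rw [hpow t, Pi.add_apply, Pi.smul_apply, smul_eq_mul] at h1
      have h2 : (t : ℚ) * |d i| = |(t : ℚ) * d i| := by rw [abs_mul, Nat.abs_cast]
      rw [h2]
      calc |(t : ℚ) * d i| = |(y i + t * d i) - y i| := by ring_nf
        _ ≤ |y i + t * d i| + |y i| := abs_sub _ _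
        _ ≤ _ := by linarith
    have hpos : 0 < |d i| := abs_pos.2 hi
    obtain ⟨t, ht⟩ := exists_nat_gt ((∑ j, |y j| + |y i|) / |d i|)
    rw [div_lt_iff₀ hpos] at ht
    exact absurd (hb t) (not_le.2 ht)
  have main : (U - 1) *ᵥ x = 0 := by
    induction n generalizing x with
    | zero => rw [pow_zero, Matrix.one_mulVec] at h; rw [h, Matrix.mulVec_zero]
    | succ n ih =>
      rw [pow_succ, ← Matrix.mulVec_mulVec] at h
      exact key x (ih h)
  rwa [Matrix.sub_mulVec, Matrix.one_mulVec, sub_eq_zero] at main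

/-- The Fitting decomposition of a stochastic matrix `M` with respect to `M (M ^ L - 1)`, where
`L` kills all eigenvalues that are roots of unity: on one summand `M` is invertible and
contracting, on the other it is eventually periodic. The columns of the basis of the first summand
have sum `0`, as those of `M ^ L - 1` have. -/
theorem exists_decomposition_of_colStochastic (hM : M ∈ colStochastic ℚ (Fin m)) :
    ∃ (k l : ℕ) (_ : k + l = m) (S : Matrix (Fin m) (Fin k ⊕ Fin l) ℚ)
      (T : Matrix (Fin k ⊕ Fin l) (Fin m) ℚ) (A A' : Matrix (Fin k) (Fin k) ℚ)
      (B : Matrix (Fin l) (Fin l) ℚ) (s L : ℕ),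
      T * S = 1 ∧ M * S = S * fromBlocks A 0 0 B ∧ A' * A = 1 ∧
      (∀ j, ∑ i, S i (Sum.inl j) = 0) ∧ 1 ≤ L ∧ B ^ (s + L) = B ^ s ∧
      ∀ ε > 0, ∃ N, ∀ n ≥ N, ∀ i j, |(A ^ n) i j| < ε := by
  set L := m.factorial with hL
  have hL1 : 1 ≤ L := m.factorial_pos
  set Φ : Matrix (Fin m) (Fin m) ℚ := M * (M ^ L - 1) with hΦ
  have hcomm : Commute M (M ^ L - 1) := ((Commute.refl M).pow_right L).sub_right (Commute.one_right M)
  have hMΦ : Commute M Φ := (Commute.refl M).mul_right hcomm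
  obtain ⟨n, hn, hcompl⟩ := ((Filter.eventually_ge_atTop 1).and
    (LinearMap.eventually_isCompl_ker_pow_range_pow (Matrix.toLin' Φ))).exists
  rw [← Matrix.toLin'_pow] at hcompl
  set K := LinearMap.ker (Matrix.toLin' (Φ ^ n)) with hK
  set W := LinearMap.range (Matrix.toLin' (Φ ^ n)) with hW
  have hMW : ∀ x ∈ W, M *ᵥ x ∈ W := by
    rintro _ ⟨y, rfl⟩
    refine ⟨M *ᵥ y, ?_⟩
    rw [Matrix.toLin'_apply, Matrix.toLin'_apply, Matrix.mulVec_mulVec, Matrix.mulVec_mulVec,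
      (hMΦ.pow_right n).eq]
  have hMK : ∀ x ∈ K, M *ᵥ x ∈ K := by
    intro x hx
    rw [hK, LinearMap.mem_ker, Matrix.toLin'_apply] at hx ⊢
    rw [Matrix.mulVec_mulVec, ← (hMΦ.pow_right n).eq, ← Matrix.mulVec_mulVec, hx, Matrix.mulVec_zero]
  have hWsum : ∀ x ∈ W, ∑ i, x i = 0 := by
    rintro _ ⟨y, rfl⟩
    obtain ⟨n', rfl⟩ : ∃ n', n = n' + 1 := ⟨n - 1, by omega⟩
    rw [Matrix.toLin'_apply, pow_succ', ← Matrix.mulVec_mulVec, hΦ, ← Matrix.mulVec_mulVec,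
      sum_mulVec_of_colStochastic hM, Matrix.sub_mulVec, Matrix.one_mulVec]
    simp only [Pi.sub_apply, Finset.sum_sub_distrib]
    rw [sum_mulVec_of_colStochastic (pow_mem hM L), sub_self]
  have hWinj : ∀ x ∈ W, Φ *ᵥ x = 0 → x = 0 := by
    intro x hx h0
    have hxK : x ∈ K := by
      obtain ⟨n', rfl⟩ : ∃ n', n = n' + 1 := ⟨n - 1, by omega⟩
      rw [hK, LinearMap.mem_ker, Matrix.toLin'_apply, pow_succ, ← Matrix.mulVec_mulVec, h0,
        Matrix.mulVec_zero]
    exact (Submodule.disjoint_def.1 hcompl.disjoint) x hxK hx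
  have hKper : ∀ x ∈ K, (M ^ (n + L)) *ᵥ x = (M ^ n) *ᵥ x := by
    intro x hx
    rw [hK, LinearMap.mem_ker, Matrix.toLin'_apply, hΦ, hcomm.mul_pow,
      (hcomm.pow_pow n n).eq, ← Matrix.mulVec_mulVec] at hx
    have := pow_mulVec_eq_of_colStochastic (pow_mem hM L) hx
    rwa [Matrix.mulVec_mulVec, ← pow_add, add_comm L n] at this
  let bW := Module.finBasis ℚ W
  let bK := Module.finBasis ℚ K
  let b := (bW.prod bK).map (Submodule.prodEquivOfIsCompl W K hcompl.symm)
  have hb1 : ∀ j, b (Sum.inl j) = bW j := fun j => by simp [b]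
  have hb2 : ∀ j, b (Sum.inr j) = bK j := fun j => by simp [b]
  have hr1 : ∀ x ∈ W, ∀ i, b.repr x (Sum.inr i) = 0 := by
    intro x hx i
    have : (Submodule.prodEquivOfIsCompl W K hcompl.symm).symm x = (⟨x, hx⟩, 0) :=
      Submodule.prodEquivOfIsCompl_symm_apply_left _ _ hcompl.symm ⟨x, hx⟩
    simp [b, this]
  have hr2 : ∀ x ∈ K, ∀ i, b.repr x (Sum.inl i) = 0 := by
    intro x hx i
    have : (Submodule.prodEquivOfIsCompl W K hcompl.symm).symm x = (0, ⟨x, hx⟩) :=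
      Submodule.prodEquivOfIsCompl_symm_apply_right _ _ hcompl.symm ⟨x, hx⟩
    simp [b, this]
  let e := Pi.basisFun ℚ (Fin m)
  set S : Matrix (Fin m) _ ℚ := e.toMatrix b with hS
  set T : Matrix _ (Fin m) ℚ := b.toMatrix e with hT
  have hTS : T * S = 1 := Module.Basis.toMatrix_mul_toMatrix_flip b e
  have hST : S * T = 1 := Module.Basis.toMatrix_mul_toMatrix_flip e b
  set D := LinearMap.toMatrix b b (Matrix.toLin' M) with hD
  have hDij : ∀ i j, D i j = b.repr (M *ᵥ b j) i := fun i j => by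
    rw [hD, LinearMap.toMatrix_apply, Matrix.toLin'_apply]
  have hMS : M * S = S * D := by
    rw [hS, hD, basis_toMatrix_mul_linearMap_toMatrix, mul_basis_toMatrix _ _ e]
    rfl
  set A := D.toBlocks₁₁ with hA
  set B := D.toBlocks₂₂ with hB
  have hDb : D = fromBlocks A 0 0 B := by
    rw [← Matrix.fromBlocks_toBlocks D]
    congr 1
    · ext i j
      rw [Matrix.toBlocks₁₂, Matrix.of_apply, hDij, hb2]
      exact hr2 _ (hMK _ (bK j).2) i
    · ext i j
      rw [Matrix.toBlocks₂₁, Matrix.of_apply, hDij, hb1]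
      exact hr1 _ (hMW _ (bW j).2) i
  have hSc : ∀ j i, S i j = b j i := fun j i => by
    rw [hS, Module.Basis.toMatrix_apply, Pi.basisFun_repr]
  have hpow : ∀ p, M ^ p * S = S * fromBlocks (A ^ p) 0 0 (B ^ p) := by
    intro p
    induction p with
    | zero => simp
    | succ p ih =>
      rw [pow_succ, Matrix.mul_assoc, hMS, hDb, ← Matrix.mul_assoc, ih, Matrix.mul_assoc,
        Matrix.fromBlocks_multiply]
      simp [pow_succ]
  have hSinj : ∀ x, S *ᵥ x = 0 → x = 0 := by
    intro x hx
    rw [← Matrix.one_mulVec x, ← hTS, ← Matrix.mulVec_mulVec, hx, Matrix.mulVec_zero]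
  have hSW : ∀ w, S *ᵥ (Sum.elim w 0) ∈ W := by
    intro w
    have : S *ᵥ (Sum.elim w 0) = ∑ j, w j • (bW j : Fin m → ℚ) := by
      funext i
      simp only [mulVec, dotProduct, Fintype.sum_sum_type, Sum.elim_inl, Sum.elim_inr, Pi.zero_apply,
        mul_zero, Finset.sum_const_zero, add_zero, Finset.sum_apply, Pi.smul_apply, smul_eq_mul, hSc,
        hb1]
      exact Finset.sum_congr rfl fun j _ => mul_comm _ _
    rw [this]
    exact W.sum_mem fun j _ => W.smul_mem _ (bW j).2
  have hSA : ∀ p w, (M ^ p) *ᵥ (S *ᵥ (Sum.elim w 0)) = S *ᵥ (Sum.elim ((A ^ p) *ᵥ w) 0) := by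
    intro p w
    rw [Matrix.mulVec_mulVec, hpow, ← Matrix.mulVec_mulVec, Matrix.fromBlocks_mulVec]
    simp
  have hSK : ∀ w, S *ᵥ (Sum.elim 0 w) ∈ K := by
    intro w
    have : S *ᵥ (Sum.elim 0 w) = ∑ j, w j • (bK j : Fin m → ℚ) := by
      funext i
      simp only [mulVec, dotProduct, Fintype.sum_sum_type, Sum.elim_inl, Sum.elim_inr, Pi.zero_apply,
        mul_zero, Finset.sum_const_zero, zero_add, Finset.sum_apply, Pi.smul_apply, smul_eq_mul, hSc,
        hb2]
      exact Finset.sum_congr rfl fun j _ => mul_comm _ _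
    rw [this]
    exact K.sum_mem fun j _ => K.smul_mem _ (bK j).2
  have hSB : ∀ p w, (M ^ p) *ᵥ (S *ᵥ (Sum.elim 0 w)) = S *ᵥ (Sum.elim 0 ((B ^ p) *ᵥ w)) := by
    intro p w
    rw [Matrix.mulVec_mulVec, hpow, ← Matrix.mulVec_mulVec, Matrix.fromBlocks_mulVec]
    simp
  have hΦw : ∀ w, A *ᵥ w = 0 ∨ (A ^ L) *ᵥ w = w → w = 0 := by
    intro w hw
    have h0 : Φ *ᵥ (S *ᵥ (Sum.elim w 0)) = 0 := by
      rcases hw with hw | hw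
      · rw [hΦ, hcomm.eq, ← Matrix.mulVec_mulVec]
        have := hSA 1 w
        rw [pow_one, pow_one, hw] at this
        rw [this]
        simp
      · rw [hΦ, ← Matrix.mulVec_mulVec, Matrix.sub_mulVec, hSA, hw, Matrix.one_mulVec, sub_self,
          Matrix.mulVec_zero]
    have := hSinj _ (hWinj _ (hSW w) h0)
    funext i
    exact congrFun this (Sum.inl i)
  have hdet : A.det ≠ 0 := by
    intro h
    obtain ⟨w, hw, h0⟩ := Matrix.exists_mulVec_eq_zero_iff.2 h
    exact hw (hΦw w (Or.inl h0))
  have hcard : Module.finrank ℚ W + Module.finrank ℚ K = m := by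
    have := Module.finrank_eq_card_basis b
    simpa using this.symm
  refine ⟨_, _, hcard, S, T, A, A⁻¹, B, n, L, hTS, hDb ▸ hMS, ?_, ?_, hL1, ?_, ?_⟩
  · exact Matrix.nonsing_inv_mul A (isUnit_iff_ne_zero.2 hdet)
  · intro j
    simp only [hSc, hb1]
    exact hWsum _ (bW j).2
  · have : ∀ w, (B ^ (n + L)) *ᵥ w = (B ^ n) *ᵥ w := by
      intro w
      have h1 := hKper _ (hSK w)
      rw [hSB, hSB, ← sub_eq_zero, ← Matrix.mulVec_sub] at h1
      have h2 := hSinj _ h1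
      funext i
      exact sub_eq_zero.1 (congrFun h2 (Sum.inr i))
    exact Matrix.mulVec_injective (funext this)
  · intro ε hε
    refine eventually_pow_lt (fun z v hv hz => ?_) hε
    set ι := Rat.castHom ℂ
    have hMSc : (M.map ι) * (S.map ι) = (S.map ι) * fromBlocks (A.map ι) 0 0 (B.map ι) := by
      have : fromBlocks (A.map ι) 0 0 (B.map ι) = (fromBlocks A 0 0 B).map ι := by
        rw [Matrix.fromBlocks_map]; simp
      rw [this, ← Matrix.map_mul, ← Matrix.map_mul, ← hDb, hMS]
    have hTSc : (T.map ι) * (S.map ι) = 1 := by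
      rw [← Matrix.map_mul, hTS, Matrix.map_one _ (map_zero _) (map_one _)]
    set y := (S.map ι) *ᵥ (Sum.elim v 0) with hy
    have hy0 : y ≠ 0 := by
      intro h0
      apply hv
      have : Sum.elim v 0 = (0 : Fin (Module.finrank ℚ W) ⊕ Fin (Module.finrank ℚ K) → ℂ) := by
        rw [← Matrix.one_mulVec (Sum.elim v 0), ← hTSc, ← Matrix.mulVec_mulVec, ← hy, h0,
          Matrix.mulVec_zero]
      funext i
      exact congrFun this (Sum.inl i)
    have hMy : (M.map ι) *ᵥ y = z • y := by
      rw [hy, Matrix.mulVec_mulVec, hMSc, ← Matrix.mulVec_mulVec, Matrix.fromBlocks_mulVec]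
      simp only [Sum.elim_comp_inl, Sum.elim_comp_inr, Matrix.mulVec_zero, Matrix.zero_mulVec,
        add_zero, hz]
      rw [← Matrix.mulVec_smul]
      congr 1
      funext i
      cases i <;> simp
    obtain ⟨h1, h2⟩ := eigenvalue_of_colStochastic hM hy0 hMy
    refine lt_of_le_of_ne h1 fun hz1 => ?_
    have hzL := h2 hz1
    have h3 := pow_mulVec_eq_smul hz L
    rw [hzL, one_smul, ← Matrix.map_pow] at h3
    have h4 : ((A ^ L - 1).map ι).det = 0 := by
      rw [← Matrix.exists_mulVec_eq_zero_iff]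
      refine ⟨v, hv, ?_⟩
      rw [Matrix.map_sub _ (map_sub ι), Matrix.map_one _ (map_zero _) (map_one _), Matrix.sub_mulVec,
        h3, Matrix.one_mulVec, sub_self]
    have h5 : (A ^ L - 1).det = 0 := by
      have : ι (A ^ L - 1).det = 0 := by rw [RingHom.map_det]; exact h4
      exact (map_eq_zero ι).1 this
    obtain ⟨w, hw, h0⟩ := Matrix.exists_mulVec_eq_zero_iff.2 h5
    rw [Matrix.sub_mulVec, Matrix.one_mulVec, sub_eq_zero] at h0
    exact hw (hΦw w (Or.inr h0))

end Decomposition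

/-! ### Primitive recursive functions

The closure properties of primitive recursive functions, in the form that `fun_prop` uses. -/

attribute [fun_prop] Primrec

section Primrec

variable {α β γ σ : Type*} [Primcodable α] [Primcodable β] [Primcodable γ] [Primcodable σ]

@[fun_prop] theorem primrec_id' : Primrec (fun a : α => a) := Primrec.id

@[fun_prop] theorem primrec_const' (x : σ) : Primrec fun _ : α => x := Primrec.const x

@[fun_prop] theorem primrec_comp' {f : β → σ} {g : α → β} (hf : Primrec f) (hg : Primrec g) :
    Primrec fun a => f (g a) := hf.comp hg

@[fun_prop] theorem Primrec.fst' {f : α → β × σ} (hf : Primrec f) : Primrec fun a => (f a).1 :=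
  Primrec.fst.comp hf

@[fun_prop] theorem Primrec.snd' {f : α → β × σ} (hf : Primrec f) : Primrec fun a => (f a).2 :=
  Primrec.snd.comp hf

@[fun_prop] theorem Primrec.pair' {f : α → β} {g : α → σ} (hf : Primrec f) (hg : Primrec g) :
    Primrec fun a => (f a, g a) := Primrec.pair hf hg

@[fun_prop] theorem Primrec.natAdd' {f g : α → ℕ} (hf : Primrec f) (hg : Primrec g) :
    Primrec fun a => f a + g a := Primrec.nat_add.comp hf hg

@[fun_prop] theorem Primrec.natMul' {f g : α → ℕ} (hf : Primrec f) (hg : Primrec g) :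
    Primrec fun a => f a * g a := Primrec.nat_mul.comp hf hg

@[fun_prop] theorem Primrec.natSub' {f g : α → ℕ} (hf : Primrec f) (hg : Primrec g) :
    Primrec fun a => f a - g a := Primrec.nat_sub.comp hf hg

@[fun_prop] theorem Primrec.natDiv' {f g : α → ℕ} (hf : Primrec f) (hg : Primrec g) :
    Primrec fun a => f a / g a := Primrec.nat_div.comp hf hg

@[fun_prop] theorem Primrec.natMod' {f g : α → ℕ} (hf : Primrec f) (hg : Primrec g) :
    Primrec fun a => f a % g a := Primrec.nat_mod.comp hf hg

@[fun_prop] theorem Primrec.natPow' {f g : α → ℕ} (hf : Primrec f) (hg : Primrec g) :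
    Primrec fun a => f a ^ g a :=
  (Primrec₂.unpaired'.1 Nat.Primrec.pow : Primrec₂ ((· ^ ·) : ℕ → ℕ → ℕ)).comp hf hg

@[fun_prop] theorem Primrec.natPair' {f g : α → ℕ} (hf : Primrec f) (hg : Primrec g) :
    Primrec fun a => Nat.pair (f a) (g a) := Primrec₂.natPair.comp hf hg

@[fun_prop] theorem Primrec.natUnpair' {f : α → ℕ} (hf : Primrec f) :
    Primrec fun a => Nat.unpair (f a) := Primrec.unpair.comp hf

@[fun_prop] theorem Primrec.encode' {f : α → σ} (hf : Primrec f) :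
    Primrec fun a => Encodable.encode (f a) := Primrec.encode.comp hf

@[fun_prop] theorem Primrec.cond' {c : α → Bool} {f g : α → σ} (hc : Primrec c) (hf : Primrec f)
    (hg : Primrec g) : Primrec fun a => bif c a then f a else g a := Primrec.cond hc hf hg

@[fun_prop] theorem Primrec.boolAnd' {f g : α → Bool} (hf : Primrec f) (hg : Primrec g) :
    Primrec fun a => f a && g a := Primrec.and.comp hf hg

@[fun_prop] theorem Primrec.boolOr' {f g : α → Bool} (hf : Primrec f) (hg : Primrec g) :
    Primrec fun a => f a || g a := Primrec.or.comp hf hg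

@[fun_prop] theorem Primrec.boolNot' {f : α → Bool} (hf : Primrec f) :
    Primrec fun a => !(f a) := Primrec.not.comp hf

@[fun_prop] theorem Primrec.boolToNat' {f : α → Bool} (hf : Primrec f) :
    Primrec fun a => (f a).toNat := (Primrec.dom_bool Bool.toNat).comp hf

@[fun_prop] theorem Primrec.beq' [DecidableEq β] {f g : α → β} (hf : Primrec f) (hg : Primrec g) :
    Primrec fun a => f a == g a := by
  have : Primrec fun a => decide (f a = g a) := (Primrec.eq.comp hf hg).decide
  exact this.of_eq fun a => by rw [Bool.eq_iff_iff]; simp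

@[fun_prop] theorem Primrec.bne' [DecidableEq β] {f g : α → β} (hf : Primrec f) (hg : Primrec g) :
    Primrec fun a => f a != g a := Primrec.boolNot' (Primrec.beq' hf hg)

@[fun_prop] theorem Primrec.iteEq' [DecidableEq β] {f g : α → β} {u v : α → σ} (hf : Primrec f)
    (hg : Primrec g) (hu : Primrec u) (hv : Primrec v) :
    Primrec fun a => if f a = g a then u a else v a := Primrec.ite (Primrec.eq.comp hf hg) hu hv

@[fun_prop] theorem Primrec.decideLe' {f g : α → ℕ} (hf : Primrec f)
    (hg : Primrec g) : Primrec fun a => decide (f a ≤ g a) := (Primrec.nat_le.comp hf hg).decide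

@[fun_prop] theorem Primrec.decideLt' {f g : α → ℕ} (hf : Primrec f)
    (hg : Primrec g) : Primrec fun a => decide (f a < g a) := (Primrec.nat_lt.comp hf hg).decide

@[fun_prop] theorem Primrec.listGetD' {f : α → List β} {g : α → ℕ} {d : β} (hf : Primrec f)
    (hg : Primrec g) : Primrec fun a => (f a).getD (g a) d := (Primrec.list_getD d).comp hf hg

@[fun_prop] theorem Primrec.listRange' {f : α → ℕ} (hf : Primrec f) :
    Primrec fun a => List.range (f a) := Primrec.list_range.comp hf

@[fun_prop] theorem Primrec.listLength' {f : α → List β} (hf : Primrec f) :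
    Primrec fun a => (f a).length := Primrec.list_length.comp hf

@[fun_prop] theorem Primrec.listCons' {f : α → β} {g : α → List β} (hf : Primrec f)
    (hg : Primrec g) : Primrec fun a => f a :: g a := Primrec.list_cons.comp hf hg

@[fun_prop] theorem Primrec.listMap' {f : α → List β} {g : α → β → σ} (hf : Primrec f)
    (hg : Primrec fun x : α × β => g x.1 x.2) : Primrec fun a => (f a).map (g a) :=
  Primrec.list_map hf hg

@[fun_prop] theorem Primrec.listFlatMap' {f : α → List β} {g : α → β → List σ} (hf : Primrec f)
    (hg : Primrec fun x : α × β => g x.1 x.2) : Primrec fun a => (f a).flatMap (g a) :=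
  Primrec.list_flatMap hf hg

@[fun_prop] theorem Primrec.listFoldl' {f : α → List β} {g : α → σ → β → σ} {z : α → σ}
    (hf : Primrec f) (hg : Primrec fun x : α × (σ × β) => g x.1 x.2.1 x.2.2) (hz : Primrec z) :
    Primrec fun a => (f a).foldl (g a) (z a) :=
  Primrec.list_foldl (h := fun a p => g a p.1 p.2) hf hz hg

@[fun_prop] theorem Primrec.listFoldr' {f : α → List β} {g : α → β → σ → σ} {z : α → σ}
    (hf : Primrec f) (hg : Primrec fun x : α × (β × σ) => g x.1 x.2.1 x.2.2) (hz : Primrec z) :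
    Primrec fun a => (f a).foldr (g a) (z a) :=
  Primrec.list_foldr (h := fun a p => g a p.1 p.2) hf hz hg

@[fun_prop] theorem Primrec.listSumNat' {f : α → List ℕ} (hf : Primrec f) :
    Primrec fun a => (f a).sum := by
  have : Primrec fun a => (f a).foldr (fun x y => x + y) 0 := by fun_prop
  exact this.of_eq fun a => List.sum_eq_foldr.symm

@[fun_prop] theorem Primrec.listAll' {f : α → List β} {g : α → β → Bool} (hf : Primrec f)
    (hg : Primrec fun x : α × β => g x.1 x.2) : Primrec fun a => (f a).all (g a) := by
  have : Primrec fun a => (f a).foldr (fun x y => g a x && y) true := by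
    refine Primrec.listFoldr' hf ?_ (by fun_prop)
    exact Primrec.boolAnd' (hg.comp (f := fun x : α × β => g x.1 x.2)
      (g := fun x : α × (β × Bool) => (x.1, x.2.1)) (by fun_prop)) (by fun_prop)
  refine this.of_eq fun a => ?_
  induction f a with
  | nil => rfl
  | cons x l ih => simp [ih]

@[fun_prop] theorem Primrec.listAny' {f : α → List β} {g : α → β → Bool} (hf : Primrec f)
    (hg : Primrec fun x : α × β => g x.1 x.2) : Primrec fun a => (f a).any (g a) := by
  have : Primrec fun a => !((f a).all fun b => !(g a b)) :=
    Primrec.boolNot' (Primrec.listAll' hf (Primrec.boolNot' hg))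
  refine this.of_eq fun a => ?_
  rw [List.any_eq_not_all_not]

@[fun_prop] theorem Primrec.natIterate' {f : α → ℕ} {g : α → σ → σ} {z : α → σ} (hf : Primrec f)
    (hg : Primrec fun x : α × σ => g x.1 x.2) (hz : Primrec z) :
    Primrec fun a => (g a)^[f a] (z a) := Primrec.nat_iterate hf hz hg

@[fun_prop] theorem Primrec.testBit' {f g : α → ℕ} (hf : Primrec f) (hg : Primrec g) :
    Primrec fun a => (f a).testBit (g a) := by
  have : Primrec fun a => f a / 2 ^ g a % 2 == 1 := by fun_prop
  exact this.of_eq fun a => by rw [Nat.testBit_eq_decide_div_mod_eq, Bool.eq_iff_iff]; simp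

/-! ### Integers -/

theorem Int.encode_natCast (n : ℕ) : Encodable.encode (n : ℤ) = 2 * n := by
  change Equiv.natSumNatEquivNat (Sum.inl n) = _
  rw [Equiv.natSumNatEquivNat_apply, Sum.elim_inl]

theorem Int.encode_negSucc (n : ℕ) : Encodable.encode (Int.negSucc n) = 2 * n + 1 := by
  change Equiv.natSumNatEquivNat (Sum.inr n) = _
  rw [Equiv.natSumNatEquivNat_apply, Sum.elim_inr]

@[fun_prop] theorem Primrec.intToNat' {f : α → ℤ} (hf : Primrec f) :
    Primrec fun a => (f a).toNat := by
  have : Primrec fun a => if Encodable.encode (f a) % 2 = 0 then Encodable.encode (f a) / 2 else 0 := by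
    fun_prop
  refine this.of_eq fun a => ?_
  rcases f a with n | n
  · rw [Int.ofNat_eq_natCast, Int.encode_natCast, if_pos (by omega)]; simp
  · rw [Int.encode_negSucc, if_neg (by omega)]; rfl

@[fun_prop] theorem Primrec.intNegToNat' {f : α → ℤ} (hf : Primrec f) :
    Primrec fun a => (-(f a)).toNat := by
  have : Primrec fun a => if Encodable.encode (f a) % 2 = 0 then 0 else Encodable.encode (f a) / 2 + 1 := by
    fun_prop
  refine this.of_eq fun a => ?_
  rcases f a with n | n
  · rw [Int.ofNat_eq_natCast, Int.encode_natCast, if_pos (by omega)]; simp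
  · rw [Int.encode_negSucc, if_neg (by omega), Int.neg_negSucc]
    omega

theorem Primrec.intSubNatCast {f g : α → ℕ} (hf : Primrec f) (hg : Primrec g) :
    Primrec fun a => (f a : ℤ) - (g a : ℤ) := by
  rw [← Primrec.encode_iff]
  have : Primrec fun a => bif decide (g a ≤ f a) then 2 * (f a - g a)
    else 2 * (g a - f a - 1) + 1 := by fun_prop
  refine this.of_eq fun a => ?_
  by_cases h : g a ≤ f a
  · rw [decide_eq_true h, cond_true, ← Nat.cast_sub h, Int.encode_natCast]
  · rw [decide_eq_false h, cond_false, ← Int.encode_negSucc]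
    congr 1
    omega

@[fun_prop] theorem Primrec.intNatCast' {f : α → ℕ} (hf : Primrec f) :
    Primrec fun a => (f a : ℤ) :=
  (Primrec.intSubNatCast hf (Primrec.const 0)).of_eq fun a => by simp

@[fun_prop] theorem Primrec.intNatAbs' {f : α → ℤ} (hf : Primrec f) :
    Primrec fun a => (f a).natAbs := by
  have : Primrec fun a => (f a).toNat + (-(f a)).toNat := by fun_prop
  exact this.of_eq fun a => by omega

@[fun_prop] theorem Primrec.intNeg' {f : α → ℤ} (hf : Primrec f) : Primrec fun a => -(f a) :=
  (Primrec.intSubNatCast (f := fun a => (-(f a)).toNat) (g := fun a => (f a).toNat) (by fun_prop)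
    (by fun_prop)).of_eq fun a => by omega

@[fun_prop] theorem Primrec.intAdd' {f g : α → ℤ} (hf : Primrec f) (hg : Primrec g) :
    Primrec fun a => f a + g a :=
  (Primrec.intSubNatCast (f := fun a => (f a).toNat + (g a).toNat)
    (g := fun a => (-(f a)).toNat + (-(g a)).toNat) (by fun_prop) (by fun_prop)).of_eq
    fun a => by push_cast; omega

@[fun_prop] theorem Primrec.intMul' {f g : α → ℤ} (hf : Primrec f) (hg : Primrec g) :
    Primrec fun a => f a * g a :=
  (Primrec.intSubNatCast (f := fun a => (f a).toNat * (g a).toNat + (-(f a)).toNat * (-(g a)).toNat)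
    (g := fun a => (-(f a)).toNat * (g a).toNat + (f a).toNat * (-(g a)).toNat)
    (by fun_prop) (by fun_prop)).of_eq fun a => by
      have h : ∀ z : ℤ, z = (z.toNat : ℤ) - ((-z).toNat : ℤ) := fun z => by omega
      conv_rhs => rw [h (f a), h (g a)]
      push_cast
      ring

@[fun_prop] theorem Primrec.intPow' {f : α → ℤ} {g : α → ℕ} (hf : Primrec f) (hg : Primrec g) :
    Primrec fun a => f a ^ g a := by
  have : Primrec fun a => (fun z : ℤ => f a * z)^[g a] 1 := by
    refine Primrec.natIterate' hg ?_ (by fun_prop)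
    exact Primrec.intMul' (hf.comp Primrec.fst) (by fun_prop)
  refine this.of_eq fun a => ?_
  rw [mul_left_iterate]
  exact mul_one _

@[fun_prop] theorem Primrec.listSumInt' {f : α → List ℤ} (hf : Primrec f) :
    Primrec fun a => (f a).sum := by
  have : Primrec fun a => (f a).foldr (fun x y => x + y) 0 := by fun_prop
  exact this.of_eq fun a => List.sum_eq_foldr.symm

end Primrec

namespace DistMC

/-! ### Computability of the operations on codes of formulas -/

section Primrec

variable {α σ : Type*} [Primcodable α] [Primcodable σ]

@[fun_prop] theorem primrec_zeroExp {k : α → ℕ} (hk : Primrec k) : Primrec fun a => zeroExp (k a) := by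
  unfold zeroExp; fun_prop

@[fun_prop] theorem primrec_rawMul {k : α → ℕ} {p q : α → RawPoly} (hk : Primrec k)
    (hp : Primrec p) (hq : Primrec q) : Primrec fun a => rawMul (k a) (p a) (q a) := by
  unfold rawMul; fun_prop

@[fun_prop] theorem primrec_rawPow {k n : α → ℕ} {p : α → RawPoly} (hk : Primrec k)
    (hp : Primrec p) (hn : Primrec n) : Primrec fun a => rawPow (k a) (p a) (n a) := by
  have : Primrec fun a => (fun acc => rawMul (k a) (p a) acc)^[n a] [(1, zeroExp (k a))] := by
    fun_prop
  refine this.of_eq fun a => ?_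
  induction n a with
  | zero => rfl
  | succ n ih => rw [Function.iterate_succ_apply', ih]; rfl

@[fun_prop] theorem primrec_rawLin {k : α → ℕ} {w : α → ℤ} {P : α → ℕ → ℤ} (hk : Primrec k)
    (hw : Primrec w) (hP : Primrec fun x : α × ℕ => P x.1 x.2) :
    Primrec fun a => rawLin (k a) (w a) (P a) := by
  unfold rawLin; fun_prop

@[fun_prop] theorem primrec_rawDeg {m : α → ℕ} {e : α → List ℕ} (hm : Primrec m) (he : Primrec e) :
    Primrec fun a => rawDeg (m a) (e a) := by
  unfold rawDeg; fun_prop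

@[fun_prop] theorem primrec_rawSubst {m k δ : α → ℕ} {w : α → ℕ → ℤ} {P : α → ℕ → ℕ → ℤ}
    {p : α → RawPoly} (hm : Primrec m) (hk : Primrec k) (hw : Primrec fun x : α × ℕ => w x.1 x.2)
    (hP : Primrec fun x : α × ℕ × ℕ => P x.1 x.2.1 x.2.2) (hδ : Primrec δ) (hp : Primrec p) :
    Primrec fun a => rawSubst (m a) (k a) (w a) (P a) (δ a) (p a) := by
  unfold rawSubst rawSubstMonomial; fun_prop

@[fun_prop] theorem primrec_constTerm {p : α → RawPoly} (hp : Primrec p) :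
    Primrec fun a => constTerm (p a) := by
  unfold constTerm; fun_prop

@[fun_prop] theorem primrec_decodePoly {n : α → ℕ} (hn : Primrec n) :
    Primrec fun a => decodePoly (n a) :=
  Primrec.option_getD.comp (Primrec.decode.comp hn) (Primrec.const [])

/-- Recursion along codes of formulas is course-of-values recursion. -/
@[fun_prop] theorem primrec_foldCode {atomEq atomPos : α → ℕ → σ} {neg : α → σ → σ}
    {conj disj : α → σ → σ → σ} {n : α → ℕ} (h0 : Primrec fun x : α × ℕ => atomEq x.1 x.2)
    (h1 : Primrec fun x : α × ℕ => atomPos x.1 x.2) (h2 : Primrec fun x : α × σ => neg x.1 x.2)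
    (h3 : Primrec fun x : α × σ × σ => conj x.1 x.2.1 x.2.2)
    (h4 : Primrec fun x : α × σ × σ => disj x.1 x.2.1 x.2.2) (hn : Primrec n) :
    Primrec fun a => foldCode (atomEq a) (atomPos a) (neg a) (conj a) (disj a) (n a) := by
  have h2' : ∀ {g : α × List σ → σ}, Primrec g → Primrec fun x : α × List σ => neg x.1 (g x) :=
    fun hg => h2.comp (Primrec.pair Primrec.fst hg)
  have h3' : ∀ {f g : α × List σ → σ}, Primrec f → Primrec g →
      Primrec fun x : α × List σ => conj x.1 (f x) (g x) :=
    fun hf hg => h3.comp (Primrec.pair Primrec.fst (Primrec.pair hf hg))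
  have h4' : ∀ {f g : α × List σ → σ}, Primrec f → Primrec g →
      Primrec fun x : α × List σ => disj x.1 (f x) (g x) :=
    fun hf hg => h4.comp (Primrec.pair Primrec.fst (Primrec.pair hf hg))
  have h0' : ∀ {g : α × List σ → ℕ}, Primrec g → Primrec fun x : α × List σ => atomEq x.1 (g x) :=
    fun hg => h0.comp (Primrec.pair Primrec.fst hg)
  have h1' : ∀ {g : α × List σ → ℕ}, Primrec g → Primrec fun x : α × List σ => atomPos x.1 (g x) :=
    fun hg => h1.comp (Primrec.pair Primrec.fst hg)
  have hd : ∀ {g : α × List σ → ℕ}, Primrec g →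
      Primrec fun x : α × List σ => x.2.getD (g x) (atomEq x.1 0) := by
    intro g hg
    have : Primrec fun x : α × List σ => (x.2[g x]?).getD (atomEq x.1 0) :=
      Primrec.option_getD.comp (Primrec.list_getElem?.comp Primrec.snd hg) (h0' (Primrec.const 0))
    exact this.of_eq fun x => by rw [List.getD_eq_getElem?_getD]
  have key : Primrec₂ fun (a : α) (n : ℕ) =>
      foldCode (atomEq a) (atomPos a) (neg a) (conj a) (disj a) n := by
    refine Primrec.nat_strong_rec _ (g := fun a l => some (
      if l.length.unpair.1 = 0 then atomEq a l.length.unpair.2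
      else if l.length.unpair.1 = 1 then atomPos a l.length.unpair.2
      else if l.length.unpair.1 = 2 then neg a (l.getD l.length.unpair.2 (atomEq a 0))
      else if l.length.unpair.1 = 3 then conj a (l.getD l.length.unpair.2.unpair.1 (atomEq a 0))
        (l.getD l.length.unpair.2.unpair.2 (atomEq a 0))
      else if l.length.unpair.1 = 4 then disj a (l.getD l.length.unpair.2.unpair.1 (atomEq a 0))
        (l.getD l.length.unpair.2.unpair.2 (atomEq a 0))
      else atomEq a 0)) ?_ ?_
    · refine Primrec.option_some.comp ?_
      refine Primrec.iteEq' (by fun_prop) (by fun_prop) (h0' (by fun_prop)) ?_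
      refine Primrec.iteEq' (by fun_prop) (by fun_prop) (h1' (by fun_prop)) ?_
      refine Primrec.iteEq' (by fun_prop) (by fun_prop) (h2' (hd (by fun_prop))) ?_
      refine Primrec.iteEq' (by fun_prop) (by fun_prop)
        (h3' (hd (by fun_prop)) (hd (by fun_prop))) ?_
      exact Primrec.iteEq' (by fun_prop) (by fun_prop)
        (h4' (hd (by fun_prop)) (hd (by fun_prop))) (h0' (by fun_prop))
    · intro a n
      have hlt : ∀ t, n.unpair.1 = t + 1 → n.unpair.2 < n := by
        intro t ht
        have := Nat.add_le_pair n.unpair.1 n.unpair.2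
        rw [Nat.pair_unpair] at this
        omega
      rw [Option.some_inj, List.length_map, List.length_range]
      conv_rhs => rw [foldCode]
      have hle1 := Nat.unpair_left_le n.unpair.2
      have hle2 := Nat.unpair_right_le n.unpair.2
      split_ifs with h0 h1 h2 h3 h4
      · rfl
      · rfl
      · rw [getD_range_map _ _ _ _ (hlt 1 h2)]
      · rw [getD_range_map _ _ _ _ (hle1.trans_lt (hlt 2 h3)),
          getD_range_map _ _ _ _ (hle2.trans_lt (hlt 2 h3))]
      · rw [getD_range_map _ _ _ _ (hle1.trans_lt (hlt 3 h4)),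
          getD_range_map _ _ _ _ (hle2.trans_lt (hlt 3 h4))]
      · rfl
  exact key.comp Primrec.id hn

@[fun_prop] theorem primrec_substCode {m k δ n : α → ℕ} {w : α → ℕ → ℤ} {P : α → ℕ → ℕ → ℤ}
    (hm : Primrec m) (hk : Primrec k) (hw : Primrec fun x : α × ℕ => w x.1 x.2)
    (hP : Primrec fun x : α × ℕ × ℕ => P x.1 x.2.1 x.2.2) (hδ : Primrec δ) (hn : Primrec n) :
    Primrec fun a => substCode (m a) (k a) (w a) (P a) (δ a) (n a) := by
  have : Primrec fun x : α × ℕ => rawSubst (m x.1) (k x.1) (w x.1) (P x.1) (δ x.1) (decodePoly x.2) := by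
    refine primrec_rawSubst (by fun_prop) (by fun_prop) ?_ ?_ (by fun_prop) (by fun_prop)
    · exact hw.comp (g := fun x : (α × ℕ) × ℕ => (x.1.1, x.2)) (by fun_prop)
    · exact hP.comp (g := fun x : (α × ℕ) × ℕ × ℕ => (x.1.1, x.2)) (by fun_prop)
  unfold substCode; fun_prop

@[fun_prop] theorem primrec_evalCode {m δ n : α → ℕ} {w : α → ℕ → ℤ}
    (hm : Primrec m) (hw : Primrec fun x : α × ℕ => w x.1 x.2) (hδ : Primrec δ) (hn : Primrec n) :
    Primrec fun a => evalCode (m a) (w a) (δ a) (n a) := by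
  have : Primrec fun x : α × ℕ =>
      constTerm (rawSubst (m x.1) 0 (w x.1) (fun _ _ => 0) (δ x.1) (decodePoly x.2)) := by
    refine primrec_constTerm (primrec_rawSubst (by fun_prop) (by fun_prop) ?_ (by fun_prop)
      (by fun_prop) (by fun_prop))
    exact hw.comp (g := fun x : (α × ℕ) × ℕ => (x.1.1, x.2)) (by fun_prop)
  unfold evalCode; fun_prop

@[fun_prop] theorem primrec_coordPoly {k j : α → ℕ} {a : α → ℤ} (hk : Primrec k) (ha : Primrec a)
    (hj : Primrec j) : Primrec fun x => coordPoly (k x) (a x) (j x) := by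
  unfold coordPoly; fun_prop

@[fun_prop] theorem primrec_boxCode {k q c : α → ℕ} (hk : Primrec k) (hq : Primrec q)
    (hc : Primrec c) : Primrec fun a => boxCode (k a) (q a) (c a) := by
  unfold boxCode; fun_prop

@[fun_prop] theorem primrec_normBound {k n : α → ℕ} (hk : Primrec k) (hn : Primrec n) :
    Primrec fun a => normBound (k a) (n a) := by
  unfold normBound; fun_prop

@[fun_prop] theorem primrec_boxConst {k c : α → ℕ} (hk : Primrec k) (hc : Primrec c) :
    Primrec fun a => boxConst (k a) (c a) := by
  have h1 : Primrec elimStep := by unfold elimStep remBound; fun_prop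
  unfold boxConst; fun_prop

end Primrec

end DistMC

namespace DistMC

/-! ### Product of a Muller automaton with a phase counter -/

section Automaton

variable {σ τ : Type}

theorem MullerAutomaton.run_congr_start (A : MullerAutomaton σ) (w : ℕ → σ) (s n : ℕ) :
    MullerAutomaton.run { A with start := A.run w s } (fun n => w (s + n)) n = A.run w (s + n) := by
  induction n with
  | zero => rfl
  | succ n ih =>
    change A.step (MullerAutomaton.run { A with start := A.run w s } (fun n => w (s + n)) n)
      (w (s + n)) = A.step (A.run w (s + n)) (w (s + n))
    rw [ih]

/-- The states visited infinitely often. -/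
noncomputable def MullerAutomaton.infSet (A : MullerAutomaton σ) (w : ℕ → σ) :
    Finset (Fin A.numStates) := by
  classical exact Finset.univ.filter fun q => ∃ᶠ n in Filter.atTop, A.run w n = q

theorem MullerAutomaton.mem_infSet {A : MullerAutomaton σ} {w : ℕ → σ} {q : Fin A.numStates} :
    q ∈ A.infSet w ↔ ∃ᶠ n in Filter.atTop, A.run w n = q := by
  simp [MullerAutomaton.infSet]

theorem MullerAutomaton.mem_language {A : MullerAutomaton σ} {w : ℕ → σ} :
    w ∈ A.language ↔ A.infSet w ∈ A.family := by
  constructor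
  · rintro ⟨F, hF, h⟩
    have : A.infSet w = F := by ext q; rw [mem_infSet, h]
    rwa [this]
  · exact fun h => ⟨_, h, fun q => mem_infSet⟩

/-- Finite prefixes do not matter once the state reached after them is taken as initial state. -/
theorem MullerAutomaton.shift_mem_language (A : MullerAutomaton σ) (w : ℕ → σ) (s : ℕ) :
    (fun n => w (s + n)) ∈ MullerAutomaton.language { A with start := A.run w s } ↔
      w ∈ A.language := by
  rw [mem_language, mem_language]
  have : MullerAutomaton.infSet { A with start := A.run w s } (fun n => w (s + n)) = A.infSet w := by
    ext q
    rw [mem_infSet, mem_infSet]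
    simp only [run_congr_start]
    rw [Filter.frequently_atTop, Filter.frequently_atTop]
    constructor
    · intro h a
      obtain ⟨b, hb, h⟩ := h a
      exact ⟨s + b, by omega, h⟩
    · intro h a
      obtain ⟨b, hb, h⟩ := h (s + a)
      exact ⟨b - s, by omega, by rw [Nat.add_sub_cancel' (by omega)]; exact h⟩
  rw [this]

theorem divNat_finProdFinEquiv {m n : ℕ} (r : Fin m) (q : Fin n) :
    (finProdFinEquiv (r, q)).divNat = r :=
  congrArg Prod.fst (finProdFinEquiv.symm_apply_apply (r, q))

theorem modNat_finProdFinEquiv {m n : ℕ} (r : Fin m) (q : Fin n) :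
    (finProdFinEquiv (r, q)).modNat = q :=
  congrArg Prod.snd (finProdFinEquiv.symm_apply_apply (r, q))

/-- The subset `{i | (r, i) ∈ a}` of a set of pairs. -/
def slice {L h : ℕ} (r : Fin L) (a : Finset (Fin (L * h))) : Finset (Fin h) :=
  Finset.univ.filter fun i => finProdFinEquiv (r, i) ∈ a

/-- The automaton that counts the time modulo `L` and reads, at time `n`, the slice with index
`n % L` of the letter. -/
def MullerAutomaton.phased {h : ℕ} (A : MullerAutomaton (Finset (Fin h))) (L : ℕ) (hL : 0 < L)
    (q₀ : Fin A.numStates) : MullerAutomaton (Finset (Fin (L * h))) where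
  numStates := L * A.numStates
  start := finProdFinEquiv (⟨0, hL⟩, q₀)
  step s a := finProdFinEquiv (⟨(s.divNat + 1) % L, Nat.mod_lt _ hL⟩, A.step s.modNat (slice s.divNat a))
  family := Finset.univ.filter fun F => F.image (fun s => s.modNat) ∈ A.family

/-- The first component of the state is the time modulo `L`, the second one follows the run on the
slices. -/
theorem MullerAutomaton.run_phased {h : ℕ} (A : MullerAutomaton (Finset (Fin h))) {L : ℕ}
    (hL : 0 < L) (q₀ : Fin A.numStates) (w : ℕ → Finset (Fin (L * h))) (n : ℕ) :
    (A.phased L hL q₀).run w n = finProdFinEquiv (⟨n % L, Nat.mod_lt _ hL⟩,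
      MullerAutomaton.run { A with start := q₀ }
        (fun n => slice ⟨n % L, Nat.mod_lt _ hL⟩ (w n)) n) := by
  induction n with
  | zero =>
    change finProdFinEquiv (⟨0, hL⟩, q₀) = finProdFinEquiv (_, q₀)
    simp
  | succ n ih =>
    change (A.phased L hL q₀).step ((A.phased L hL q₀).run w n) (w n) = _
    rw [ih]
    generalize hq : MullerAutomaton.run { A with start := q₀ }
        (fun n => slice ⟨n % L, Nat.mod_lt _ hL⟩ (w n)) n = q
    have h3 := divNat_finProdFinEquiv (⟨n % L, Nat.mod_lt _ hL⟩ : Fin L) q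
    have h4 := modNat_finProdFinEquiv (⟨n % L, Nat.mod_lt _ hL⟩ : Fin L) q
    change finProdFinEquiv (_, _) = finProdFinEquiv (_, A.step
      (MullerAutomaton.run { A with start := q₀ } _ n) _)
    rw [hq]
    congr 1
    refine Prod.ext ?_ ?_
    · refine Fin.ext ?_
      simp only [h3, Nat.mod_add_mod]
    · simp only [h3, h4]

/-- The set of states that the product visits infinitely often projects onto the corresponding set of
the factor, because a state visited infinitely often is visited infinitely often in some phase. -/
theorem MullerAutomaton.mem_language_phased {h : ℕ} (A : MullerAutomaton (Finset (Fin h))) {L : ℕ}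
    (hL : 0 < L) (q₀ : Fin A.numStates) (w : ℕ → Finset (Fin (L * h))) :
    w ∈ (A.phased L hL q₀).language ↔ (fun n => slice ⟨n % L, Nat.mod_lt _ hL⟩ (w n)) ∈
      MullerAutomaton.language { A with start := q₀ } := by
  rw [mem_language, mem_language]
  let F : Finset (Fin (L * A.numStates)) := (A.phased L hL q₀).infSet w
  have hF : ∀ s : Fin (L * A.numStates), s ∈ F ↔
      ∃ᶠ n in Filter.atTop, (A.phased L hL q₀).run w n = s := fun s => mem_infSet
  change F ∈ Finset.univ.filter (fun F : Finset (Fin (L * A.numStates)) =>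
    F.image (fun s => s.modNat) ∈ A.family) ↔ _
  clear_value F
  rw [Finset.mem_filter, and_iff_right (Finset.mem_univ _)]
  have : F.image (fun s => s.modNat) = MullerAutomaton.infSet { A with start := q₀ }
        (fun n => slice ⟨n % L, Nat.mod_lt _ hL⟩ (w n)) := by
    ext q
    rw [mem_infSet, Finset.mem_image]
    constructor
    · rintro ⟨s, hs, rfl⟩
      rw [hF] at hs
      refine hs.mono fun n hn => ?_
      rw [run_phased] at hn
      rw [← hn]
      exact (modNat_finProdFinEquiv _ _).symm
    · intro hq
      by_contra! hall
      have h1 : ∀ r : Fin L, ∀ᶠ n in Filter.atTop, (A.phased L hL q₀).run w n ≠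
          finProdFinEquiv (r, q) := by
        intro r
        rw [← Filter.not_frequently, ← hF]
        intro hmem
        exact hall _ hmem (modNat_finProdFinEquiv r q)
      have h2 := Filter.eventually_all.2 h1
      obtain ⟨n, hn, hn2⟩ := (hq.and_eventually h2).exists
      refine hn2 ⟨n % L, Nat.mod_lt _ hL⟩ ?_
      rw [run_phased, hn]
  rw [this]

/-! The code of the product: the pair `(r, q)` is the number `q + n * r`, so that the slices of a
set of pairs are blocks of binary digits. -/

theorem slice_subsetOfBits {L h : ℕ} (r : Fin L) (b : ℕ) :
    slice r (subsetOfBits (L * h) b) = subsetOfBits h (b / 2 ^ (h * r) % 2 ^ h) := by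
  ext i
  simp only [slice, subsetOfBits, Finset.mem_filter, Finset.mem_univ, true_and,
    finProdFinEquiv_apply_val, Nat.testBit_mod_two_pow, Nat.testBit_div_two_pow, i.2, decide_true,
    Bool.true_and]

/-- Whether the set of states with code `b` is the projection of the set of pairs with code `b'`. -/
def projectsTo (n L b b' : ℕ) : Bool :=
  (List.range n).all fun q => b.testBit q == (List.range L).any fun r => b'.testBit (q + n * r)

/-- The code of the automaton `MullerAutomaton.phased`. -/
def phasedCode (h L q₀ : ℕ) (c : AutomatonCode) : AutomatonCode :=
  (L * c.1, q₀,
    (List.range (L * c.1)).map fun s => (List.range (2 ^ (L * h))).map fun b =>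
      (c.2.2.1.getD (s % c.1) []).getD (b / 2 ^ (h * (s / c.1)) % 2 ^ h) 0 +
        c.1 * ((s / c.1 + 1) % L),
    (List.range (2 ^ (L * c.1))).map fun b' => (List.range (2 ^ c.1)).any fun b =>
      c.2.2.2.getD b false && projectsTo c.1 L b b')

theorem ofFn_eq_range_map {β : Type*} {n : ℕ} {f : Fin n → β} {g : ℕ → β}
    (h : ∀ i : Fin n, f i = g i) : List.ofFn f = (List.range n).map g := by
  refine List.ext_getElem (by simp) fun i h1 h2 => ?_
  simp [h]

theorem getD_ofFn {β : Type*} {n : ℕ} (f : Fin n → β) (d : β) (i : ℕ) (hi : i < n) :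
    (List.ofFn f).getD i d = f ⟨i, hi⟩ := by
  simp [hi]

theorem MullerAutomaton.getD_code_step {h : ℕ} (A : MullerAutomaton (Finset (Fin h)))
    (q : Fin A.numStates) {b : ℕ} (hb : b < 2 ^ h) :
    (A.code.2.2.1.getD q []).getD b 0 = A.step q (subsetOfBits h b) := by
  simp only [MullerAutomaton.code]
  rw [getD_ofFn _ _ _ q.2, getD_ofFn _ _ _ hb]

theorem MullerAutomaton.getD_code_family {h : ℕ} (A : MullerAutomaton (Finset (Fin h)))
    {b : ℕ} (hb : b < 2 ^ A.numStates) :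
    A.code.2.2.2.getD b false = true ↔ subsetOfBits A.numStates b ∈ A.family := by
  simp only [MullerAutomaton.code]
  rw [getD_ofFn _ _ _ hb, decide_eq_true_iff]

theorem MullerAutomaton.code_phased {h : ℕ} (A : MullerAutomaton (Finset (Fin h))) {L : ℕ}
    (hL : 0 < L) (q₀ : Fin A.numStates) :
    (A.phased L hL q₀).code = phasedCode h L q₀ A.code := by
  have hn : A.code.1 = A.numStates := rfl
  rw [phasedCode, hn, MullerAutomaton.code]
  refine Prod.ext rfl (Prod.ext ?_ (Prod.ext ?_ ?_))
  · simp [MullerAutomaton.phased]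
  · refine ofFn_eq_range_map fun s => ofFn_eq_range_map fun b => ?_
    change ((finProdFinEquiv ((⟨(Fin.divNat s + 1) % L, Nat.mod_lt _ hL⟩ : Fin L), A.step (Fin.modNat s)
      (slice (Fin.divNat s) (subsetOfBits (L * h) b))) : Fin (L * A.numStates)) : ℕ) = _
    rw [finProdFinEquiv_apply_val, slice_subsetOfBits,
      ← A.getD_code_step _ (Nat.mod_lt _ (Nat.two_pow_pos h))]
    rfl
  · refine ofFn_eq_range_map fun b' => ?_
    rw [Bool.eq_iff_iff, decide_eq_true_iff, List.any_eq_true]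
    have hmem : ∀ q : Fin A.numStates,
        q ∈ (subsetOfBits (L * A.numStates) b').image (fun s => Fin.modNat s) ↔
          ((List.range L).any fun r => (b' : ℕ).testBit (q + A.numStates * r)) = true := by
      intro q
      rw [Finset.mem_image, List.any_eq_true]
      constructor
      · rintro ⟨s, hs, rfl⟩
        refine ⟨s.divNat, List.mem_range.2 s.divNat.2, ?_⟩
        have := (Finset.mem_filter.1 hs).2
        rw [Fin.coe_modNat, Fin.coe_divNat, Nat.mod_add_div]
        exact this
      · rintro ⟨r, hr, hb⟩
        refine ⟨finProdFinEquiv (⟨r, List.mem_range.1 hr⟩, q), ?_, ?_⟩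
        · rw [subsetOfBits, Finset.mem_filter]
          exact ⟨Finset.mem_univ _, hb⟩
        · exact modNat_finProdFinEquiv _ q
    have heq : ∀ b : ℕ, subsetOfBits A.numStates b =
        (subsetOfBits (L * A.numStates) b').image (fun s => Fin.modNat s) ↔
        projectsTo A.numStates L b b' = true := by
      intro b
      rw [projectsTo, Finset.ext_iff, List.all_eq_true]
      constructor
      · intro hq q hqr
        have h1 := hq ⟨q, List.mem_range.1 hqr⟩
        rw [hmem, subsetOfBits, Finset.mem_filter, and_iff_right (Finset.mem_univ _)] at h1
        rw [beq_iff_eq, Bool.eq_iff_iff]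
        exact h1
      · intro hq q
        have h1 := hq q (List.mem_range.2 q.2)
        rw [beq_iff_eq, Bool.eq_iff_iff] at h1
        rw [hmem, ← h1, subsetOfBits, Finset.mem_filter, and_iff_right (Finset.mem_univ _)]
    change subsetOfBits (L * A.numStates) b' ∈ Finset.univ.filter _ ↔ _
    rw [Finset.mem_filter, and_iff_right (Finset.mem_univ _)]
    constructor
    · intro hF
      obtain ⟨b, hb⟩ := exists_bits ((subsetOfBits (L * A.numStates) b').image (fun s => Fin.modNat s))
      refine ⟨b, List.mem_range.2 b.2, ?_⟩
      rw [Bool.and_eq_true, ← heq, A.getD_code_family b.2, hb]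
      exact ⟨hF, rfl⟩
    · rintro ⟨b, hb, hb'⟩
      rw [Bool.and_eq_true, ← heq, A.getD_code_family (List.mem_range.1 hb)] at hb'
      rw [← hb'.2]
      exact hb'.1

end Automaton

end DistMC

namespace DistMC

/-! ### The reduced instance -/

/-- The pullback of a formula along `x ↦ (w + P x) / δ`, localised to a box so small that the
origin lies in the closure of the set unless the set is empty. -/
def SAFormula.pullback {m : ℕ} (k : ℕ) (w : ℕ → ℤ) (P : ℕ → ℕ → ℤ) (δ : ℕ) (φ : SAFormula m) :
    SAFormula k :=
  (φ.subst k w P δ).box (boxConst k (normBound k (φ.subst k w P δ).code))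

/-- The inverse of the width of the box in `SAFormula.pullback`. -/
def pullbackConst (m k : ℕ) (w : ℕ → ℤ) (P : ℕ → ℕ → ℤ) (δ n : ℕ) : ℕ :=
  boxConst k (normBound k (substCode m k w P δ n))

/-- The code of the formula `SAFormula.pullback`. -/
def pullbackCode (m k : ℕ) (w : ℕ → ℤ) (P : ℕ → ℕ → ℤ) (δ n : ℕ) : ℕ :=
  boxCode k (pullbackConst m k w P δ n) (substCode m k w P δ n)

theorem code_pullback {m k : ℕ} (w : ℕ → ℤ) (P : ℕ → ℕ → ℤ) (δ : ℕ) (φ : SAFormula m) :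
    (φ.pullback k w P δ).code = pullbackCode m k w P δ φ.code := by
  rw [SAFormula.pullback, code_box, code_subst]
  rfl

theorem SAFormula.mem_pullback {m k : ℕ} {w : ℕ → ℤ} {P : ℕ → ℕ → ℤ} {δ : ℕ} (hδ : 0 < δ)
    (φ : SAFormula m) (x : Fin k → ℝ) : x ∈ (φ.pullback k w P δ).toSet ↔
      affinePoint m w P δ x ∈ φ.toSet ∧ ∀ j, |x j| * pullbackConst m k w P δ φ.code < 1 := by
  rw [SAFormula.pullback, SAFormula.mem_box, SAFormula.mem_subst hδ, code_subst]
  rfl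

theorem continuous_affinePoint {m k : ℕ} (w : ℕ → ℤ) (P : ℕ → ℕ → ℤ) (δ : ℕ) :
    Continuous (affinePoint m w P δ : (Fin k → ℝ) → Fin m → ℝ) := by
  unfold affinePoint; fun_prop

theorem SAFormula.intrinsicDim_pullback_le {m k : ℕ} {w : ℕ → ℤ} {P : ℕ → ℕ → ℤ} {δ : ℕ}
    (hδ : 0 < δ) {Q : Fin k → Fin m → ℚ}
    (hQ : ∀ j l : Fin k, ∑ i, Q j i * P i l = if j = l then 1 else 0) (φ : SAFormula m) :
    intrinsicDim (φ.pullback k w P δ).toSet ≤ intrinsicDim φ.toSet :=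
  intrinsicDim_le_of_affinePoint hδ hQ fun x hx => ((φ.mem_pullback hδ x).1 hx).1

/-- Unless the pullback is empty, the point `w / δ` belongs to the closure of the set, hence to
its span, but not to the span of the columns of `P`. -/
theorem SAFormula.linearDim_pullback_le {m k : ℕ} {w : ℕ → ℤ} {P : ℕ → ℕ → ℤ} {δ : ℕ}
    (hδ : 0 < δ) {Q : Fin k → Fin m → ℚ}
    (hQ : ∀ j l : Fin k, ∑ i, Q j i * P i l = if j = l then 1 else 0)
    (hP : ∀ j : Fin k, ∑ i : Fin m, P i j = 0) (hw : ∑ i : Fin m, w i ≠ 0) (φ : SAFormula m) :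
    linearDim (φ.pullback k w P δ).toSet ≤ linearDim φ.toSet - 1 := by
  refine linearDim_le_of_affinePoint hδ hQ hP hw
    (fun x hx => ((φ.mem_pullback hδ x).1 hx).1) ?_
  rintro ⟨x, hx⟩
  rw [SAFormula.pullback, SAFormula.mem_box] at hx
  have h0 := SAFormula.zero_mem_closure (Nat.le_add_left 4 _)
    (φ.subst k w P δ).forallPoly_norm_le hx.1 hx.2
  have h1 := map_mem_closure (t := φ.toSet) (continuous_affinePoint w P δ) h0
    fun y hy => (φ.mem_subst hδ y).1 hy
  have h2 : affinePoint m w P δ (0 : Fin k → ℝ) = fun i : Fin m => (w i : ℝ) / δ := by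
    funext i; simp [affinePoint]
  rwa [h2] at h1

/-- The code of the reduced instance: `k` is the dimension, `v` the initial vector, `A` the update
matrix, and for the phase `r` the points are transformed by `x ↦ (w r + P x) / δ`. -/
def reducedCode (c : InstanceCode) (k L δ q₀ : ℕ) (v : ℕ → ℤ × ℕ) (A : ℕ → ℕ → ℤ × ℕ)
    (w P : ℕ → ℕ → ℤ) : InstanceCode :=
  (k, (List.range k).map v, (List.range k).map fun i => (List.range k).map (A i),
    (List.range (L * c.2.2.2.1.length)).map fun t =>
      pullbackCode c.1 k (w (t / c.2.2.2.1.length)) P δ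
        (c.2.2.2.1.getD (t % c.2.2.2.1.length) 0),
    phasedCode c.2.2.2.1.length L q₀ c.2.2.2.2)

theorem Instance.mem_charWord {I : Instance} {n : ℕ} {i : Fin I.numTargets} :
    i ∈ I.charWord n ↔ I.orbit n ∈ (I.target i).toSet := by
  simp [Instance.charWord]

/-- The correctness of the reduction. The trajectory of the given instance, from time `s₀` on, consists
of the images of the points of the new trajectory under the affine maps `x ↦ (w r + P x) / δ`, where
the phase `r` is the time modulo `L`, and the new trajectory does not leave the boxes. -/
theorem exists_reduced (I : Instance) {k L δ s₀ q₀ : ℕ} (hL : 0 < L) (hδ : 0 < δ)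
    {A A' : Matrix (Fin k) (Fin k) ℚ} {v : Fin k → ℚ} {w P : ℕ → ℕ → ℤ}
    {Q : Fin k → Fin I.dim → ℚ} {cv : ℕ → ℤ × ℕ} {cA : ℕ → ℕ → ℤ × ℕ}
    (hcv : ∀ i : Fin k, ratCode (v i) = cv i) (hcA : ∀ i j : Fin k, ratCode (A i j) = cA i j)
    (hA : A' * A = 1) (hQ : ∀ j l : Fin k, ∑ i, Q j i * P i l = if j = l then 1 else 0)
    (hP : ∀ j : Fin k, ∑ i : Fin I.dim, P i j = 0)
    (hw : ∀ r < L, ∑ i : Fin I.dim, w r i ≠ 0)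
    (horb : ∀ n (i : Fin I.dim), (δ : ℚ) * ((I.mat ^ (s₀ + n)).mulVec I.init i) =
      w (n % L) i + ∑ j : Fin k, P i j * ((A ^ n).mulVec v) j)
    (hbox : ∀ n, ∀ t < L * I.code.2.2.2.1.length, ∀ j, |((A ^ n).mulVec v) j| *
      pullbackConst I.dim k (w (t / I.code.2.2.2.1.length)) P δ
        (I.code.2.2.2.1.getD (t % I.code.2.2.2.1.length) 0) < 1)
    (hrun : (I.automaton.run I.charWord s₀ : ℕ) = q₀) :
    ∃ J : Instance, reducedCode I.code k L δ q₀ cv cA w P = J.code ∧ J.dim = k ∧ IsUnit J.mat ∧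
      (∀ j, ∃ i, intrinsicDim (J.target j).toSet ≤ intrinsicDim (I.target i).toSet ∧
        linearDim (J.target j).toSet ≤ linearDim (I.target i).toSet - 1) ∧
      (I.Holds ↔ J.Holds) := by
  have hδ' : (δ : ℝ) ≠ 0 := by positivity
  let J : Instance :=
    { dim := k
      init := v
      mat := A
      numTargets := L * I.numTargets
      target := fun t => (I.target t.modNat).pullback k (w t.divNat) P δ
      automaton := I.automaton.phased L hL (I.automaton.run I.charWord s₀) }
  have hlen : I.code.2.2.2.1.length = I.numTargets := by simp [Instance.code]
  have hget : ∀ i : Fin I.numTargets, I.code.2.2.2.1.getD i 0 = (I.target i).code := fun i => by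
    simp only [Instance.code]
    rw [getD_ofFn _ _ _ i.2]
  rw [hlen] at hbox
  refine ⟨J, ?_, rfl, ?_, ?_, ?_⟩
  · rw [reducedCode, hlen]
    refine Prod.ext rfl (Prod.ext ?_ (Prod.ext ?_ (Prod.ext ?_ ?_)))
    · exact (ofFn_eq_range_map hcv).symm
    · exact (ofFn_eq_range_map fun i => ofFn_eq_range_map (hcA i)).symm
    · refine (ofFn_eq_range_map fun t => ?_).symm
      rw [code_pullback, ← hget]
      rfl
    · rw [← hrun]
      exact (I.automaton.code_phased hL _).symm
  · exact (Matrix.isUnit_iff_isUnit_det A).2 (Matrix.isUnit_det_of_left_inverse hA)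
  · intro t
    refine ⟨Fin.modNat (n := I.numTargets) t, ?_, ?_⟩
    · exact SAFormula.intrinsicDim_pullback_le hδ hQ _
    · exact SAFormula.linearDim_pullback_le hδ hQ hP (hw _ (Fin.divNat (n := I.numTargets) t).2) _
  · have horbit : ∀ n, I.orbit (s₀ + n) = affinePoint I.dim (w (n % L)) P δ (J.orbit n) := by
      intro n
      funext i
      rw [affinePoint, eq_div_iff hδ', mul_comm]
      have h1 := horb n i
      have h2 : I.orbit (s₀ + n) i = (((I.mat ^ (s₀ + n)).mulVec I.init i : ℚ) : ℝ) := rfl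
      have h3 : ∀ j, J.orbit n j = (((A ^ n).mulVec v j : ℚ) : ℝ) := fun j => rfl
      simp only [h2, h3]
      exact_mod_cast h1
    have hletter : ∀ n, I.charWord (s₀ + n) = slice ⟨n % L, Nat.mod_lt _ hL⟩ (J.charWord n) := by
      intro n
      ext i
      have h1 := hbox n (finProdFinEquiv (⟨n % L, Nat.mod_lt _ hL⟩, i)) (Fin.is_lt _)
      rw [← Fin.coe_divNat, ← Fin.coe_modNat, hget, modNat_finProdFinEquiv,
        divNat_finProdFinEquiv] at h1
      have h2 : i ∈ slice ⟨n % L, Nat.mod_lt _ hL⟩ (J.charWord n) ↔ J.orbit n ∈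
          ((I.target (finProdFinEquiv ((⟨n % L, Nat.mod_lt _ hL⟩ : Fin L), i)).modNat).pullback k
            (w (finProdFinEquiv ((⟨n % L, Nat.mod_lt _ hL⟩ : Fin L), i)).divNat) P δ).toSet := by
        rw [slice, Finset.mem_filter, and_iff_right (Finset.mem_univ _)]
        exact Instance.mem_charWord (I := J)
      rw [h2, modNat_finProdFinEquiv, divNat_finProdFinEquiv, SAFormula.mem_pullback hδ,
        ← horbit, Instance.mem_charWord]
      refine ⟨fun h => ⟨h, fun j => ?_⟩, fun h => h.1⟩
      have h3 : J.orbit n j = (((A ^ n).mulVec v j : ℚ) : ℝ) := rfl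
      rw [h3]
      exact_mod_cast h1 j
    -- The prefix of length `s₀` is absorbed into the initial state of the new automaton.
    rw [Instance.Holds, Instance.Holds, ← MullerAutomaton.shift_mem_language _ _ s₀]
    have := MullerAutomaton.mem_language_phased I.automaton hL (I.automaton.run I.charWord s₀)
      J.charWord
    simp only [hletter]
    exact this.symm

end DistMC

namespace DistMC

open Matrix

/-! ### Rational matrices as finite data

Rational numbers are handled as pairs of a numerator and a denominator, which need not be coprime;
in the pairs, `d - 1 + 1` is the denominator `d`, and `1` if `d = 0`. -/

/-- The rational number given by a numerator and a denominator; the denominator `0` counts as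
`1`. -/
def ratVal (r : ℤ × ℕ) : ℚ := (r.1 : ℚ) / ((r.2 - 1 + 1 : ℕ) : ℚ)

/-- The sum of fractions. -/
def rawAdd (r s : ℤ × ℕ) : ℤ × ℕ :=
  (r.1 * (s.2 - 1 + 1 : ℕ) + s.1 * (r.2 - 1 + 1 : ℕ), (r.2 - 1 + 1) * (s.2 - 1 + 1))

/-- The product of fractions. -/
def rawRatMul (r s : ℤ × ℕ) : ℤ × ℕ := (r.1 * s.1, (r.2 - 1 + 1) * (s.2 - 1 + 1))

/-- The absolute value of a fraction. -/
def rawAbs (r : ℤ × ℕ) : ℤ × ℕ := ((r.1.natAbs : ℤ), r.2)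

/-- An integer as a fraction. -/
def rawInt (z : ℤ) : ℤ × ℕ := (z, 1)

/-- Equality of the values of fractions. -/
def rawEq (r s : ℤ × ℕ) : Bool := r.1 * (s.2 - 1 + 1 : ℕ) == s.1 * (r.2 - 1 + 1 : ℕ)

/-- Comparison of the values of fractions. -/
def rawLe (r s : ℤ × ℕ) : Bool :=
  (r.1 * (s.2 - 1 + 1 : ℕ) + -(s.1 * (r.2 - 1 + 1 : ℕ))).toNat == 0

/-- Whether a fraction is reduced. -/
def rawReduced (r : ℤ × ℕ) : Bool :=
  r.2 != 0 && (List.range (r.2 + 1)).all fun d =>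
    decide (d ≤ 1) || r.1.natAbs % d != 0 || r.2 % d != 0

/-- The sum of the first `n` terms of a sequence of fractions. -/
def rawSum (n : ℕ) (f : ℕ → ℤ × ℕ) : ℤ × ℕ := (List.range n).foldr (fun i x => rawAdd (f i) x) (0, 1)

/-- The entries of a product of matrices, where `n` is the length of the rows of the left factor. -/
def rawMatMul (n : ℕ) (f g : ℕ → ℕ → ℤ × ℕ) (i j : ℕ) : ℤ × ℕ :=
  rawSum n fun a => rawRatMul (f i a) (g a j)

/-- Equality of `r × c` matrices of fractions. -/
def rawMatEq (r c : ℕ) (f g : ℕ → ℕ → ℤ × ℕ) : Bool :=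
  (List.range r).all fun i => (List.range c).all fun j => rawEq (f i j) (g i j)

/-- The entries of the identity matrix. -/
def rawOne (i j : ℕ) : ℤ × ℕ := if i = j then (1, 1) else (0, 1)

/-- The rational matrix with given entries. -/
def toMat (r c : ℕ) (f : ℕ → ℕ → ℤ × ℕ) : Matrix (Fin r) (Fin c) ℚ := Matrix.of fun i j => ratVal (f i j)

theorem toMat_apply {r c : ℕ} (f : ℕ → ℕ → ℤ × ℕ) (i : Fin r) (j : Fin c) :
    toMat r c f i j = ratVal (f i j) := rfl

theorem ratVal_ratCode (q : ℚ) : ratVal (ratCode q) = q := by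
  have := q.den_pos
  rw [ratVal, ratCode, Nat.sub_add_cancel this, Rat.num_div_den]

theorem ratVal_rawInt (z : ℤ) : ratVal (rawInt z) = z := by simp [ratVal, rawInt]

theorem ratVal_mk {z : ℤ} {d : ℕ} (hd : d ≠ 0) : ratVal (z, d) = z / d := by
  rw [ratVal, Nat.sub_add_cancel (Nat.pos_of_ne_zero hd)]

theorem ratVal_rawAdd (r s : ℤ × ℕ) : ratVal (rawAdd r s) = ratVal r + ratVal s := by
  have h : ∀ n : ℕ, (((n + 1 : ℕ) : ℕ) : ℚ) ≠ 0 := fun n => by positivity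
  rw [ratVal, ratVal, ratVal, div_add_div _ _ (h _) (h _), rawAdd]
  dsimp only
  rw [Nat.sub_add_cancel (Nat.mul_pos (Nat.succ_pos _) (Nat.succ_pos _))]
  congr 1
  · push_cast; ring
  · push_cast; ring

theorem ratVal_rawRatMul (r s : ℤ × ℕ) : ratVal (rawRatMul r s) = ratVal r * ratVal s := by
  rw [ratVal, ratVal, ratVal, div_mul_div_comm, rawRatMul]
  dsimp only
  rw [Nat.sub_add_cancel (Nat.mul_pos (Nat.succ_pos _) (Nat.succ_pos _))]
  push_cast
  rfl

theorem ratVal_rawAbs (r : ℤ × ℕ) : ratVal (rawAbs r) = |ratVal r| := by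
  rw [ratVal, ratVal, abs_div, rawAbs, Nat.abs_cast]
  simp

theorem ratVal_rawSum (n : ℕ) (f : ℕ → ℤ × ℕ) : ratVal (rawSum n f) = ∑ i : Fin n, ratVal (f i) := by
  rw [← sum_range_map (fun i => ratVal (f i)) n, rawSum]
  generalize List.range n = l
  induction l with
  | nil => simp [ratVal]
  | cons a l ih => rw [List.foldr_cons, ratVal_rawAdd, ih, List.map_cons, List.sum_cons]

theorem rawEq_iff (r s : ℤ × ℕ) : rawEq r s = true ↔ ratVal r = ratVal s := by
  have h : ∀ n : ℕ, (((n + 1 : ℕ) : ℕ) : ℚ) ≠ 0 := fun n => by positivity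
  rw [rawEq, beq_iff_eq, ratVal, ratVal, div_eq_div_iff (h _) (h _)]
  norm_cast

theorem rawLe_iff (r s : ℤ × ℕ) : rawLe r s = true ↔ ratVal r ≤ ratVal s := by
  have h : ∀ n : ℕ, (0 : ℚ) < ((n + 1 : ℕ) : ℕ) := fun n => by positivity
  rw [rawLe, beq_iff_eq, Int.toNat_eq_zero, ratVal, ratVal, div_le_div_iff₀ (h _) (h _),
    ← sub_eq_add_neg, sub_nonpos]
  norm_cast

theorem rawReduced_iff (r : ℤ × ℕ) : rawReduced r = true ↔ ratCode (ratVal r) = r := by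
  obtain ⟨z, d⟩ := r
  simp only [rawReduced, Bool.and_eq_true, bne_iff_ne, ne_eq, List.all_eq_true, List.mem_range,
    Bool.or_eq_true, decide_eq_true_eq]
  constructor
  · rintro ⟨hd, hall⟩
    have hcop : z.natAbs.Coprime d := by
      by_contra hne
      have h1 := Nat.gcd_dvd_left z.natAbs d
      have h2 := Nat.gcd_dvd_right z.natAbs d
      have hle := Nat.le_of_dvd (Nat.pos_of_ne_zero hd) h2
      have hpos : 0 < Nat.gcd z.natAbs d := Nat.gcd_pos_of_pos_right _ (Nat.pos_of_ne_zero hd)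
      rcases hall _ (Nat.lt_succ_of_le hle) with (h | h) | h
      · exact hne (by rw [Nat.Coprime]; omega)
      · exact h (Nat.mod_eq_zero_of_dvd h1)
      · exact h (Nat.mod_eq_zero_of_dvd h2)
    rw [ratVal_mk hd, ratCode]
    have hd' : (0 : ℤ) < d := by exact_mod_cast Nat.pos_of_ne_zero hd
    have h1 := Rat.num_div_eq_of_coprime hd' (a := z) hcop
    have h2 := Rat.den_div_eq_of_coprime hd' (a := z) hcop
    rw [Int.cast_natCast] at h1 h2
    rw [h1]
    exact Prod.ext rfl (by exact_mod_cast h2)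
  · intro h
    rw [ratCode, Prod.mk.injEq] at h
    have hcop := (ratVal (z, d)).reduced
    rw [h.1, h.2] at hcop
    refine ⟨h.2 ▸ (ratVal (z, d)).den_nz, fun e _ => ?_⟩
    by_contra! hcon
    obtain ⟨⟨h1, h2⟩, h3⟩ := hcon
    have := Nat.dvd_gcd (Nat.dvd_of_mod_eq_zero h2) (Nat.dvd_of_mod_eq_zero h3)
    rw [hcop, Nat.dvd_one] at this
    omega

theorem rawMatEq_iff {r c : ℕ} {f g : ℕ → ℕ → ℤ × ℕ} :
    rawMatEq r c f g = true ↔ toMat r c f = toMat r c g := by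
  simp only [rawMatEq, List.all_eq_true, List.mem_range, rawEq_iff]
  constructor
  · intro h
    ext i j
    exact h i i.2 j j.2
  · intro h i hi j hj
    exact congrFun (congrFun h ⟨i, hi⟩) ⟨j, hj⟩

theorem toMat_rawMatMul {r n c : ℕ} (f g : ℕ → ℕ → ℤ × ℕ) :
    toMat r c (rawMatMul n f g) = toMat r n f * toMat n c g := by
  ext i j
  rw [toMat_apply, rawMatMul, ratVal_rawSum, Matrix.mul_apply]
  exact Finset.sum_congr rfl fun a _ => ratVal_rawRatMul _ _

theorem toMat_add {r c : ℕ} (f g : ℕ → ℕ → ℤ × ℕ) :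
    toMat r c (fun i j => rawAdd (f i j) (g i j)) = toMat r c f + toMat r c g := by
  ext i j
  exact ratVal_rawAdd _ _

theorem toMat_smul {r c : ℕ} (a : ℤ × ℕ) (f : ℕ → ℕ → ℤ × ℕ) :
    toMat r c (fun i j => rawRatMul a (f i j)) = ratVal a • toMat r c f := by
  ext i j
  exact ratVal_rawRatMul _ _

theorem toMat_one {r : ℕ} : toMat r r rawOne = 1 := by
  ext i j
  rw [toMat_apply, rawOne, Matrix.one_apply]
  by_cases h : i = j
  · rw [if_pos (congrArg _ h), if_pos h]; simp [ratVal]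
  · rw [if_neg (fun h' => h (Fin.ext h')), if_neg h]; simp [ratVal]

theorem toMat_zero {r c : ℕ} : toMat r c (fun _ _ => (0, 1)) = 0 := by
  ext i j
  simp [toMat_apply, ratVal]

section Primrec

variable {α : Type*} [Primcodable α]

@[fun_prop] theorem primrec_rawAdd {f g : α → ℤ × ℕ} (hf : Primrec f) (hg : Primrec g) :
    Primrec fun a => rawAdd (f a) (g a) := by
  unfold rawAdd; fun_prop

@[fun_prop] theorem primrec_rawRatMul {f g : α → ℤ × ℕ} (hf : Primrec f) (hg : Primrec g) :
    Primrec fun a => rawRatMul (f a) (g a) := by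
  unfold rawRatMul; fun_prop

@[fun_prop] theorem primrec_rawAbs {f : α → ℤ × ℕ} (hf : Primrec f) :
    Primrec fun a => rawAbs (f a) := by
  unfold rawAbs; fun_prop

@[fun_prop] theorem primrec_rawInt {f : α → ℤ} (hf : Primrec f) :
    Primrec fun a => rawInt (f a) := by
  unfold rawInt; fun_prop

@[fun_prop] theorem primrec_rawEq {f g : α → ℤ × ℕ} (hf : Primrec f) (hg : Primrec g) :
    Primrec fun a => rawEq (f a) (g a) := by
  unfold rawEq; fun_prop

@[fun_prop] theorem primrec_rawLe {f g : α → ℤ × ℕ} (hf : Primrec f) (hg : Primrec g) :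
    Primrec fun a => rawLe (f a) (g a) := by
  unfold rawLe; fun_prop

@[fun_prop] theorem primrec_rawReduced {f : α → ℤ × ℕ} (hf : Primrec f) :
    Primrec fun a => rawReduced (f a) := by
  unfold rawReduced; fun_prop

@[fun_prop] theorem primrec_rawSum {n : α → ℕ} {f : α → ℕ → ℤ × ℕ} (hn : Primrec n)
    (hf : Primrec fun x : α × ℕ => f x.1 x.2) : Primrec fun a => rawSum (n a) (f a) := by
  unfold rawSum
  refine Primrec.listFoldr' (by fun_prop) (primrec_rawAdd ?_ (by fun_prop)) (by fun_prop)
  exact hf.comp (g := fun x : α × ℕ × ℤ × ℕ => (x.1, x.2.1)) (by fun_prop)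

@[fun_prop] theorem primrec_rawMatMul {n i j : α → ℕ} {f g : α → ℕ → ℕ → ℤ × ℕ} (hn : Primrec n)
    (hf : Primrec fun x : α × ℕ × ℕ => f x.1 x.2.1 x.2.2)
    (hg : Primrec fun x : α × ℕ × ℕ => g x.1 x.2.1 x.2.2) (hi : Primrec i) (hj : Primrec j) :
    Primrec fun a => rawMatMul (n a) (f a) (g a) (i a) (j a) := by
  unfold rawMatMul
  refine primrec_rawSum hn (primrec_rawRatMul ?_ ?_)
  · exact hf.comp (g := fun x : α × ℕ => (x.1, i x.1, x.2)) (by fun_prop)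
  · exact hg.comp (g := fun x : α × ℕ => (x.1, x.2, j x.1)) (by fun_prop)

@[fun_prop] theorem primrec_rawMatEq {r c : α → ℕ} {f g : α → ℕ → ℕ → ℤ × ℕ} (hr : Primrec r)
    (hc : Primrec c) (hf : Primrec fun x : α × ℕ × ℕ => f x.1 x.2.1 x.2.2)
    (hg : Primrec fun x : α × ℕ × ℕ => g x.1 x.2.1 x.2.2) :
    Primrec fun a => rawMatEq (r a) (c a) (f a) (g a) := by
  unfold rawMatEq
  refine Primrec.listAll' (by fun_prop) (Primrec.listAll' (by fun_prop) (primrec_rawEq ?_ ?_))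
  · exact hf.comp (g := fun x : (α × ℕ) × ℕ => (x.1.1, x.1.2, x.2)) (by fun_prop)
  · exact hg.comp (g := fun x : (α × ℕ) × ℕ => (x.1.1, x.1.2, x.2)) (by fun_prop)

@[fun_prop] theorem primrec_rawOne {i j : α → ℕ} (hi : Primrec i) (hj : Primrec j) :
    Primrec fun a => rawOne (i a) (j a) := by
  unfold rawOne; fun_prop

end Primrec

/-! ### Certificates -/

/-- An entry of a certificate. A certificate lists the entries of sequences of rational matrices, which
are numbered by `t`: the entry of the `n`-th matrix at `(i, j)` stands at the place that the pairing
function assigns to `(t, n, i, j)`. -/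
def ent (l : List (ℤ × ℕ)) (t n i j : ℕ) : ℤ × ℕ :=
  l.getD (Nat.pair t (Nat.pair n (Nat.pair i j))) (0, 1)

/-- A natural number in a certificate. -/
def par (l : List (ℤ × ℕ)) (i : ℕ) : ℕ := (ent l 0 0 0 i).1.toNat

/-- The entries of the update matrix. -/
def matEnt (c : InstanceCode) (i j : ℕ) : ℤ × ℕ := (c.2.2.1.getD i []).getD j (0, 1)

/-- The entries of the initial vector. -/
def initEnt (c : InstanceCode) (i : ℕ) (_ : ℕ) : ℤ × ℕ := c.2.1.getD i (0, 1)

/-- The number of targets. -/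
def numTargetsCode (c : InstanceCode) : ℕ := c.2.2.2.1.length

/-- The code of a target. -/
def targetCode (c : InstanceCode) (i : ℕ) : ℕ := c.2.2.2.1.getD i 0

/-- The initial state. -/
def startState (c : InstanceCode) : ℕ := c.2.2.2.2.2.1

/-- The transition table. -/
def nextState (c : InstanceCode) (q b : ℕ) : ℕ := (c.2.2.2.2.2.2.1.getD q []).getD b 0

/-- The dimension of the contracting summand. -/
def dimA (l : List (ℤ × ℕ)) : ℕ := par l 0

/-- The dimension of the eventually periodic summand. -/
def dimB (l : List (ℤ × ℕ)) : ℕ := par l 1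

/-- The period of the powers on the eventually periodic summand. -/
def period (l : List (ℤ × ℕ)) : ℕ := par l 2

/-- The preperiod of the powers on the eventually periodic summand. -/
def preperiod (l : List (ℤ × ℕ)) : ℕ := par l 3

/-- The exponent of a contracting power of `matA`. -/
def contrExp (l : List (ℤ × ℕ)) : ℕ := par l 4

/-- The common denominator of the offsets. -/
def commonDen (l : List (ℤ × ℕ)) : ℕ := par l 5

/-- The time at which the new trajectory starts. It is a multiple of the period, so that the phase
after `n` further steps is `n` modulo the period. -/
def startTime (l : List (ℤ × ℕ)) : ℕ := par l 2 * par l 6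

/-- The matrix on the contracting summand. -/
def matA (l : List (ℤ × ℕ)) (i j : ℕ) : ℤ × ℕ := ent l 1 0 i j

/-- The inverse of `matA`. -/
def matAinv (l : List (ℤ × ℕ)) (i j : ℕ) : ℤ × ℕ := ent l 2 0 i j

/-- The matrix on the eventually periodic summand. -/
def matB (l : List (ℤ × ℕ)) (i j : ℕ) : ℤ × ℕ := ent l 3 0 i j

/-- The embedding of the contracting summand, which has integral entries. -/
def embA (l : List (ℤ × ℕ)) (i j : ℕ) : ℤ := (ent l 4 0 i j).1

/-- The embedding of the eventually periodic summand. -/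
def embB (l : List (ℤ × ℕ)) (i j : ℕ) : ℤ × ℕ := ent l 5 0 i j

/-- The projection onto the contracting summand. -/
def projA (l : List (ℤ × ℕ)) (i j : ℕ) : ℤ × ℕ := ent l 6 0 i j

/-- The projection onto the eventually periodic summand. -/
def projB (l : List (ℤ × ℕ)) (i j : ℕ) : ℤ × ℕ := ent l 7 0 i j

/-- The powers of `matA`. -/
def powA (l : List (ℤ × ℕ)) (n i j : ℕ) : ℤ × ℕ := ent l 8 n i j

/-- The powers of `matB`. -/
def powB (l : List (ℤ × ℕ)) (n i j : ℕ) : ℤ × ℕ := ent l 9 n i j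

/-- The numerators of the coordinates of the given trajectory, up to the start time. -/
def orbNum (l : List (ℤ × ℕ)) (n i : ℕ) : ℤ := (ent l 10 n i 0).1

/-- A common denominator of the coordinates of a point of the given trajectory. -/
def orbDen (l : List (ℤ × ℕ)) (n : ℕ) : ℕ := (ent l 11 n 0 0).1.toNat

/-- The points of the given trajectory up to the start time, as columns. -/
def orbVec (l : List (ℤ × ℕ)) (n i _j : ℕ) : ℤ × ℕ := (orbNum l n i, orbDen l n)

/-- The offset of a phase: the periodic part of the trajectory, times the common denominator. -/
def offset (l : List (ℤ × ℕ)) (r i : ℕ) : ℤ := (ent l 12 r i 0).1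

/-- The initial vector of the new trajectory, as a column. -/
def initA (l : List (ℤ × ℕ)) (i _j : ℕ) : ℤ × ℕ := ent l 13 0 i 0

/-- The first points of the new trajectory, as columns. -/
def orbA (l : List (ℤ × ℕ)) (n i _j : ℕ) : ℤ × ℕ := ent l 14 n i 0

/-- The states of the given automaton up to the start time. -/
def runState (l : List (ℤ × ℕ)) (n : ℕ) : ℕ := (ent l 15 n 0 0).1.toNat

/-- The letters of the characteristic word up to the start time, as binary codes of sets. -/
def letter (l : List (ℤ × ℕ)) (n : ℕ) : ℕ := (ent l 16 n 0 0).1.toNat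

/-- The update matrix is the direct sum of `matA` and `matB`, with the given embeddings and
projections; `matA` is invertible, and the columns of its embedding have sum `0`. -/
def okDecomposition (c : InstanceCode) (l : List (ℤ × ℕ)) : Bool :=
  dimA l + dimB l == c.1 &&
  (rawMatEq c.1 (dimA l) (rawMatMul c.1 (matEnt c) fun i j => rawInt (embA l i j))
    (rawMatMul (dimA l) (fun i j => rawInt (embA l i j)) (matA l)) &&
  (rawMatEq c.1 (dimB l) (rawMatMul c.1 (matEnt c) (embB l)) (rawMatMul (dimB l) (embB l) (matB l)) &&
  (rawMatEq (dimA l) (dimA l) (rawMatMul c.1 (projA l) fun i j => rawInt (embA l i j)) rawOne &&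
  (rawMatEq (dimA l) (dimB l) (rawMatMul c.1 (projA l) (embB l)) (fun _ _ => (0, 1)) &&
  (rawMatEq (dimB l) (dimA l) (rawMatMul c.1 (projB l) fun i j => rawInt (embA l i j))
    (fun _ _ => (0, 1)) &&
  (rawMatEq (dimB l) (dimB l) (rawMatMul c.1 (projB l) (embB l)) rawOne &&
  (rawMatEq (dimA l) (dimA l) (rawMatMul (dimA l) (matAinv l) (matA l)) rawOne &&
  rawMatEq 1 (dimA l) (rawMatMul c.1 (fun _ _ => (1, 1)) fun i j => rawInt (embA l i j))
    (fun _ _ => (0, 1)))))))))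

/-- A power of `matA` is a contraction in the maximum norm, and the powers of `matB` are eventually
periodic. -/
def okPowers (l : List (ℤ × ℕ)) : Bool :=
  contrExp l != 0 && (period l != 0 &&
  (rawMatEq (dimA l) (dimA l) (powA l 0) rawOne &&
  (((List.range (contrExp l)).all fun n => rawMatEq (dimA l) (dimA l) (powA l (n + 1))
    (rawMatMul (dimA l) (matA l) (powA l n))) &&
  (((List.range (dimA l)).all fun i =>
    !rawLe (1, 1) (rawSum (dimA l) fun j => rawAbs (powA l (contrExp l) i j))) &&
  (rawMatEq (dimB l) (dimB l) (powB l 0) rawOne &&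
  (((List.range (preperiod l + period l)).all fun n => rawMatEq (dimB l) (dimB l) (powB l (n + 1))
    (rawMatMul (dimB l) (matB l) (powB l n))) &&
  rawMatEq (dimB l) (dimB l) (powB l (preperiod l + period l)) (powB l (preperiod l))))))))

/-- At the start time, the point of the trajectory is `(offset + embA * initA) / commonDen`, and the
update matrix permutes the offsets cyclically. -/
def okOrbit (c : InstanceCode) (l : List (ℤ × ℕ)) : Bool :=
  commonDen l != 0 &&
  (((List.range (startTime l + 1)).all fun n => orbDen l n != 0) &&
  (rawMatEq c.1 1 (orbVec l 0) (initEnt c) &&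
  (((List.range (startTime l)).all fun n => rawMatEq c.1 1
    (orbVec l (n + 1))
    (rawMatMul c.1 (matEnt c) (orbVec l n))) &&
  (rawMatEq c.1 1
    (fun i j => rawRatMul (rawInt (commonDen l)) (orbVec l (startTime l) i j))
    (fun i j => rawAdd (rawInt (offset l 0 i))
      (rawMatMul (dimA l) (fun i j => rawInt (embA l i j)) (initA l) i j)) &&
  (((List.range (period l)).all fun r => rawMatEq c.1 1 (fun i _ => rawInt (offset l (r + 1) i))
    (rawMatMul c.1 (matEnt c) fun i _ => rawInt (offset l r i))) &&
  rawMatEq c.1 1 (fun i _ => rawInt (offset l (period l) i))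
    (fun i _ => rawInt (offset l 0 i)))))))

/-- The first points of the new trajectory belong to the boxes of all targets. By contraction, this
holds for all points. -/
def okBox (c : InstanceCode) (l : List (ℤ × ℕ)) : Bool :=
  rawMatEq (dimA l) 1 (orbA l 0) (initA l) &&
  (((List.range (contrExp l)).all fun n => rawMatEq (dimA l) 1 (orbA l (n + 1))
    (rawMatMul (dimA l) (matA l) (orbA l n))) &&
  ((List.range (contrExp l)).all fun n =>
    (List.range (period l * numTargetsCode c)).all fun t => (List.range (dimA l)).all fun j =>
      !rawLe (1, 1) (rawRatMul (rawAbs (orbA l n j 0))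
        (rawInt (pullbackConst c.1 (dimA l) (offset l (t / numTargetsCode c)) (embA l) (commonDen l)
          (targetCode c (t % numTargetsCode c)) : ℕ)))))

/-- The states are those of the run of the automaton up to the start time. -/
def okRun (c : InstanceCode) (l : List (ℤ × ℕ)) : Bool :=
  runState l 0 == startState c &&
  (List.range (startTime l)).all fun n =>
    decide (letter l n < 2 ^ numTargetsCode c) &&
    (((List.range (numTargetsCode c)).all fun i =>
      (letter l n).testBit i == evalCode c.1 (orbNum l n) (orbDen l n) (targetCode c i)) &&
    runState l (n + 1) == nextState c (runState l n) (letter l n))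

/-- The fractions that occur in the new instance are reduced, as they are in the code of an instance. -/
def okReduced (l : List (ℤ × ℕ)) : Bool :=
  (List.range (dimA l)).all fun i => rawReduced (initA l i 0) &&
    (List.range (dimA l)).all fun j => rawReduced (matA l i j)

/-- Whether a list is a certificate for the reduction of a given instance. -/
def ok (c : InstanceCode) (l : List (ℤ × ℕ)) : Bool :=
  okDecomposition c l && (okPowers l && (okOrbit c l && (okBox c l && (okRun c l && okReduced l))))

/-- Whether the matrix is column-stochastic and the entries of the initial vector have sum `1`. -/
def isMarkovCode (c : InstanceCode) : Bool :=
  ((List.range c.1).all fun i => (List.range c.1).all fun j => rawLe (0, 1) (matEnt c i j)) &&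
  (rawMatEq 1 c.1 (rawMatMul c.1 (fun _ _ => (1, 1)) (matEnt c)) (fun _ _ => (1, 1)) &&
  rawMatEq 1 1 (rawMatMul c.1 (fun _ _ => (1, 1)) (initEnt c)) (fun _ _ => (1, 1)))

/-- The reduced instance given by a certificate. -/
def reduceBy (c : InstanceCode) (l : List (ℤ × ℕ)) : InstanceCode :=
  reducedCode c (dimA l) (period l) (commonDen l) (runState l (startTime l)) (fun i => initA l i 0)
    (matA l) (offset l) (embA l)

section Primrec

variable {α : Type*} [Primcodable α]

@[fun_prop] theorem primrec_ent {l : α → List (ℤ × ℕ)} {t n i j : α → ℕ} (hl : Primrec l)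
    (ht : Primrec t) (hn : Primrec n) (hi : Primrec i) (hj : Primrec j) :
    Primrec fun a => ent (l a) (t a) (n a) (i a) (j a) := by
  unfold ent; fun_prop

@[fun_prop] theorem primrec_matEnt {c : α → InstanceCode} {i j : α → ℕ} (hc : Primrec c)
    (hi : Primrec i) (hj : Primrec j) : Primrec fun a => matEnt (c a) (i a) (j a) := by
  unfold matEnt; fun_prop

@[fun_prop] theorem primrec_pullbackConst {m k δ n : α → ℕ} {w : α → ℕ → ℤ} {P : α → ℕ → ℕ → ℤ}
    (hm : Primrec m) (hk : Primrec k) (hw : Primrec fun x : α × ℕ => w x.1 x.2)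
    (hP : Primrec fun x : α × ℕ × ℕ => P x.1 x.2.1 x.2.2) (hδ : Primrec δ) (hn : Primrec n) :
    Primrec fun a => pullbackConst (m a) (k a) (w a) (P a) (δ a) (n a) := by
  unfold pullbackConst; fun_prop

@[fun_prop] theorem primrec_pullbackCode {m k δ n : α → ℕ} {w : α → ℕ → ℤ} {P : α → ℕ → ℕ → ℤ}
    (hm : Primrec m) (hk : Primrec k) (hw : Primrec fun x : α × ℕ => w x.1 x.2)
    (hP : Primrec fun x : α × ℕ × ℕ => P x.1 x.2.1 x.2.2) (hδ : Primrec δ) (hn : Primrec n) :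
    Primrec fun a => pullbackCode (m a) (k a) (w a) (P a) (δ a) (n a) := by
  unfold pullbackCode; fun_prop

end Primrec

end DistMC

namespace DistMC

/-! ### Verification of certificates is primitive recursive -/

section Primrec

variable {α : Type*} [Primcodable α] {l : α → List (ℤ × ℕ)} {c : α → InstanceCode} {n i j : α → ℕ}

@[fun_prop] theorem primrec_par (hl : Primrec l) (hi : Primrec i) :
    Primrec fun a => par (l a) (i a) := by
  unfold par; fun_prop

@[fun_prop] theorem primrec_initEnt (hc : Primrec c) (hi : Primrec i) (_hj : Primrec j) :
    Primrec fun a => initEnt (c a) (i a) (j a) := by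
  unfold initEnt; fun_prop

@[fun_prop] theorem primrec_numTargetsCode (hc : Primrec c) :
    Primrec fun a => numTargetsCode (c a) := by
  unfold numTargetsCode; fun_prop

@[fun_prop] theorem primrec_targetCode (hc : Primrec c) (hi : Primrec i) :
    Primrec fun a => targetCode (c a) (i a) := by
  unfold targetCode; fun_prop

@[fun_prop] theorem primrec_startState (hc : Primrec c) : Primrec fun a => startState (c a) := by
  unfold startState; fun_prop

@[fun_prop] theorem primrec_nextState (hc : Primrec c) (hi : Primrec i) (hj : Primrec j) :
    Primrec fun a => nextState (c a) (i a) (j a) := by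
  unfold nextState; fun_prop

@[fun_prop] theorem primrec_dimA (hl : Primrec l) : Primrec fun a => dimA (l a) := by
  unfold dimA; fun_prop

@[fun_prop] theorem primrec_dimB (hl : Primrec l) : Primrec fun a => dimB (l a) := by
  unfold dimB; fun_prop

@[fun_prop] theorem primrec_period (hl : Primrec l) : Primrec fun a => period (l a) := by
  unfold period; fun_prop

@[fun_prop] theorem primrec_preperiod (hl : Primrec l) : Primrec fun a => preperiod (l a) := by
  unfold preperiod; fun_prop

@[fun_prop] theorem primrec_contrExp (hl : Primrec l) : Primrec fun a => contrExp (l a) := by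
  unfold contrExp; fun_prop

@[fun_prop] theorem primrec_commonDen (hl : Primrec l) : Primrec fun a => commonDen (l a) := by
  unfold commonDen; fun_prop

@[fun_prop] theorem primrec_startTime (hl : Primrec l) : Primrec fun a => startTime (l a) := by
  unfold startTime; fun_prop

@[fun_prop] theorem primrec_matA (hl : Primrec l) (hi : Primrec i) (hj : Primrec j) :
    Primrec fun a => matA (l a) (i a) (j a) := by
  unfold matA; fun_prop

@[fun_prop] theorem primrec_matAinv (hl : Primrec l) (hi : Primrec i) (hj : Primrec j) :
    Primrec fun a => matAinv (l a) (i a) (j a) := by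
  unfold matAinv; fun_prop

@[fun_prop] theorem primrec_matB (hl : Primrec l) (hi : Primrec i) (hj : Primrec j) :
    Primrec fun a => matB (l a) (i a) (j a) := by
  unfold matB; fun_prop

@[fun_prop] theorem primrec_embA (hl : Primrec l) (hi : Primrec i) (hj : Primrec j) :
    Primrec fun a => embA (l a) (i a) (j a) := by
  unfold embA; fun_prop

@[fun_prop] theorem primrec_embB (hl : Primrec l) (hi : Primrec i) (hj : Primrec j) :
    Primrec fun a => embB (l a) (i a) (j a) := by
  unfold embB; fun_prop

@[fun_prop] theorem primrec_projA (hl : Primrec l) (hi : Primrec i) (hj : Primrec j) :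
    Primrec fun a => projA (l a) (i a) (j a) := by
  unfold projA; fun_prop

@[fun_prop] theorem primrec_projB (hl : Primrec l) (hi : Primrec i) (hj : Primrec j) :
    Primrec fun a => projB (l a) (i a) (j a) := by
  unfold projB; fun_prop

@[fun_prop] theorem primrec_orbNum (hl : Primrec l) (hi : Primrec i) (hj : Primrec j) :
    Primrec fun a => orbNum (l a) (i a) (j a) := by
  unfold orbNum; fun_prop

@[fun_prop] theorem primrec_orbVec (hl : Primrec l) (hn : Primrec n) (hi : Primrec i)
    (_hj : Primrec j) : Primrec fun a => orbVec (l a) (n a) (i a) (j a) := by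
  have h1 : Primrec fun a => orbNum (l a) (n a) (i a) := by fun_prop
  have h2 : Primrec fun a => orbDen (l a) (n a) := by unfold orbDen; fun_prop
  exact Primrec.pair h1 h2

@[fun_prop] theorem primrec_offset (hl : Primrec l) (hi : Primrec i) (hj : Primrec j) :
    Primrec fun a => offset (l a) (i a) (j a) := by
  unfold offset; fun_prop

@[fun_prop] theorem primrec_initA (hl : Primrec l) (hi : Primrec i) (_hj : Primrec j) :
    Primrec fun a => initA (l a) (i a) (j a) := by
  unfold initA; fun_prop

@[fun_prop] theorem primrec_powA (hl : Primrec l) (hn : Primrec n) (hi : Primrec i) (hj : Primrec j) :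
    Primrec fun a => powA (l a) (n a) (i a) (j a) := by
  unfold powA; fun_prop

@[fun_prop] theorem primrec_powB (hl : Primrec l) (hn : Primrec n) (hi : Primrec i) (hj : Primrec j) :
    Primrec fun a => powB (l a) (n a) (i a) (j a) := by
  unfold powB; fun_prop

@[fun_prop] theorem primrec_orbA (hl : Primrec l) (hn : Primrec n) (hi : Primrec i) (_hj : Primrec j) :
    Primrec fun a => orbA (l a) (n a) (i a) (j a) := by
  unfold orbA; fun_prop

@[fun_prop] theorem primrec_orbDen (hl : Primrec l) (hi : Primrec i) :
    Primrec fun a => orbDen (l a) (i a) := by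
  unfold orbDen; fun_prop

@[fun_prop] theorem primrec_runState (hl : Primrec l) (hi : Primrec i) :
    Primrec fun a => runState (l a) (i a) := by
  unfold runState; fun_prop

@[fun_prop] theorem primrec_letter (hl : Primrec l) (hi : Primrec i) :
    Primrec fun a => letter (l a) (i a) := by
  unfold letter; fun_prop

@[fun_prop] theorem primrec_okDecomposition (hc : Primrec c) (hl : Primrec l) :
    Primrec fun a => okDecomposition (c a) (l a) := by
  unfold okDecomposition
  fun_prop

@[fun_prop] theorem primrec_okPowers (hl : Primrec l) : Primrec fun a => okPowers (l a) := by
  unfold okPowers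
  fun_prop

@[fun_prop] theorem primrec_okOrbit (hc : Primrec c) (hl : Primrec l) :
    Primrec fun a => okOrbit (c a) (l a) := by
  unfold okOrbit
  fun_prop

@[fun_prop] theorem primrec_okBox (hc : Primrec c) (hl : Primrec l) :
    Primrec fun a => okBox (c a) (l a) := by
  unfold okBox
  fun_prop

@[fun_prop] theorem primrec_okRun (hc : Primrec c) (hl : Primrec l) :
    Primrec fun a => okRun (c a) (l a) := by
  unfold okRun
  fun_prop

@[fun_prop] theorem primrec_okReduced (hl : Primrec l) : Primrec fun a => okReduced (l a) := by
  unfold okReduced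
  fun_prop

@[fun_prop] theorem primrec_ok (hc : Primrec c) (hl : Primrec l) :
    Primrec fun a => ok (c a) (l a) := by
  unfold ok
  fun_prop

@[fun_prop] theorem primrec_isMarkovCode (hc : Primrec c) : Primrec fun a => isMarkovCode (c a) := by
  unfold isMarkovCode
  fun_prop

@[fun_prop] theorem primrec_projectsTo {m L b b' : α → ℕ} (hm : Primrec m) (hL : Primrec L)
    (hb : Primrec b) (hb' : Primrec b') :
    Primrec fun a => projectsTo (m a) (L a) (b a) (b' a) := by
  unfold projectsTo; fun_prop

@[fun_prop] theorem primrec_phasedCode {h L q : α → ℕ} {b : α → AutomatonCode} (hh : Primrec h)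
    (hL : Primrec L) (hq : Primrec q) (hb : Primrec b) :
    Primrec fun a => phasedCode (h a) (L a) (q a) (b a) := by
  have h1 : Primrec fun a => (b a).1 := hb.fst'
  have h2 : Primrec fun a => (b a).2.2.1 := hb.snd'.snd'.fst'
  have h3 : Primrec fun a => (b a).2.2.2 := hb.snd'.snd'.snd'
  unfold phasedCode
  generalize hn : (fun a => (b a).1) = n at h1
  generalize ht : (fun a => (b a).2.2.1) = t at h2
  generalize hu : (fun a => (b a).2.2.2) = u at h3
  simp only [funext_iff] at hn ht hu
  simp only [hn, ht, hu]
  refine Primrec.pair' (by fun_prop) (Primrec.pair' hq (Primrec.pair' (by fun_prop) ?_))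
  fun_prop

@[fun_prop] theorem primrec_reduceBy (hc : Primrec c) (hl : Primrec l) :
    Primrec fun a => reduceBy (c a) (l a) := by
  unfold reduceBy reducedCode
  refine Primrec.pair' (by fun_prop) (Primrec.pair' (by fun_prop) (Primrec.pair' (by fun_prop)
    (Primrec.pair' ?_ ?_)))
  · change Primrec fun a => (List.range (period (l a) * numTargetsCode (c a))).map fun t =>
      pullbackCode (c a).1 (dimA (l a)) (offset (l a) (t / numTargetsCode (c a))) (embA (l a))
        (commonDen (l a)) (targetCode (c a) (t % numTargetsCode (c a)))
    fun_prop
  · change Primrec fun a => phasedCode (numTargetsCode (c a)) _ _ _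
    exact primrec_phasedCode (by fun_prop) (by fun_prop) (by fun_prop) hc.snd'.snd'.snd'.snd'

end Primrec

end DistMC

namespace DistMC

open Matrix

/-! ### Certificates yield reductions -/

theorem toMat_matEnt (I : Instance) : toMat I.dim I.dim (matEnt I.code) = I.mat := by
  ext i j
  rw [toMat_apply, matEnt, Instance.code]
  dsimp only
  rw [getD_ofFn _ _ _ i.2, getD_ofFn _ _ _ j.2, ratVal_ratCode]

theorem toMat_initEnt (I : Instance) (i : Fin I.dim) (j : Fin 1) :
    toMat I.dim 1 (initEnt I.code) i j = I.init i := by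
  rw [toMat_apply, initEnt, Instance.code]
  dsimp only
  rw [getD_ofFn _ _ _ i.2, ratVal_ratCode]

theorem targetCode_code (I : Instance) (i : Fin I.numTargets) :
    targetCode I.code i = (I.target i).code := by
  rw [targetCode, Instance.code]
  dsimp only
  rw [getD_ofFn _ _ _ i.2]

theorem numTargetsCode_code (I : Instance) : numTargetsCode I.code = I.numTargets := by
  simp [numTargetsCode, Instance.code]

theorem rawLe_eq_false_iff {r s : ℤ × ℕ} : (!rawLe r s) = true ↔ ratVal s < ratVal r := by
  rw [Bool.not_eq_true', ← Bool.not_eq_true, rawLe_iff, not_le]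

theorem ratVal_one : ratVal (1, 1) = 1 := by simp [ratVal]

theorem eq_pow_mul_of_step {k c N : ℕ} {A : Matrix (Fin k) (Fin k) ℚ} {f : ℕ → Matrix (Fin k) (Fin c) ℚ}
    (h : ∀ n < N, f (n + 1) = A * f n) {n : ℕ} (hn : n ≤ N) : f n = A ^ n * f 0 := by
  induction n with
  | zero => rw [pow_zero, Matrix.one_mul]
  | succ n ih => rw [h n (by omega), ih (by omega), pow_succ', Matrix.mul_assoc]

/-- If `A ^ p` is a contraction in the maximum norm, a bound for the first `p` points of the
trajectory holds for all points. -/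
theorem bound_of_contraction {k p : ℕ} {A : Matrix (Fin k) (Fin k) ℚ} (hp : p ≠ 0)
    (hA : ∀ i, ∑ j, |(A ^ p) i j| < 1) {v : Fin k → ℚ} {q : ℚ} (hq : 0 ≤ q)
    (h : ∀ n < p, ∀ j, |((A ^ n) *ᵥ v) j| * q < 1) (n : ℕ) (j : Fin k) :
    |((A ^ n) *ᵥ v) j| * q < 1 := by
  induction n using Nat.strong_induction_on generalizing j with
  | _ n ih =>
    by_cases hn : n < p
    · exact h n hn j
    obtain ⟨n', rfl⟩ := Nat.exists_eq_add_of_le (not_lt.1 hn)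
    rw [pow_add, ← Matrix.mulVec_mulVec]
    calc |∑ i, (A ^ p) j i * ((A ^ n') *ᵥ v) i| * q
        ≤ (∑ i, |(A ^ p) j i| * |((A ^ n') *ᵥ v) i|) * q := by
          refine mul_le_mul_of_nonneg_right ?_ hq
          refine (Finset.abs_sum_le_sum_abs _ _).trans (le_of_eq ?_)
          exact Finset.sum_congr rfl fun i _ => abs_mul _ _
      _ = ∑ i, |(A ^ p) j i| * (|((A ^ n') *ᵥ v) i| * q) := by
          rw [Finset.sum_mul]
          exact Finset.sum_congr rfl fun i _ => mul_assoc _ _ _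
      _ ≤ ∑ i, |(A ^ p) j i| * 1 :=
          Finset.sum_le_sum fun i _ => mul_le_mul_of_nonneg_left
            (ih n' (by omega) i).le (abs_nonneg _)
      _ < 1 := by simpa using hA j

/-- A certificate gives a reduced instance with the same answer; in particular, the dimension is the
dynamical dimension, whatever certificate is found. -/
theorem exists_reduceBy (I : Instance) (hI : I.IsMarkovChain) {l : List (ℤ × ℕ)}
    (hok : ok I.code l = true) :
    ∃ J : Instance, reduceBy I.code l = J.code ∧ J.dim = dynamicalDim I.mat ∧ IsUnit J.mat ∧
      (∀ j, ∃ i, intrinsicDim (J.target j).toSet ≤ intrinsicDim (I.target i).toSet ∧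
        linearDim (J.target j).toSet ≤ linearDim (I.target i).toSet - 1) ∧
      (I.Holds ↔ J.Holds) := by
  have hc1 : I.code.1 = I.dim := rfl
  simp only [ok, okDecomposition, okPowers, okOrbit, okBox, okRun, okReduced, Bool.and_eq_true,
    rawMatEq_iff, toMat_rawMatMul, toMat_add, toMat_smul, toMat_one, toMat_zero, toMat_matEnt,
    List.all_eq_true, List.mem_range, bne_iff_ne, beq_iff_eq, rawReduced_iff, decide_eq_true_iff,
    rawLe_eq_false_iff, ratVal_one, ratVal_rawSum, ratVal_rawAbs, ratVal_rawRatMul, ratVal_rawInt, hc1,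
    numTargetsCode_code] at hok
  obtain ⟨⟨hkl, hMP, hMS, hQP, hQS, hRP, hRS, hA', hPsum⟩,
    ⟨hp, hL, hA0, hAs, hAp, hB0, hBs, hBper⟩, ⟨hδ, hd, hU0, hUs, hUw, hws, hwL⟩,
    ⟨hZ0, hZs, hbox⟩, ⟨hq0, hrun⟩, hred⟩ := hok
  set k := dimA l
  set m := I.dim
  set L := period l
  set δ := commonDen l
  set s₀ := startTime l with hs₀
  set M := I.mat
  set A := toMat k k (matA l) with hA
  set P := toMat m k fun i j => rawInt (embA l i j) with hP
  set V := toMat k 1 (initA l) with hV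
  set W : ℕ → Matrix (Fin m) (Fin 1) ℚ := fun r => toMat m 1 fun i _ => rawInt (offset l r i) with hW
  set U : ℕ → Matrix (Fin m) (Fin 1) ℚ := fun n => toMat m 1 (orbVec l n) with hU
  have hPij : ∀ i j, P i j = (embA l i j : ℚ) := fun i j => ratVal_rawInt _
  have hWi : ∀ r i j, W r i j = (offset l r i : ℚ) := fun r i j => ratVal_rawInt _
  have hMc : M ∈ colStochastic ℚ (Fin m) := hI.2
  have hpowA : ∀ n ≤ contrExp l, toMat k k (powA l n) = A ^ n := fun n hn => by
    rw [eq_pow_mul_of_step (f := fun n => toMat k k (powA l n)) hAs hn, hA0, Matrix.mul_one]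
  have hpowB : ∀ n ≤ preperiod l + L, toMat (dimB l) (dimB l) (powB l n) =
      toMat (dimB l) (dimB l) (matB l) ^ n := fun n hn => by
    rw [eq_pow_mul_of_step (f := fun n => toMat (dimB l) (dimB l) (powB l n)) hBs hn, hB0,
      Matrix.mul_one]
  have hAp' : ∀ i, ∑ j, |(A ^ contrExp l) i j| < 1 := by
    intro i
    rw [← hpowA _ le_rfl]
    exact hAp i i.2
  rw [hpowB _ le_rfl, hpowB _ (Nat.le_add_right _ _)] at hBper
  have hdim : dynamicalDim M = k := by
    refine dynamicalDim_eq hkl (S := fromCols P (toMat m (dimB l) (embB l)))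
      (T := fromRows (toMat k m (projA l)) (toMat (dimB l) m (projB l))) ?_ ?_ hA' hAp'
      (Nat.one_le_iff_ne_zero.2 hL) hBper
    · rw [fromRows_mul_fromCols, hQP, hQS, hRP, hRS, fromBlocks_one]
    · rw [mul_fromCols, fromCols_mul_fromBlocks, hMP, hMS]
      simp only [Matrix.mul_zero, add_zero, zero_add]
      rfl
  have hPcol : ∀ j : Fin k, ∑ i : Fin m, P i j = 0 := by
    intro j
    have := congrFun (congrFun hPsum 0) j
    rw [Matrix.mul_apply] at this
    simpa [toMat_apply, ratVal_one] using this
  have hMW : ∀ r ≤ L, W r = M ^ r * W 0 := fun r hr => eq_pow_mul_of_step hws hr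
  have hUn : ∀ n ≤ s₀, U n = M ^ n * U 0 := fun n hn => eq_pow_mul_of_step hUs hn
  have hU0i : ∀ i j, U 0 i j = I.init i := fun i j => by
    rw [← toMat_initEnt I i j]; exact congrFun (congrFun hU0 i) j
  have hMP' : ∀ n, M ^ n * P = P * A ^ n := by
    intro n
    induction n with
    | zero => simp
    | succ n ih =>
      rw [pow_succ, Matrix.mul_assoc, hMP, ← Matrix.mul_assoc, ih, Matrix.mul_assoc, ← pow_succ]
  have hWmod : ∀ n, M ^ n * W 0 = W (n % L) := by
    have hper : ∀ n, M ^ (n * L) * W 0 = W 0 := by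
      intro n
      induction n with
      | zero => simp
      | succ n ih =>
        rw [Nat.succ_mul, pow_add, Matrix.mul_assoc, ← hMW L le_rfl]
        exact (congrArg (M ^ (n * L) * ·) hwL).trans ih
    intro n
    conv_lhs => rw [← Nat.mod_add_div n L, pow_add, Matrix.mul_assoc, mul_comm L, hper]
    exact (hMW _ (Nat.mod_lt _ (Nat.pos_of_ne_zero hL)).le).symm
  have hinit : ∀ n i, (M ^ n *ᵥ I.init) i = (M ^ n * U 0) i 0 := by
    intro n i
    rw [Matrix.mul_apply]
    simp only [hU0i]
    rfl
  have horb : ∀ n, (δ : ℚ) • (M ^ (s₀ + n) * U 0) = W (n % L) + P * (A ^ n * V) := by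
    intro n
    rw [add_comm s₀, pow_add, Matrix.mul_assoc, ← hUn s₀ le_rfl, ← Matrix.mul_smul]
    have h1 : (δ : ℚ) • U s₀ = W 0 + P * V := by
      rw [← Int.cast_natCast (R := ℚ) δ]
      exact hUw
    rw [h1, Matrix.mul_add, hWmod, ← Matrix.mul_assoc, hMP', Matrix.mul_assoc]
  -- The offsets keep the coordinate sum of the distributions, up to the factor `δ`.
  have hsumW : ∀ r < L, ∑ i : Fin m, offset l r i ≠ 0 := by
    intro r hr h0
    have h1 : ∑ i, (W r) i 0 = 0 := by
      simp only [hWi]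
      exact_mod_cast h0
    have h2 := horb r
    rw [Nat.mod_eq_of_lt hr] at h2
    have h3 : ∀ i, (δ : ℚ) * (M ^ (s₀ + r) *ᵥ I.init) i = W r i 0 + ∑ j, P i j * (A ^ r * V) j 0 := by
      intro i
      rw [hinit, ← Matrix.mul_apply, ← Matrix.add_apply, ← h2]
      rfl
    have h4 : (δ : ℚ) * ∑ i, (M ^ (s₀ + r) *ᵥ I.init) i = 0 := by
      rw [Finset.mul_sum]
      simp only [h3]
      rw [Finset.sum_add_distrib, h1, zero_add, Finset.sum_comm]
      refine Finset.sum_eq_zero fun j _ => ?_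
      rw [← Finset.sum_mul, hPcol, zero_mul]
    rw [sum_mulVec_of_colStochastic (pow_mem hMc _), hI.1.2, mul_one] at h4
    exact hδ (by exact_mod_cast h4)
  set v : Fin k → ℚ := fun i => V i 0 with hv
  have hAv : ∀ n j, (A ^ n *ᵥ v) j = (A ^ n * V) j 0 := fun n j => rfl
  have hZn : ∀ n ≤ contrExp l, toMat k 1 (orbA l n) = A ^ n * V := fun n hn => by
    rw [eq_pow_mul_of_step (f := fun n => toMat k 1 (orbA l n)) hZs hn, hZ0]
  have horbit : ∀ n ≤ s₀, I.orbit n = fun i : Fin m => (orbNum l n i : ℝ) / orbDen l n := by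
    intro n hn
    funext i
    have h1 : (M ^ n *ᵥ I.init) i = (orbNum l n i : ℚ) / orbDen l n := by
      rw [hinit, ← hUn n hn]
      exact ratVal_mk (hd n (by omega))
    rw [Instance.orbit, h1]
    push_cast
    rfl
  have hruns : ∀ n ≤ s₀, (I.automaton.run I.charWord n : ℕ) = runState l n := by
    intro n
    induction n with
    | zero => exact fun _ => hq0.symm
    | succ n ih =>
      intro hn
      obtain ⟨h1, h2, h3⟩ := hrun n (by omega)
      have hlet : I.charWord n = subsetOfBits I.numTargets (letter l n) := by
        ext i
        rw [Instance.mem_charWord, horbit n (by omega),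
          ← evalCode_iff (Nat.pos_of_ne_zero (hd n (by omega))), ← targetCode_code, ← h2 i i.2,
          subsetOfBits, Finset.mem_filter, and_iff_right (Finset.mem_univ _)]
      rw [h3, ← ih (by omega), MullerAutomaton.run, hlet]
      exact (I.automaton.getD_code_step _ h1).symm
  have hlen : I.code.2.2.2.1.length = I.numTargets := numTargetsCode_code I
  have hboxes : ∀ n, ∀ t < L * I.numTargets, ∀ j, |(A ^ n *ᵥ v) j| *
      ((pullbackConst m k (offset l (t / I.numTargets)) (embA l) δ
        (targetCode I.code (t % I.numTargets)) : ℕ) : ℚ) < 1 := by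
    intro n t ht j
    refine bound_of_contraction hp hAp' (Nat.cast_nonneg _) (fun n hn j => ?_) n j
    have h1 := hbox n hn t ht j j.2
    rw [hAv, ← hZn n hn.le]
    exact_mod_cast h1
  have hQ : ∀ j i : Fin k, ∑ a, toMat k m (projA l) j a * (embA l a i : ℚ) = if j = i then 1 else 0 := by
    intro j i
    have := congrFun (congrFun hQP j) i
    rw [Matrix.mul_apply, Matrix.one_apply] at this
    simpa only [hPij] using this
  have hPz : ∀ j : Fin k, ∑ i : Fin m, embA l i j = 0 := by
    intro j
    have := hPcol j
    simp only [hPij] at this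
    exact_mod_cast this
  have horbv : ∀ n (i : Fin m), (δ : ℚ) * (M ^ (s₀ + n) *ᵥ I.init) i =
      offset l (n % L) i + ∑ j : Fin k, (embA l i j : ℚ) * (A ^ n *ᵥ v) j := by
    intro n i
    have h1 := congrFun (congrFun (horb n) i) 0
    rw [Matrix.smul_apply, smul_eq_mul, ← hinit, Matrix.add_apply, hWi, Matrix.mul_apply] at h1
    simp only [hPij] at h1
    exact h1
  rw [← hlen] at hboxes
  obtain ⟨J, hJ1, hJ2, hJ⟩ := exists_reduced I (Nat.pos_of_ne_zero hL) (Nat.pos_of_ne_zero hδ)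
    (cv := fun i => initA l i 0) (cA := matA l) (fun i => (hred i i.2).1)
    (fun i j => (hred i i.2).2 j j.2) hA' hQ hPz hsumW horbv hboxes (hruns s₀ le_rfl)
  exact ⟨J, hJ1, hJ2.trans hdim.symm, hJ⟩

end DistMC

namespace DistMC

open Matrix

/-! ### Existence of certificates -/

/-- The extension of a matrix by zero. -/
def extend {r c : ℕ} (X : Matrix (Fin r) (Fin c) ℚ) (i j : ℕ) : ℚ :=
  if h : i < r ∧ j < c then X ⟨i, h.1⟩ ⟨j, h.2⟩ else 0

theorem extend_apply {r c : ℕ} (X : Matrix (Fin r) (Fin c) ℚ) (i : Fin r) (j : Fin c) :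
    extend X i j = X i j := by
  rw [extend, dif_pos ⟨i.2, j.2⟩]

theorem extend_of_le_left {r c : ℕ} (X : Matrix (Fin r) (Fin c) ℚ) {i : ℕ} (j : ℕ) (h : r ≤ i) :
    extend X i j = 0 := by
  rw [extend, dif_neg (by omega)]

theorem toMat_eq_of_extend {r c : ℕ} {Y : Matrix (Fin r) (Fin c) ℚ} {f : ℕ → ℕ → ℤ × ℕ}
    (h : ∀ i < r, ∀ j < c, f i j = ratCode (extend Y i j)) : toMat r c f = Y := by
  ext i j
  rw [toMat_apply, h i i.2 j j.2, ratVal_ratCode, extend_apply]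

/-- Every finite collection of rational numbers is that of the entries of a list; the entries
outside the range are zero. -/
theorem exists_list_of_entries (F : ℕ → ℕ → ℕ → ℕ → ℚ) (N : ℕ) :
    ∃ l : List (ℤ × ℕ), ∀ t n i j, ent l t n i j =
      ratCode (if t ≤ N ∧ n ≤ N ∧ i ≤ N ∧ j ≤ N then F t n i j else 0) := by
  have hp : ∀ {B a b : ℕ}, a ≤ B → b ≤ B → Nat.pair a b ≤ (B + 1) ^ 2 := fun {B a b} ha hb =>
    (Nat.pair_lt_max_add_one_sq a b).le.trans (Nat.pow_le_pow_left (by omega) 2)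
  have hle : ∀ B : ℕ, B ≤ (B + 1) ^ 2 := fun B => by nlinarith
  set G : ℕ → ℕ → ℕ → ℕ → ℚ :=
    fun t n i j => if t ≤ N ∧ n ≤ N ∧ i ≤ N ∧ j ≤ N then F t n i j else 0 with hG
  obtain ⟨g, hg⟩ : ∃ g : ℕ → ℤ × ℕ, ∀ t n i j,
      g (Nat.pair t (Nat.pair n (Nat.pair i j))) = ratCode (G t n i j) :=
    ⟨fun x => ratCode (G x.unpair.1 x.unpair.2.unpair.1 x.unpair.2.unpair.2.unpair.1
      x.unpair.2.unpair.2.unpair.2), fun t n i j => by simp only [Nat.unpair_pair]⟩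
  set B₁ := (N + 1) ^ 2
  set B₂ := (B₁ + 1) ^ 2
  set B₃ := (B₂ + 1) ^ 2
  refine ⟨(List.range (B₃ + 1)).map g, fun t n i j => ?_⟩
  by_cases h : Nat.pair t (Nat.pair n (Nat.pair i j)) ≤ B₃
  · rw [ent, getD_range_map _ _ _ _ (Nat.lt_succ_of_le h), hg]
  · have hnot : ¬ (t ≤ N ∧ n ≤ N ∧ i ≤ N ∧ j ≤ N) := by
      rintro ⟨ht, hn, hi, hj⟩
      have h1 : N ≤ B₁ := hle N
      have h4 : Nat.pair n (Nat.pair i j) ≤ B₂ := hp (hn.trans h1) (hp hi hj)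
      exact h (hp (ht.trans (h1.trans (hle B₁))) h4)
    rw [if_neg hnot, ent, List.getD_eq_default _ _ (by simp; omega)]
    rfl

theorem ratCode_natCast (n : ℕ) : (ratCode (n : ℚ)).1.toNat = n := by simp [ratCode]

theorem isMarkovCode_iff (c : InstanceCode) : isMarkovCode c = true ↔
    toMat c.1 c.1 (matEnt c) ∈ colStochastic ℚ (Fin c.1) ∧
      ∑ i, toMat c.1 1 (initEnt c) i 0 = 1 := by
  simp only [isMarkovCode, Bool.and_eq_true, rawMatEq_iff, toMat_rawMatMul, List.all_eq_true,
    List.mem_range, rawLe_iff]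
  have h0 : ratVal (0, 1) = 0 := by simp [ratVal]
  have hrow : ∀ (n : ℕ) (X : Matrix (Fin c.1) (Fin n) ℚ),
      (toMat 1 c.1 fun _ _ => (1, 1)) * X = (toMat 1 n fun _ _ => (1, 1)) ↔
        ∀ j, ∑ i, X i j = 1 := by
    intro n X
    rw [← Matrix.ext_iff]
    simp only [Matrix.mul_apply, toMat_apply, ratVal_one, one_mul]
    exact ⟨fun h j => h 0 j, fun h _ j => h j⟩
  rw [hrow, hrow, h0, ← and_assoc]
  refine and_congr (and_congr ?_ ?_) ?_
  · exact ⟨fun h i j => h i i.2 j j.2, fun h i hi j hj => h ⟨i, hi⟩ ⟨j, hj⟩⟩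
  · rw [funext_iff]
    simp only [vecMul, dotProduct, Pi.one_apply, one_mul]
  · exact ⟨fun h => h 0, fun h j => by rwa [Subsingleton.elim j 0]⟩

theorem isMarkovCode_code {I : Instance} (hI : I.IsMarkovChain) : isMarkovCode I.code = true := by
  refine (isMarkovCode_iff _).2 ⟨?_, ?_⟩
  · have := toMat_matEnt I
    exact this ▸ hI.2
  · have : ∀ i, toMat I.dim 1 (initEnt I.code) i 0 = I.init i := fun i => toMat_initEnt I i 0
    exact (Finset.sum_congr rfl fun i _ => this i).trans hI.1.2

/-- Every stochastic matrix has a certificate. -/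
theorem exists_cert {c : InstanceCode} (hc : isMarkovCode c = true) : ∃ l, ok c l = true := by
  obtain ⟨hM, -⟩ := (isMarkovCode_iff c).1 hc
  set m := c.1 with hm
  set M := toMat m m (matEnt c) with hMdef
  set μ := toMat m 1 (initEnt c) with hμ
  obtain ⟨k, l', hkl, S, T, A, A', B, s, L, hTS, hMS, hA', hPsum, hL, hBper, hsmall⟩ :=
    exists_decomposition_of_colStochastic hM
  have hST : S * T = 1 :=
    (Matrix.mul_eq_one_comm_of_card_eq _ _ _ (by simp [hkl])).1 hTS
  obtain ⟨P', S₂, rfl⟩ : ∃ P' S₂, S = fromCols P' S₂ := ⟨_, _, (fromCols_toCols S).symm⟩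
  obtain ⟨Q', R, rfl⟩ : ∃ Q' R, T = fromRows Q' R := ⟨_, _, (fromRows_toRows T).symm⟩
  rw [fromRows_mul_fromCols, ← fromBlocks_one, fromBlocks_inj] at hTS
  obtain ⟨hQP', hQS', hRP', hRS⟩ := hTS
  rw [mul_fromCols, fromCols_mul_fromBlocks] at hMS
  simp only [Matrix.mul_zero, add_zero, zero_add] at hMS
  obtain ⟨hMP', hMS₂⟩ := fromCols_inj hMS
  rw [fromCols_mul_fromRows] at hST
  simp only [fromCols_apply_inl] at hPsum
  -- The embedding in a certificate is integral; scaling the projection inversely keeps `Q * P = 1`.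
  obtain ⟨d, hd, g, hg⟩ := exists_common_denominator fun x : Fin m × Fin k => P' x.1 x.2
  have hd' : (d : ℚ) ≠ 0 := by positivity
  set P : Matrix (Fin m) (Fin k) ℚ := (d : ℚ) • P' with hP
  set Q : Matrix (Fin k) (Fin m) ℚ := (d : ℚ)⁻¹ • Q' with hQ
  have hPint : ∀ i j, ∃ z : ℤ, P i j = z := fun i j => ⟨g (i, j), by
    rw [hP, Matrix.smul_apply, hg (i, j), smul_eq_mul, mul_div_cancel₀ _ hd']⟩
  have hQP : Q * P = 1 := by
    rw [hP, hQ, Matrix.smul_mul, Matrix.mul_smul, smul_smul, inv_mul_cancel₀ hd', one_smul, hQP']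
  have hQS : Q * S₂ = 0 := by rw [hQ, Matrix.smul_mul, hQS', smul_zero]
  have hRP : R * P = 0 := by rw [hP, Matrix.mul_smul, hRP', smul_zero]
  have hMP : M * P = P * A := by rw [hP, Matrix.mul_smul, hMP', Matrix.smul_mul]
  have hPQ : P * Q + S₂ * R = 1 := by
    rw [hP, hQ, Matrix.smul_mul, Matrix.mul_smul, smul_smul, mul_inv_cancel₀ hd', one_smul, hST]
  have hPcol : ∀ j, ∑ i, P i j = 0 := fun j => by
    simp only [hP, Matrix.smul_apply, ← Finset.smul_sum, hPsum, smul_zero]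
  -- The trajectory is the sum of a contracting and of an eventually periodic part.
  set y := Q * μ with hy
  set z := R * μ with hz
  have hMPn : ∀ n, M ^ n * P = P * A ^ n := by
    intro n
    induction n with
    | zero => simp
    | succ n ih =>
      rw [pow_succ, Matrix.mul_assoc, hMP, ← Matrix.mul_assoc, ih, Matrix.mul_assoc, ← pow_succ]
  have hMSn : ∀ n, M ^ n * S₂ = S₂ * B ^ n := by
    intro n
    induction n with
    | zero => simp
    | succ n ih =>
      rw [pow_succ, Matrix.mul_assoc, hMS₂, ← Matrix.mul_assoc, ih, Matrix.mul_assoc, ← pow_succ]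
  have htraj : ∀ n, M ^ n * μ = P * (A ^ n * y) + S₂ * (B ^ n * z) := by
    intro n
    have h1 : μ = P * y + S₂ * z := by
      rw [hy, hz, ← Matrix.mul_assoc, ← Matrix.mul_assoc, ← Matrix.add_mul, hPQ, Matrix.one_mul]
    conv_lhs => rw [h1, Matrix.mul_add, ← Matrix.mul_assoc _ P, ← Matrix.mul_assoc _ S₂, hMPn, hMSn,
      Matrix.mul_assoc, Matrix.mul_assoc]
  -- The offsets are the values of the periodic part at the times `L * s + r`, which are past the
  -- preperiod and have phase `r`, with cleared denominators.
  obtain ⟨δ, hδ, w, hw⟩ := exists_common_denominator fun x : Fin (L + 1) × Fin m =>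
    (S₂ * (B ^ (L * s + x.1) * z)) x.2 0
  have hδ' : (δ : ℚ) ≠ 0 := by positivity
  set W : ℕ → Matrix (Fin m) (Fin 1) ℚ := fun r => (δ : ℚ) • (S₂ * (B ^ (L * s + r) * z)) with hW
  have hWint : ∀ r ≤ L, ∀ i j, ∃ x : ℤ, W r i j = x := fun r hr i j => ⟨w (⟨r, by omega⟩, i), by
    have := hw (⟨r, by omega⟩, i)
    dsimp only at this
    obtain rfl : j = 0 := Subsingleton.elim _ _
    change (δ : ℚ) * (S₂ * (B ^ (L * s + r) * z)) i 0 = _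
    rw [this, mul_div_cancel₀ _ hδ']⟩
  have hBper' : ∀ a n, s ≤ n → B ^ (n + L * a) = B ^ n := by
    intro a n hn
    induction a with
    | zero => simp
    | succ a ih =>
      obtain ⟨n', rfl⟩ := Nat.exists_eq_add_of_le hn
      have : s + n' + L * (a + 1) = (s + L) + (n' + L * a) := by ring
      rw [this, pow_add, hBper, ← pow_add, ← ih]
      congr 1
      ring
  have hsL : s ≤ L * s := Nat.le_mul_of_pos_left s hL
  have hMW : ∀ r, W (r + 1) = M * W r := by
    intro r
    simp only [hW]
    rw [Matrix.mul_smul, ← Matrix.mul_assoc M, hMS₂, ← add_assoc, pow_succ', Matrix.mul_assoc,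
      Matrix.mul_assoc]
  have hWL : W L = W 0 := by
    simp only [hW]
    have := hBper' 1 (L * s) hsL
    rw [mul_one] at this
    rw [this, add_zero]
  -- The boxes do not depend on the start time, so that the trajectory is in all of them from a
  -- suitable start time on.
  set pz : ℕ → ℕ → ℤ := fun i j => (extend P i j).num with hpz
  set wz : ℕ → ℕ → ℤ := fun r i => (extend (W r) i 0).num with hwz
  set H := numTargetsCode c with hH
  set box : ℕ → ℕ := fun t => pullbackConst m k (wz (t / H)) pz δ (targetCode c (t % H)) with hbox
  obtain ⟨q, hq⟩ : ∃ q : ℕ, ∀ t < L * H, box t ≤ q :=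
    ⟨(Finset.range (L * H)).sup box, fun t ht => Finset.le_sup (Finset.mem_range.2 ht)⟩
  set y' := (δ : ℚ) • y with hy'
  set C : ℚ := (∑ i, |y' i 0| + 1) * (q + 1) with hC
  have hsum0 : (0 : ℚ) ≤ ∑ i, |y' i 0| := Finset.sum_nonneg fun i _ => abs_nonneg _
  have hCpos : 0 < C := by positivity
  obtain ⟨N₁, hN₁⟩ := hsmall C⁻¹ (inv_pos.2 hCpos)
  obtain ⟨N₂, hN₂⟩ := hsmall ((k : ℚ) + 1)⁻¹ (by positivity)
  set p := N₂ + 1 with hp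
  set u := s + N₁ with hu
  set s₀ := L * u with hs₀
  have hs₀u : u ≤ s₀ := Nat.le_mul_of_pos_left u hL
  set V := A ^ s₀ * y' with hV
  have hVbox : ∀ (n : ℕ) (j : Fin k) (t : ℕ), t < L * H → |(A ^ n * V) j 0| * (box t : ℚ) < 1 := by
    intro n j t ht
    have h1 : |(A ^ n * V) j 0| ≤ C⁻¹ * ∑ i, |y' i 0| := by
      rw [hV, ← Matrix.mul_assoc, ← pow_add, Matrix.mul_apply, Finset.mul_sum]
      refine (Finset.abs_sum_le_sum_abs _ _).trans (Finset.sum_le_sum fun i _ => ?_)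
      rw [abs_mul]
      exact mul_le_mul_of_nonneg_right (hN₁ _ (by omega) j i).le (abs_nonneg _)
    have h2 : (box t : ℚ) ≤ q := by exact_mod_cast hq t ht
    calc |(A ^ n * V) j 0| * (box t : ℚ) ≤ (C⁻¹ * ∑ i, |y' i 0|) * q :=
          mul_le_mul h1 h2 (Nat.cast_nonneg _) (by positivity)
      _ = ((∑ i, |y' i 0|) * q) / C := by field_simp
      _ < 1 := by
          rw [div_lt_one hCpos, hC]
          have : (0 : ℚ) ≤ q := Nat.cast_nonneg q
          nlinarith
  have hAp : ∀ i, ∑ j, |(A ^ p) i j| < 1 := by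
    intro i
    have h1 : ∑ j, |(A ^ p) i j| ≤ ∑ _j : Fin k, ((k : ℚ) + 1)⁻¹ :=
      Finset.sum_le_sum fun j _ => (hN₂ p (by omega) i j).le
    refine h1.trans_lt ?_
    rw [Finset.sum_const, Finset.card_univ, Fintype.card_fin, nsmul_eq_mul, ← div_eq_mul_inv,
      div_lt_one (by positivity)]
    linarith
  have hUw : (δ : ℚ) • (M ^ s₀ * μ) = W 0 + P * V := by
    have h1 : B ^ s₀ = B ^ (L * s + 0) := by
      rw [hs₀, hu, Nat.mul_add, hBper' N₁ _ hsL, add_zero]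
    rw [htraj, h1, smul_add, add_comm, hV, hy', Matrix.mul_smul, Matrix.mul_smul]
  -- Up to the start time, the points of the trajectory have no common denominator that is known in
  -- advance, hence one is chosen for every point.
  have hUden : ∀ n, ∃ e : ℕ, 0 < e ∧ ∃ x : Fin m → ℤ, ∀ i : Fin m,
      (M ^ n * μ : Matrix (Fin m) (Fin 1) ℚ) i 0 = (x i : ℚ) / e :=
    fun n => exists_common_denominator fun i : Fin m => (M ^ n * μ) i 0
  choose e he x hx using hUden
  set X : ℕ → Matrix (Fin m) (Fin 1) ℚ := fun n => Matrix.of fun i _ => (x n i : ℚ) with hX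
  set xz : ℕ → ℕ → ℤ := fun n i => (extend (X n) i 0).num with hxz
  have hlet : ∀ n, ∃ b < 2 ^ H, ∀ i < H, b.testBit i = evalCode m (xz n) (e n) (targetCode c i) := by
    intro n
    obtain ⟨b, hb⟩ := exists_bits (Finset.univ.filter fun i : Fin H =>
      evalCode m (xz n) (e n) (targetCode c i) = true)
    refine ⟨b, b.2, fun i hi => ?_⟩
    have := congrArg (fun F => (⟨i, hi⟩ : Fin H) ∈ F) hb
    simp only [subsetOfBits, Finset.mem_filter, Finset.mem_univ, true_and] at this
    rw [Bool.eq_iff_iff]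
    exact iff_of_eq this
  choose b hb hb' using hlet
  set rs : ℕ → ℕ := fun n => Nat.rec (startState c) (fun n a => nextState c a (b n)) n with hrs
  -- All indices of entries that are used are at most `N`.
  set N := m + k + l' + L + s + p + u + s₀ + 20 with hN
  obtain ⟨l, hl⟩ := exists_list_of_entries (fun t n i j => match t with
    | 0 => (([k, l', L, s, p, δ, u].getD j 0 : ℕ) : ℚ)
    | 1 => extend A i j
    | 2 => extend A' i j
    | 3 => extend B i j
    | 4 => extend P i j
    | 5 => extend S₂ i j
    | 6 => extend Q i j
    | 7 => extend R i j
    | 8 => extend (A ^ n) i j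
    | 9 => extend (B ^ n) i j
    | 10 => extend (X n) i j
    | 11 => (e n : ℚ)
    | 12 => extend (W n) i j
    | 13 => extend V i j
    | 14 => extend (A ^ n * V) i j
    | 15 => (rs n : ℚ)
    | 16 => (b n : ℚ)
    | _ => 0) N
  refine ⟨l, ?_⟩
  have hpar : ∀ i ≤ 6, par l i = [k, l', L, s, p, δ, u].getD i 0 := fun i hi => by
    rw [par, hl, if_pos (by omega)]
    exact ratCode_natCast _
  have hk : dimA l = k := hpar 0 (by omega)
  have hl' : dimB l = l' := hpar 1 (by omega)
  have hLl : period l = L := hpar 2 (by omega)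
  have hsl : preperiod l = s := hpar 3 (by omega)
  have hpl : contrExp l = p := hpar 4 (by omega)
  have hδl : commonDen l = δ := hpar 5 (by omega)
  have hs₀l : startTime l = s₀ := by
    rw [startTime, hpar 2 (by omega), hpar 6 (by omega)]
    rfl
  have hAl : toMat k k (matA l) = A := toMat_eq_of_extend fun i hi j hj =>
    (hl 1 0 i j).trans (congrArg ratCode (if_pos (by omega)))
  have hA'l : toMat k k (matAinv l) = A' := toMat_eq_of_extend fun i hi j hj =>
    (hl 2 0 i j).trans (congrArg ratCode (if_pos (by omega)))
  have hBl : toMat l' l' (matB l) = B := toMat_eq_of_extend fun i hi j hj =>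
    (hl 3 0 i j).trans (congrArg ratCode (if_pos (by omega)))
  have hSl : toMat m l' (embB l) = S₂ := toMat_eq_of_extend fun i hi j hj =>
    (hl 5 0 i j).trans (congrArg ratCode (if_pos (by omega)))
  have hQl : toMat k m (projA l) = Q := toMat_eq_of_extend fun i hi j hj =>
    (hl 6 0 i j).trans (congrArg ratCode (if_pos (by omega)))
  have hRl : toMat l' m (projB l) = R := toMat_eq_of_extend fun i hi j hj =>
    (hl 7 0 i j).trans (congrArg ratCode (if_pos (by omega)))
  have hpowA : ∀ n ≤ p, toMat k k (powA l n) = A ^ n := fun n hn =>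
    toMat_eq_of_extend fun i hi j hj =>
      (hl 8 n i j).trans (congrArg ratCode (if_pos (by omega)))
  have hpowB : ∀ n ≤ s + L, toMat l' l' (powB l n) = B ^ n := fun n hn =>
    toMat_eq_of_extend fun i hi j hj =>
      (hl 9 n i j).trans (congrArg ratCode (if_pos (by omega)))
  have hVi : ∀ i < k, initA l i 0 = ratCode (extend V i 0) := fun i hi =>
    (hl 13 0 i 0).trans (congrArg ratCode (if_pos (by omega)))
  have hVl : toMat k 1 (initA l) = V := toMat_eq_of_extend fun i hi j hj => by
    obtain rfl : j = 0 := by omega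
    exact hVi i hi
  have hZl : ∀ n ≤ p, toMat k 1 (orbA l n) = A ^ n * V := fun n hn =>
    toMat_eq_of_extend fun i hi j hj => by
      obtain rfl : j = 0 := by omega
      exact (hl 14 n i 0).trans (congrArg ratCode (if_pos (by omega)))
  have hnum : ∀ {a : ℚ}, (∃ z : ℤ, a = z) → ((a.num : ℤ) : ℚ) = a := by
    rintro _ ⟨z, rfl⟩
    simp
  have hPl : embA l = pz := by
    funext i j
    by_cases h : i < m ∧ j < k
    · exact congrArg Prod.fst ((hl 4 0 i j).trans (congrArg ratCode (if_pos (by omega))))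
    · have h0 : extend P i j = 0 := dif_neg h
      have h1 := congrArg Prod.fst (hl 4 0 i j)
      simp only [h0, ite_self] at h1
      simp only [hpz, h0]
      exact h1
  have hvec : ∀ (t : ℕ) (Y : ℕ → Matrix (Fin m) (Fin 1) ℚ), t ≤ N → (∀ n ≤ N, ∀ i, ent l t n i 0 =
      ratCode (if t ≤ N ∧ n ≤ N ∧ i ≤ N ∧ 0 ≤ N then extend (Y n) i 0 else 0)) →
      ∀ n ≤ N, (fun i => (ent l t n i 0).1) = fun i => (extend (Y n) i 0).num := by
    intro t Y ht h n hn
    funext i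
    rw [h n hn]
    split_ifs with h'
    · rfl
    · by_cases hi : i < m
      · exact absurd ⟨ht, hn, by omega, Nat.zero_le _⟩ h'
      · rw [extend_of_le_left _ _ (not_lt.1 hi)]
        rfl
  have hWl : ∀ n ≤ N, offset l n = wz n := hvec 12 W (by omega) fun n _ i => hl 12 n i 0
  have hXl : ∀ n ≤ N, orbNum l n = xz n := hvec 10 X (by omega) fun n _ i => hl 10 n i 0
  have hel : ∀ n ≤ N, orbDen l n = e n := fun n hn => by
    rw [orbDen, hl, if_pos (by omega)]
    exact ratCode_natCast _
  have hrl : ∀ n ≤ N, runState l n = rs n := fun n hn => by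
    rw [runState, hl, if_pos (by omega)]
    exact ratCode_natCast _
  have hbl : ∀ n ≤ N, letter l n = b n := fun n hn => by
    rw [letter, hl, if_pos (by omega)]
    exact ratCode_natCast _
  have hPm : (toMat m k fun i j => rawInt (pz i j)) = P := by
    ext i j
    rw [toMat_apply, ratVal_rawInt, hpz]
    dsimp only
    rw [extend_apply, hnum (hPint i j)]
  have hWm : ∀ r ≤ L, (toMat m 1 fun i _ => rawInt (wz r i)) = W r := by
    intro r hr
    ext i j
    obtain rfl : j = 0 := Subsingleton.elim _ _
    rw [toMat_apply, ratVal_rawInt, hwz]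
    exact (congrArg (fun a : ℚ => ((a.num : ℤ) : ℚ)) (extend_apply (W r) i 0)).trans
      (hnum (hWint r hr i 0))
  have hXm : ∀ n ≤ s₀, toMat m 1 (orbVec l n) = M ^ n * μ := by
    intro n hn
    ext i j
    obtain rfl : j = 0 := Subsingleton.elim _ _
    have h1 : xz n i = x n i := by
      have h2 : extend (X n) i 0 = (x n i : ℚ) := extend_apply (X n) i 0
      rw [hxz]
      dsimp only
      rw [h2, Rat.num_intCast]
    rw [toMat_apply, orbVec, hXl n (by omega), hel n (by omega), ratVal_mk (he n).ne', h1, hx]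
  simp only [ok, okDecomposition, okPowers, okOrbit, okBox, okRun, okReduced, Bool.and_eq_true,
    rawMatEq_iff, toMat_rawMatMul, toMat_add, toMat_smul, toMat_one, toMat_zero,
    List.all_eq_true, List.mem_range, bne_iff_ne, beq_iff_eq, rawReduced_iff, decide_eq_true_iff,
    rawLe_eq_false_iff, ratVal_one, ratVal_rawSum, ratVal_rawAbs, ratVal_rawRatMul, ratVal_rawInt,
    hk, hl', hLl, hsl, hpl, hδl, hs₀l, ← hm, ← hMdef, ← hμ, hAl, hA'l, hBl, hSl, hQl, hRl, hVl, hPl, hPm,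
    ← hH]
  have hred : ∀ {a : ℚ} {r : ℤ × ℕ}, r = ratCode a → ratCode (ratVal r) = r := by
    rintro a _ rfl
    rw [ratVal_ratCode]
  refine ⟨⟨hkl, hMP, hMS₂, hQP, hQS, hRP, hRS, hA', ?_⟩,
    ⟨by omega, by omega, ?_, fun n hn => ?_, fun i hi => ?_, ?_, fun n hn => ?_, ?_⟩,
    ⟨by omega, fun n hn => ?_, ?_, fun n hn => ?_, ?_, fun r hr => ?_, ?_⟩,
    ⟨?_, fun n hn => ?_, fun n hn t ht j hj => ?_⟩, ⟨?_, fun n hn => ⟨?_, fun i hi => ?_, ?_⟩⟩,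
    fun i hi => ⟨hred (hVi i hi), fun j hj => ?_⟩⟩
  · ext i j
    rw [Matrix.mul_apply]
    simp only [toMat_apply, ratVal_one, one_mul, hPcol, Matrix.zero_apply]
  · rw [hpowA 0 (Nat.zero_le _), pow_zero]
  · rw [hpowA (n + 1) hn, hpowA n hn.le, pow_succ']
  · have h1 := hAp ⟨i, hi⟩
    rw [← hpowA p le_rfl] at h1
    exact h1
  · rw [hpowB 0 (Nat.zero_le _), pow_zero]
  · rw [hpowB (n + 1) hn, hpowB n hn.le, pow_succ']
  · rw [hpowB _ le_rfl, hpowB _ (Nat.le_add_right _ _), hBper]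
  · rw [hel n (by omega)]
    exact (he n).ne'
  · rw [hXm 0 (Nat.zero_le _), pow_zero, Matrix.one_mul]
  · rw [hXm (n + 1) hn, hXm n hn.le, pow_succ', Matrix.mul_assoc]
  · rw [hWl 0 (Nat.zero_le _), hWm 0 (Nat.zero_le _), ← hUw, ← hXm s₀ le_rfl, Int.cast_natCast]
  · rw [hWl r (by omega), hWl (r + 1) (by omega), hWm r hr.le, hWm (r + 1) hr, hMW]
  · rw [hWl L (by omega), hWl 0 (by omega), hWm L le_rfl, hWm 0 (by omega), hWL]
  · rw [hZl 0 (Nat.zero_le _), pow_zero, Matrix.one_mul]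
  · rw [hZl (n + 1) hn, hZl n hn.le, pow_succ', Matrix.mul_assoc]
  · have h1 := hVbox n ⟨j, hj⟩ t ht
    rw [← hZl n hn.le] at h1
    have h2 : t / H < L := Nat.div_lt_of_lt_mul (by rwa [mul_comm] at ht)
    rw [hWl (t / H) (by omega)]
    exact_mod_cast h1
  · exact hrl 0 (Nat.zero_le _)
  · rw [hbl n (by omega)]
    exact hb n
  · rw [hbl n (by omega), hXl n (by omega), hel n (by omega)]
    exact hb' n i hi
  · rw [hrl (n + 1) (by omega), hrl n (by omega), hbl n (by omega)]
  · exact hred ((hl 1 0 i j).trans (congrArg ratCode (if_pos (by omega))))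

end DistMC

namespace DistMC

/-! ### The reduction -/

/-- The search for a certificate; on codes that do not belong to a stochastic matrix and an initial
vector with sum `1`, it stops at once. -/
theorem computable_search : ∃ g : InstanceCode → List (ℤ × ℕ), Computable g ∧
    ∀ c, isMarkovCode c = true → ok c (g c) = true := by
  classical
  let cert : ℕ → List (ℤ × ℕ) := fun n => (Encodable.decode n : Option (List (ℤ × ℕ))).getD []
  have hcert : Primrec cert := Primrec.option_getD.comp Primrec.decode (Primrec.const [])
  let test : InstanceCode → ℕ → Bool := fun c n => !isMarkovCode c || ok c (cert n)
  have htest : Primrec₂ test :=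
    Primrec.or.comp (Primrec.not.comp (primrec_isMarkovCode Primrec.fst))
      (primrec_ok Primrec.fst (hcert.comp Primrec.snd))
  have hex : ∀ c, ∃ n, test c n = true := by
    intro c
    by_cases hc : isMarkovCode c = true
    · obtain ⟨l, hl⟩ := exists_cert hc
      exact ⟨Encodable.encode l, by simp [test, cert, hl]⟩
    · exact ⟨0, by simp [test, hc]⟩
  have hfind : Computable fun c => Nat.find (hex c) := by
    refine (Partrec.rfind (p := fun c n => Part.some (test c n)) htest.to_comp.partrec₂).of_eq
      fun c => ?_
    refine Part.eq_some_iff.2 (Nat.mem_rfind.2 ⟨?_, fun {n} hn => ?_⟩)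
    · rw [Nat.find_spec (hex c)]
      exact Part.mem_some _
    · rw [Bool.eq_false_of_not_eq_true (Nat.find_min (hex c) hn)]
      exact Part.mem_some _
  refine ⟨fun c => cert (Nat.find (hex c)), hcert.to_comp.comp hfind, fun c hc => ?_⟩
  have h : test c (Nat.find (hex c)) = true := Nat.find_spec (hex c)
  have h' : (!isMarkovCode c || ok c (cert (Nat.find (hex c)))) = true := h
  rwa [hc, Bool.not_true, Bool.false_or] at h'

theorem computable_apply_pair {α β γ : Type*} [Primcodable α] [Primcodable β] [Primcodable γ]
    {F : α → β → γ} (hF : Primrec₂ F) {g : α → β} (hg : Computable g) :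
    Computable fun a => F a (g a) :=
  hF.to_comp.comp Computable.id hg

theorem primrec₂_reduceBy : Primrec₂ reduceBy :=
  primrec_reduceBy Primrec.fst Primrec.snd

end DistMC

theorem theorem1 :
    ∃ f : DistMC.InstanceCode → DistMC.InstanceCode, Computable f ∧
      ∀ (I : DistMC.Instance) (k d₁ d₂ : ℕ), 1 ≤ d₂ →
        I.IsMarkovChain →
        DistMC.dynamicalDim I.mat = k →
        (∀ i, DistMC.intrinsicDim (I.target i).toSet ≤ (d₁ : WithBot ℕ∞) ∧
          DistMC.linearDim (I.target i).toSet ≤ d₂) →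
        ∃ J : DistMC.Instance, f I.code = J.code ∧
          J.dim = k ∧ IsUnit J.mat ∧
          (∀ j, DistMC.intrinsicDim (J.target j).toSet ≤ (d₁ : WithBot ℕ∞) ∧
            DistMC.linearDim (J.target j).toSet ≤ d₂ - 1) ∧
          (I.Holds ↔ J.Holds) := by
  obtain ⟨g, hg, hok⟩ := DistMC.computable_search
  refine ⟨fun c => DistMC.reduceBy c (g c), ?_, fun I k d₁ d₂ _ hI hk hdim => ?_⟩
  · exact DistMC.computable_apply_pair DistMC.primrec₂_reduceBy hg
  · obtain ⟨J, hJ, hJd, hJu, hJt, hJh⟩ := DistMC.exists_reduceBy I hI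
      (hok _ (DistMC.isMarkovCode_code hI))
    refine ⟨J, hJ, hJd.trans hk, hJu, fun j => ?_, hJh⟩
    obtain ⟨i, h1, h2⟩ := hJt j
    exact ⟨h1.trans (hdim i).1, h2.trans (Nat.sub_le_sub_right (hdim i).2 1)⟩
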